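/- Let $d\ge 1$, $L>0$, and let $\mathbb T^d=(\mathbb R/L\mathbb Z)^d$. Let $\alpha\in[\tfrac12,1]$ and $q\in[1,\infty)$ satisfy $q(1-\alpha)=d$. For a vector field $f$ on $\mathbb T^d$ let $\hat f_k=L^{-d}\int_{\mathbb T^d} f(x)e^{-2\pi i k\cdot x/L}\,dx$ for $k\in\mathbb Z^d$, let $P_Nf=\sum_{|k|_\infty\le N}\hat f_k e^{2\pi i k\cdot x/L}$, let $$\mathbf P_N f=\sum_{|k|_\infty\le N}\Big(\hat f_k-\frac{\hat f_k\cdot k}{|k|^2}k\Big)e^{2\pi i k\cdot x/L}$$ (the mode $k=0$ being left unchanged), and let $\|f\|_{H^{-\alpha}}=\big(\tfrac{2\pi}{L}\big)^{-\alpha}\big\|\sum_{k\neq0}|k|^{-\alpha}\hat f_k e^{2\pi i k\cdot x/L}\big\|_{L^2(\mathbb T^d)}$. Let $U\in L^\infty((0,\infty);W^{1,q}(\mathbb T^d;\mathbb R^d))$ be divergence free, and let $u_0\in L^2(\mathbb T^d;\mathbb R^d)$ be divergence free with mean zero. For $N\in\mathbb N$ put $U_N=P_NU$ and let $u_N$ be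 a solution, with frequencies $|k|_\infty\le N$, of $$\partial_t u_N+\mathbf P_N\big((U_N\cdot\nabla)u_N\big)=0,\qquad u_N(0)=\mathbf P_Nu_0$$ (in integrated form in time). Then for every $r\in[1,\infty)$ there is a constant $C_r>0$, depending only on $r,\alpha,q,d,L$, such that for all such $U$ and $u_0$ the following hold, where $p=\frac{1-\alpha}{\alpha}+\frac{d}{\alpha r}$ and $[x]_+=\max(x,0)$. 1. For every $N$ and every $t\ge 0$, $$\|u_N(t)\|_{H^{-\alpha}}\ge\Big[\|u_N(0)\|_{H^{-\alpha}}^{p}-p\,C_r\,t\,\|\nabla U_N\|_{L^\infty_tL^q_x}\|u_N(0)\|_{L^2}^{p}\Big]_+^{\frac{\alpha r}{r-\alpha r+d}}.$$ 2. Let $u\in L^\infty((0,\infty);L^2(\mathbb T^d))$ be the limit of a subsequence of $(u_N)_N$, weakly-$*$ in $L^\infty((0,T);L^2(\mathbb T^d))$ for every $T>0$. Then $u$ has, after modification on a null set of times, a representative with values in $L^2(\mathbb T^d)$ that is continuous on $[0,\infty)$ in $H^{-\alpha}$ and satisfies $u(0)=u_0$, and for every $t\ge0$ $$\|u(t)\|_{H^{-\alpha}}\ge\Big[\|u_0\|_{H^{-\alpha}}^{p}-p\,C_r\,t\,\|\nabla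 U\|_{L^\infty_tL^q_x}\|u_0\|_{L^2}^{p}\Big]_+^{\frac{\alpha r}{r-\alpha r+d}}.$$ 3. Consequently $\|u(t)\|_{H^{-\alpha}}>0$ for every $0\le t<t_{\min}$, where $$t_{\min}=\frac{\alpha r\,\|u_0\|_{H^{-\alpha}}^{p}}{(r-\alpha r+d)\,C_r\,\|u_0\|_{L^2}^{p}\,\|\nabla U\|_{L^\infty_tL^q_x}}$$ (with $t_{\min}=\infty$ if $u_0\ne0$ and $\nabla U=0$, and $t_{\min}=0$ if $u_0=0$). -/

import Mathlib

open MeasureTheory Filter Topology Set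
open scoped ENNReal NNReal ContDiff

noncomputable section

namespace VectorMixing

/-- The `d`-dimensional torus of side length `L`; its volume is the Lebesgue measure of total
mass `L ^ d` as soon as `0 < L`. -/
abbrev Torus (d : ℕ) (L : ℝ) : Type := Fin d → AddCircle L

/-- `ℝ^d` with the Euclidean norm. -/
abbrev Vec (d : ℕ) : Type := EuclideanSpace ℝ (Fin d)

/-- `d × d` matrices with the Frobenius norm; the entry `(i, j)` of a gradient is `∂_j f_i`. -/
abbrev Mat (d : ℕ) : Type := EuclideanSpace ℝ (Fin d × Fin d)

variable {d : ℕ} {L : ℝ}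

/-! ### Calculus on the torus -/

/-- The classical partial derivative `∂_j f` at `x`. -/
def partialDeriv (j : Fin d) (f : Torus d L → ℝ) (x : Torus d L) : ℝ :=
  deriv (fun s : ℝ => f (x + Pi.single j (s : AddCircle L))) 0

/-- Smooth functions on the torus: the periodic lift to `ℝ^d` is `C^∞`. -/
def IsSmooth (f : Torus d L → ℝ) : Prop :=
  ContDiff ℝ ∞ (fun y : Fin d → ℝ => f (fun i => (y i : AddCircle L)))

/-- The classical gradient of a vector field, with entries `∂_j f_i`. -/
def gradient (f : Torus d L → Vec d) (x : Torus d L) : Mat d :=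
  WithLp.toLp 2 (fun p : Fin d × Fin d => partialDeriv p.2 (fun y => f y p.1) x)

/-- `(V · ∇) v`, with components `∑ j, V_j ∂_j v_i`. -/
def advect (V v : Torus d L → Vec d) (x : Torus d L) : Vec d :=
  WithLp.toLp 2 (fun i : Fin d => ∑ j : Fin d, V x j * partialDeriv j (fun y => v y i) x)

/-- `f` is divergence free in the sense of distributions. -/
def IsDivFree [Fact (0 < L)] (f : Torus d L → Vec d) : Prop :=
  ∀ η : Torus d L → ℝ, IsSmooth η → ∫ x, ∑ j : Fin d, f x j * partialDeriv j η x = 0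

/-- `G` is the weak gradient of `f`: `∫ f_i ∂_j η = - ∫ G_{ij} η` for all test functions `η`. -/
def IsWeakGradient [Fact (0 < L)] (f : Torus d L → Vec d) (G : Torus d L → Mat d) : Prop :=
  ∀ η : Torus d L → ℝ, IsSmooth η → ∀ i j : Fin d,
    ∫ x, f x i * partialDeriv j η x = - ∫ x, G x (i, j) * η x

/-! ### Fourier series -/

/-- The character `x ↦ exp (2 π i k · x / L)`. -/
def character (k : Fin d → ℤ) (x : Torus d L) : ℂ := ∏ i : Fin d, fourier (k i) (x i)

/-- The Fourier coefficient `L ^ (-d) ∫ f(x) exp (- 2 π i k · x / L) dx` in `ℂ^d`. -/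
def fourierCoeffVec [Fact (0 < L)] (f : Torus d L → Vec d) (k : Fin d → ℤ) (i : Fin d) : ℂ :=
  ((L ^ d)⁻¹ : ℝ) * ∫ x, (f x i : ℂ) * character (-k) x

/-- The Euclidean length of a frequency. -/
def freqNorm (k : Fin d → ℤ) : ℝ := √(∑ i : Fin d, (k i : ℝ) ^ 2)

/-- The frequencies with `|k|_∞ ≤ N`. -/
def freqBox (d N : ℕ) : Finset (Fin d → ℤ) :=
  Fintype.piFinset (fun _ => Finset.Icc (-(N : ℤ)) (N : ℤ))

/-- `P_N f = ∑_{|k|_∞ ≤ N} f̂_k exp (2 π i k · x / L)`. The sum is real because `f` is real. -/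
def truncate [Fact (0 < L)] (N : ℕ) (f : Torus d L → Vec d) (x : Torus d L) : Vec d :=
  WithLp.toLp 2 (fun i : Fin d =>
    (∑ k ∈ freqBox d N, fourierCoeffVec f k i * character k x).re)

/-- The projection onto divergence-free fields with frequencies `|k|_∞ ≤ N`:
`∑_{|k|_∞ ≤ N} (f̂_k - (f̂_k · k) k / |k|²) exp (2 π i k · x / L)`; the mode `k = 0` is kept. -/
def lerayTruncate [Fact (0 < L)] (N : ℕ) (f : Torus d L → Vec d) (x : Torus d L) : Vec d :=
  WithLp.toLp 2 (fun i : Fin d =>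
    (∑ k ∈ freqBox d N,
      (fourierCoeffVec f k i
        - (∑ j : Fin d, fourierCoeffVec f k j * (k j : ℂ)) / ((freqNorm k ^ 2 : ℝ) : ℂ) * (k i : ℂ))
      * character k x).re)

/-! ### Norms -/

/-- The homogeneous `H^s` norm `(2π/L)^s ‖∑_k |k|^s f̂_k exp (2 π i k · x / L)‖_{L²}`, with the
`L²` norm written through Parseval. For `s ≠ 0` the mode `k = 0` has weight `0`. For `s ≤ 0` the
series converges for every `f ∈ L²`. -/
def homSobolevNorm [Fact (0 < L)] (s : ℝ) (f : Torus d L → Vec d) : ℝ :=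
  (2 * Real.pi / L) ^ s *
    √(L ^ d * ∑' k : Fin d → ℤ,
      (freqNorm k ^ s) ^ 2 * ∑ i : Fin d, ‖fourierCoeffVec f k i‖ ^ 2)

/-- The `L²` norm. -/
def l2Norm [Fact (0 < L)] (f : Torus d L → Vec d) : ℝ := (eLpNorm f 2 volume).toReal

/-- Lebesgue measure on the time axis `(0, ∞)`. -/
def timeMeasure : Measure ℝ := volume.restrict (Ioi 0)

/-- The norm of `L^∞((0,∞); L^q)`. -/
def supLqNorm [Fact (0 < L)] (q : ℝ) (G : ℝ → Torus d L → Mat d) : ℝ :=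
  (essSup (fun t => eLpNorm (G t) (ENNReal.ofReal q) volume) timeMeasure).toReal

/-! ### The transport problem -/

/-- `U` is a divergence-free field in `L^∞((0,∞); W^{1,q})`, with spatial weak gradient `G`. -/
structure IsAdmissibleVelocity [Fact (0 < L)] (q : ℝ) (U : ℝ → Torus d L → Vec d)
    (G : ℝ → Torus d L → Mat d) : Prop where
  measurable : AEStronglyMeasurable (fun p : ℝ × Torus d L => U p.1 p.2)
    (timeMeasure.prod volume)
  divFree : ∀ᵐ t ∂timeMeasure, IsDivFree (U t)
  weakGradient : ∀ᵐ t ∂timeMeasure, IsWeakGradient (U t) (G t)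
  bound : ∃ K : ℝ≥0, ∀ᵐ t ∂timeMeasure,
    MemLp (U t) (ENNReal.ofReal q) volume ∧ MemLp (G t) (ENNReal.ofReal q) volume ∧
      eLpNorm (U t) (ENNReal.ofReal q) volume + eLpNorm (G t) (ENNReal.ofReal q) volume ≤ K

/-- Mean-zero, divergence-free initial data in `L²`. -/
structure IsInitialDatum [Fact (0 < L)] (u₀ : Torus d L → Vec d) : Prop where
  memLp : MemLp u₀ 2 volume
  divFree : IsDivFree u₀
  mean_zero : ∫ x, u₀ x = 0

/-- `v` is the spectral approximation with `N` modes: `v` has frequencies `|k|_∞ ≤ N`,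
`v(0) = 𝐏_N u₀` and `∂_t v + 𝐏_N ((P_N U · ∇) v) = 0`. The evolution equation is written in
integrated form, since `U` is only measurable in time. -/
structure IsSpectralSolution [Fact (0 < L)] (N : ℕ) (U : ℝ → Torus d L → Vec d)
    (u₀ : Torus d L → Vec d) (v : ℝ → Torus d L → Vec d) : Prop where
  modes : ∀ t, 0 ≤ t → v t = truncate N (v t)
  continuous : ∀ x, ContinuousOn (fun t => v t x) (Ici 0)
  initial : v 0 = lerayTruncate N u₀
  evolution : ∀ t, 0 ≤ t → ∀ x,
    v t x = v 0 x - ∫ s in (0 : ℝ)..t, lerayTruncate N (advect (truncate N (U s)) (v s)) x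

/-- `u` belongs to `L^∞((0,∞); L²)` and is the weak-* limit in `L^∞_loc([0,∞); L²)` of some
subsequence of `v`. -/
def IsSubsequentialLimit [Fact (0 < L)] (v : ℕ → ℝ → Torus d L → Vec d)
    (u : ℝ → Torus d L → Vec d) : Prop :=
  AEStronglyMeasurable (fun p : ℝ × Torus d L => u p.1 p.2) (timeMeasure.prod volume) ∧
  (∃ K : ℝ≥0, ∀ᵐ t ∂timeMeasure, MemLp (u t) 2 volume ∧ eLpNorm (u t) 2 volume ≤ K) ∧
  ∃ n : ℕ → ℕ, StrictMono n ∧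
    ∀ T : ℝ, 0 < T → ∀ g : ℝ → Torus d L → Vec d,
      AEStronglyMeasurable (fun p : ℝ × Torus d L => g p.1 p.2)
        ((volume.restrict (Ioc 0 T)).prod volume) →
      ∫⁻ t in Ioc 0 T, eLpNorm (g t) 2 volume < ⊤ →
      Tendsto (fun j => ∫ t in (0 : ℝ)..T, ∫ x, inner ℝ (v (n j) t x) (g t x)) atTop
        (𝓝 (∫ t in (0 : ℝ)..T, ∫ x, inner ℝ (u t x) (g t x)))

/-- `w` coincides with `u` for almost every time, takes values in `L²`, starts from `u₀`, and is
continuous on `[0,∞)` with respect to the homogeneous `H^s` norm. -/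
structure IsContinuousRepresentative [Fact (0 < L)] (s : ℝ) (u₀ : Torus d L → Vec d)
    (u w : ℝ → Torus d L → Vec d) : Prop where
  ae_eq : ∀ᵐ t ∂timeMeasure, w t =ᵐ[volume] u t
  memLp : ∀ t, 0 ≤ t → MemLp (w t) 2 volume
  initial : w 0 =ᵐ[volume] u₀
  continuous : ∀ t, 0 ≤ t →
    Tendsto (fun τ => homSobolevNorm s (fun x => w τ x - w t x)) (𝓝[Ici 0] t) (𝓝 0)

/-! ### The lower bound and the minimal mixing time -/

/-- `(1 - α) / α + d / (α r)`. -/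
def mixingPower (d : ℕ) (α r : ℝ) : ℝ := (1 - α) / α + d / (α * r)

/-- `[h^p - p C t g e^p]_+ ^ (α r / (r - α r + d))` with `p = (1 - α) / α + d / (α r)`, where `h`,
`e` are the `H^{-α}` and `L²` norms of the initial field and `g` is the norm of the velocity
gradient. -/
def mixingLowerBound (d : ℕ) (α r C t h e g : ℝ) : ℝ :=
  (max (h ^ mixingPower d α r
      - mixingPower d α r * C * t * g * e ^ mixingPower d α r) 0) ^ (α * r / (r - α * r + d))

/-- `α r h^p / ((r - α r + d) C e^p g)`, which is `∞` if only the denominator vanishes. -/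
def minimalMixingTime (d : ℕ) (α r C h e g : ℝ) : ℝ≥0∞ :=
  ENNReal.ofReal (α * r * h ^ mixingPower d α r) /
    ENNReal.ofReal ((r - α * r + d) * C * e ^ mixingPower d α r * g)

end VectorMixing

end

open scoped ComplexConjugate

namespace VectorMixing

variable {d : ℕ} {L : ℝ}

/-! ### Characters -/

/-! Let y be the square of the H^{-α} norm of a solution. Transport by a divergence-free field is
skew-adjoint, so the L² norm is conserved and y' is given by a commutator of (-Δ)^{-α} with U·∇; the
Leray projection is invisible against a divergence-free field. The key estimate is |y'| ≤ C
‖∇U‖_{L^q} ‖u‖_{H^{-α}}^{2-p₀} ‖u‖_{L²}^{p₀} with p₀ = (1-α)/α. It lets y^{p₀/2} decrease at most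
linearly, which is the lower bound for the exponent p₀ (`rpow_sub_le_rpow_of_integral`). The
exponents p ≥ p₀ of the theorem follow from Bernoulli's inequality and the Poincaré inequality
‖u‖_{H^{-α}} ≤ (2π/L)^{-α} ‖u‖_{L²} (`max_rpow_le_of_rpow_sub_le`).

The commutator is estimated through Hölder continuity alone. Since 1 - d/q = α, Morrey's inequality
(`norm_trigPoly_add_sub_le`) bounds the α-Hölder seminorm of the velocity by its gradient.
Multiplication by an α-Hölder function commutes with the translation by z up to O(|z|^α), and the
heat semigroup at time s is a Gaussian average of translations, so its commutator with U·∇ gains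
s^{α/2} and loses one derivative (`norm_heat_transport_commutator_le`). In Γ(α)(-Δ)^{-α} = ∫ s^{α-1}
e^{sΔ} ds the small times are controlled by the L² norm and the large times by the negative norm;
the regimes meet where s^{α/2} ‖u‖_{L²} = ‖u‖_{H^{-α}} (`exists_negCommutator_bound`).

For the limit the bound must involve ∇U and not ∇P_N U. The gradient of the Fejér mean is bounded in
L^q by that of U, so the mean is uniformly Hölder, and it differs from P_N U by a field that
vanishes uniformly: the approximation rate of Fejér means beats the growth of the Lebesgue constants
(`norm_trigPoly_sub_fejerMean_le`, `tendsto_dirichletError`). The remainder is harmless because α ≥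
1/2 makes (-Δ)^{-α}∇ bounded on L² (`norm_transport_le`). The Fourier coefficients of u_N are
Lipschitz in time uniformly in N, hence converge at every time along the subsequence; bounded energy
and decaying weights give convergence of the negative norms, and the integrated differential
inequality passes to the limit (`exists_representative_mixingLowerBound_le`). -/

theorem character_add_apply (k : Fin d → ℤ) (x y : Torus d L) :
    character k (x + y) = character k x * character k y := by
  simp only [character, ← Finset.prod_mul_distrib]
  refine Finset.prod_congr rfl fun i _ => ?_
  simp [fourier_apply, smul_add, AddCircle.toCircle_add]

theorem character_add (k l : Fin d → ℤ) (x : Torus d L) :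
    character (k + l) x = character k x * character l x := by
  simp only [character, ← Finset.prod_mul_distrib, Pi.add_apply, fourier_add]

theorem character_neg (k : Fin d → ℤ) (x : Torus d L) :
    character (-k) x = conj (character k x) := by
  simp only [character, Pi.neg_apply, fourier_neg, map_prod]

@[simp] theorem character_apply_zero (k : Fin d → ℤ) : character k (0 : Torus d L) = 1 := by
  simp [character]

@[simp] theorem norm_character (k : Fin d → ℤ) (x : Torus d L) : ‖character k x‖ = 1 := by
  simp only [character, norm_prod, fourier_apply, Circle.norm_coe, Finset.prod_const_one]

@[fun_prop] theorem continuous_character (k : Fin d → ℤ) :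
    Continuous (character k : Torus d L → ℂ) := by
  unfold character
  fun_prop

theorem character_coe (k : Fin d → ℤ) (y : Fin d → ℝ) :
    character k (fun i => (y i : AddCircle L)) =
      Complex.exp (Complex.I * ((2 * Real.pi / L * ∑ i, (k i : ℝ) * y i : ℝ) : ℂ)) := by
  simp only [character, fourier_coe_apply, ← Complex.exp_sum]
  congr 1
  push_cast
  rw [Finset.mul_sum, Finset.mul_sum]
  refine Finset.sum_congr rfl fun i _ => ?_
  ring

theorem character_mul_conj (k l : Fin d → ℤ) (x : Torus d L) :
    character k x * conj (character l x) = character (k - l) x := by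
  rw [sub_eq_add_neg, character_add, character_neg]

theorem hasDerivAt_character_single (k : Fin d → ℤ) (j : Fin d) (x : Torus d L) (s : ℝ) :
    HasDerivAt (fun s : ℝ => character k (x + Pi.single j (s : AddCircle L)))
      (Complex.I * ((2 * Real.pi / L * k j : ℝ) : ℂ) *
        character k (x + Pi.single j (s : AddCircle L))) s := by
  have h1 : ∀ s : ℝ, character k (Pi.single j (s : AddCircle L) : Torus d L)
      = fourier (k j) (s : AddCircle L) := by
    intro s
    rw [character, Finset.prod_eq_single j]
    · simp
    · intro i _ hi
      simp [Pi.single_eq_of_ne hi]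
    · simp
  simp only [character_add_apply, h1]
  have := (hasDerivAt_fourier L (k j) s).const_mul (character k x)
  rw [show Complex.I * ((2 * Real.pi / L * k j : ℝ) : ℂ) *
      (character k x * fourier (k j) (s : AddCircle L)) = character k x *
      (2 * Real.pi * Complex.I * k j / L * fourier (k j) (s : AddCircle L)) by push_cast; ring]
  exact this

section Measure

variable [hL : Fact (0 < L)]

theorem integral_fourier (n : ℤ) :
    ∫ x : AddCircle L, fourier n x = if n = 0 then (L : ℂ) else 0 := by
  split_ifs with h
  · subst h
    simp [Measure.real, AddCircle.measure_univ, hL.out.le]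
  · have h2 := fourierCoeff_fourier (T := L) n
    have h3 := congrFun h2 0
    simp only [fourierCoeff, neg_zero, fourier_zero, one_smul] at h3
    rw [AddCircle.integral_haarAddCircle, Pi.single_eq_of_ne (Ne.symm h)] at h3
    have hL0 : L⁻¹ ≠ 0 := inv_ne_zero hL.out.ne'
    exact (smul_eq_zero.1 h3).resolve_left hL0

theorem integral_character (k : Fin d → ℤ) :
    ∫ x : Torus d L, character k x = if k = 0 then ((L ^ d : ℝ) : ℂ) else 0 := by
  unfold character
  rw [integral_fintype_prod_volume_eq_prod (fun i x => fourier (k i) x)]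
  simp only [integral_fourier]
  split_ifs with h
  · subst h
    simp
  · obtain ⟨i, hi⟩ := Function.ne_iff.1 h
    exact Finset.prod_eq_zero (Finset.mem_univ i) (if_neg hi)

end Measure

end VectorMixing

open scoped ComplexConjugate

namespace VectorMixing

variable {d : ℕ} {L : ℝ}

/-! ### Trigonometric polynomials -/

/-- The trigonometric polynomial `∑_{k ∈ K} a_k exp (2 π i k · x / L)`. -/
noncomputable def trigPoly (K : Finset (Fin d → ℤ)) (a : (Fin d → ℤ) → ℂ) (x : Torus d L) : ℂ :=
  ∑ k ∈ K, a k * character k x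

/-- The Fourier symbol `2 π i k_j / L` of `∂_j`. -/
noncomputable def derivSymbol (L : ℝ) (j : Fin d) (k : Fin d → ℤ) : ℂ :=
  Complex.I * ((2 * Real.pi / L * k j : ℝ) : ℂ)

/-- The Fourier symbol `(2 π / L)² |k|²` of `-Δ`. -/
noncomputable def laplaceSymbol (L : ℝ) (k : Fin d → ℤ) : ℝ := (2 * Real.pi / L) ^ 2 * ∑ i, (k i : ℝ) ^ 2

/-- The square root of `∑_{k ∈ K} |a_k|²`. -/
noncomputable def l2Coeff {ι : Type*} (K : Finset ι) (a : ι → ℂ) : ℝ := √(∑ k ∈ K, ‖a k‖ ^ 2)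

theorem l2Coeff_nonneg {ι : Type*} (K : Finset ι) (a : ι → ℂ) : 0 ≤ l2Coeff K a :=
  Real.sqrt_nonneg _

theorem sq_l2Coeff {ι : Type*} (K : Finset ι) (a : ι → ℂ) :
    l2Coeff K a ^ 2 = ∑ k ∈ K, ‖a k‖ ^ 2 :=
  Real.sq_sqrt (Finset.sum_nonneg fun _ _ => by positivity)

theorem l2Coeff_le_mul {ι : Type*} {K : Finset ι} {a b : ι → ℂ} {c : ℝ} (hc : 0 ≤ c)
    (h : ∀ k ∈ K, ‖a k‖ ≤ c * ‖b k‖) : l2Coeff K a ≤ c * l2Coeff K b := by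
  refine Real.sqrt_le_iff.2 ⟨mul_nonneg hc (l2Coeff_nonneg K b), ?_⟩
  rw [mul_pow, sq_l2Coeff, Finset.mul_sum]
  refine Finset.sum_le_sum fun k hk => ?_
  rw [← mul_pow]
  exact pow_le_pow_left₀ (norm_nonneg _) (h k hk) 2

theorem l2Coeff_mono {ι : Type*} {K : Finset ι} {a b : ι → ℂ}
    (h : ∀ k ∈ K, ‖a k‖ ≤ ‖b k‖) : l2Coeff K a ≤ l2Coeff K b := by
  simpa using l2Coeff_le_mul (c := 1) zero_le_one (by simpa using h)

theorem laplaceSymbol_nonneg (k : Fin d → ℤ) : 0 ≤ laplaceSymbol L k :=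
  mul_nonneg (sq_nonneg _) (Finset.sum_nonneg fun _ _ => sq_nonneg _)

theorem one_le_sum_sq {k : Fin d → ℤ} (hk : k ≠ 0) : (1 : ℝ) ≤ ∑ i, (k i : ℝ) ^ 2 := by
  obtain ⟨i, hi⟩ := Function.ne_iff.1 hk
  have h1 : (1 : ℝ) ≤ (k i : ℝ) ^ 2 := by
    have h2 : (1 : ℤ) ≤ (k i) ^ 2 := Int.add_one_le_iff.2 (by have := sq_pos_of_ne_zero (R := ℤ) hi; simpa using this)
    exact_mod_cast h2
  exact h1.trans (Finset.single_le_sum (f := fun i => (k i : ℝ) ^ 2)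
    (fun _ _ => sq_nonneg _) (Finset.mem_univ i))

theorem sq_le_laplaceSymbol {k : Fin d → ℤ} (hk : k ≠ 0) :
    (2 * Real.pi / L) ^ 2 ≤ laplaceSymbol L k :=
  le_mul_of_one_le_right (sq_nonneg _) (one_le_sum_sq hk)

theorem sq_norm_derivSymbol_le (j : Fin d) (k : Fin d → ℤ) :
    ‖derivSymbol L j k‖ ^ 2 ≤ laplaceSymbol L k := by
  rw [derivSymbol, norm_mul, Complex.norm_I, one_mul, Complex.norm_real, Real.norm_eq_abs, sq_abs,
    mul_pow, laplaceSymbol]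
  exact mul_le_mul_of_nonneg_left (Finset.single_le_sum (f := fun i => (k i : ℝ) ^ 2)
    (fun _ _ => sq_nonneg _) (Finset.mem_univ j)) (sq_nonneg _)

theorem norm_derivSymbol_le (j : Fin d) (k : Fin d → ℤ) :
    ‖derivSymbol L j k‖ ≤ √(laplaceSymbol L k) :=
  Real.le_sqrt_of_sq_le (sq_norm_derivSymbol_le j k)

theorem conj_derivSymbol (j : Fin d) (k : Fin d → ℤ) :
    conj (derivSymbol L j k) = - derivSymbol L j k := by
  rw [derivSymbol, map_mul, Complex.conj_I, Complex.conj_ofReal, neg_mul]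

@[simp] theorem derivSymbol_neg (j : Fin d) (k : Fin d → ℤ) :
    derivSymbol L j (-k) = - derivSymbol L j k := by
  simp [derivSymbol]

theorem derivSymbol_sub (j : Fin d) (k l : Fin d → ℤ) :
    derivSymbol L j (k - l) = derivSymbol L j k - derivSymbol L j l := by
  simp [derivSymbol]; ring

@[simp] theorem derivSymbol_zero (j : Fin d) : derivSymbol L j 0 = 0 := by
  simp [derivSymbol]

@[fun_prop] theorem continuous_trigPoly (K : Finset (Fin d → ℤ)) (a : (Fin d → ℤ) → ℂ) :
    Continuous (trigPoly K a : Torus d L → ℂ) := by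
  unfold trigPoly
  fun_prop

theorem trigPoly_add_apply (K : Finset (Fin d → ℤ)) (a : (Fin d → ℤ) → ℂ) (x y : Torus d L) :
    trigPoly K a (x + y) = trigPoly K (fun k => a k * character k y) x := by
  simp only [trigPoly, character_add_apply]
  exact Finset.sum_congr rfl fun k _ => by ring

theorem trigPoly_congr {K : Finset (Fin d → ℤ)} {a b : (Fin d → ℤ) → ℂ}
    (h : ∀ k ∈ K, a k = b k) (x : Torus d L) : trigPoly K a x = trigPoly K b x :=
  Finset.sum_congr rfl fun k hk => by rw [h k hk]

theorem trigPoly_sub (K : Finset (Fin d → ℤ)) (a b : (Fin d → ℤ) → ℂ) (x : Torus d L) :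
    trigPoly K (fun k => a k - b k) x = trigPoly K a x - trigPoly K b x := by
  simp [trigPoly, sub_mul, Finset.sum_sub_distrib]

theorem hasDerivAt_trigPoly_single (K : Finset (Fin d → ℤ)) (a : (Fin d → ℤ) → ℂ) (j : Fin d)
    (x : Torus d L) (s : ℝ) :
    HasDerivAt (fun s : ℝ => trigPoly K a (x + Pi.single j (s : AddCircle L)))
      (trigPoly K (fun k => derivSymbol L j k * a k) (x + Pi.single j (s : AddCircle L))) s := by
  unfold trigPoly
  refine HasDerivAt.fun_sum fun k _ => ?_
  have := (hasDerivAt_character_single k j x s).const_mul (a k)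
  rw [mul_left_comm, ← mul_assoc] at this
  exact this

/-- The map `ℝ^d → 𝕋^d`. -/
noncomputable def toTorus (L : ℝ) (y : Fin d → ℝ) : Torus d L := fun i => (y i : AddCircle L)

theorem toTorus_add (y z : Fin d → ℝ) : toTorus L (y + z) = toTorus L y + toTorus L z := by
  funext i
  simp [toTorus]

@[fun_prop] theorem continuous_toTorus : Continuous (toTorus L : (Fin d → ℝ) → Torus d L) :=
  continuous_pi fun i => (AddCircle.continuous_mk' L).comp (continuous_apply i)

theorem norm_toTorus_le (y : Fin d → ℝ) : ‖toTorus L y‖ ≤ ‖y‖ := by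
  refine (pi_norm_le_iff_of_nonneg (norm_nonneg _)).2 fun i => ?_
  refine le_trans ?_ (norm_le_pi_norm y i)
  exact QuotientAddGroup.norm_mk_le_norm

/-- Every coordinate takes its representative closest to zero. Increments on the torus can then be
followed along a straight segment of the same length. -/
theorem exists_toTorus_norm_eq [Fact (0 < L)] (x : Torus d L) :
    ∃ y : Fin d → ℝ, toTorus L y = x ∧ ‖y‖ = ‖x‖ := by
  have h : ∀ i, ∃ y : ℝ, (y : AddCircle L) = x i ∧ ‖y‖ = ‖x i‖ := by
    intro i
    obtain ⟨z, hz⟩ := QuotientAddGroup.mk_surjective (x i)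
    refine ⟨z - round (L⁻¹ * z) * L, ?_, ?_⟩
    · rw [← hz]
      refine (QuotientAddGroup.eq_iff_sub_mem.2 ?_)
      rw [AddSubgroup.mem_zmultiples_iff]
      exact ⟨-round (L⁻¹ * z), by simp⟩
    · rw [← hz]
      exact (AddCircle.norm_eq (p := L) (x := z)).symm
  choose y hy hn using h
  refine ⟨y, funext hy, le_antisymm ?_ ?_⟩
  · exact (pi_norm_le_iff_of_nonneg (norm_nonneg _)).2 fun i => (hn i).le.trans (norm_le_pi_norm x i)
  · exact (pi_norm_le_iff_of_nonneg (norm_nonneg _)).2 fun i => (hn i).ge.trans (norm_le_pi_norm y i)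

section Measure

variable [hL : Fact (0 < L)]

theorem torus_volume_pos : 0 < L ^ d := pow_pos hL.out d

theorem integrable_of_continuous {E : Type*} [NormedAddCommGroup E] {f : Torus d L → E}
    (hf : Continuous f) : Integrable f volume :=
  hf.integrable_of_hasCompactSupport (HasCompactSupport.of_compactSpace f)

theorem integral_trigPoly_mul_character (K : Finset (Fin d → ℤ)) (a : (Fin d → ℤ) → ℂ)
    (k : Fin d → ℤ) :
    ∫ x : Torus d L, trigPoly K a x * character (-k) x
      = if k ∈ K then ((L ^ d : ℝ) : ℂ) * a k else 0 := by
  simp only [trigPoly, Finset.sum_mul]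
  rw [integral_finsetSum _ fun l _ => integrable_of_continuous (by fun_prop)]
  simp only [mul_assoc, ← character_add, integral_const_mul, integral_character]
  split_ifs with hk
  · rw [Finset.sum_eq_single k]
    · simp [mul_comm]
    · intro l _ hl
      rw [if_neg (by rwa [← sub_eq_add_neg, sub_eq_zero]), mul_zero]
    · exact fun h => absurd hk h
  · refine Finset.sum_eq_zero fun l hl => ?_
    rw [if_neg, mul_zero]
    rw [← sub_eq_add_neg, sub_eq_zero]
    rintro rfl
    exact hk hl

theorem integral_trigPoly_mul_conj (K : Finset (Fin d → ℤ)) (a b : (Fin d → ℤ) → ℂ) :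
    ∫ x : Torus d L, trigPoly K a x * conj (trigPoly K b x)
      = ((L ^ d : ℝ) : ℂ) * ∑ k ∈ K, a k * conj (b k) := by
  have h : ∀ x : Torus d L, trigPoly K a x * conj (trigPoly K b x)
      = ∑ k ∈ K, conj (b k) * (trigPoly K a x * character (-k) x) := by
    intro x
    conv_lhs => rw [trigPoly.eq_def K b, map_sum, Finset.mul_sum]
    refine Finset.sum_congr rfl fun k _ => ?_
    rw [map_mul, character_neg]
    ring
  simp only [h]
  rw [integral_finsetSum _ fun l _ => integrable_of_continuous (by fun_prop), Finset.mul_sum]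
  refine Finset.sum_congr rfl fun k hk => ?_
  rw [integral_const_mul, integral_trigPoly_mul_character, if_pos hk]
  ring

theorem integral_norm_sq_trigPoly (K : Finset (Fin d → ℤ)) (a : (Fin d → ℤ) → ℂ) :
    ∫ x : Torus d L, ‖trigPoly K a x‖ ^ 2 = L ^ d * l2Coeff K a ^ 2 := by
  have h := integral_trigPoly_mul_conj (L := L) K a a
  simp only [Complex.mul_conj'] at h
  rw [sq_l2Coeff]
  have h2 : ∫ x : Torus d L, ((‖trigPoly K a x‖ ^ 2 : ℝ) : ℂ)
      = ((∫ x : Torus d L, ‖trigPoly K a x‖ ^ 2 : ℝ) : ℂ) := integral_ofReal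
  push_cast at h2
  rw [h2] at h
  exact_mod_cast h

theorem integral_norm_mul_norm_le {f g : Torus d L → ℂ} (hf : Continuous f) (hg : Continuous g) :
    ∫ x, ‖f x‖ * ‖g x‖ ≤ √(∫ x, ‖f x‖ ^ 2) * √(∫ x, ‖g x‖ ^ 2) := by
  have h := integral_mul_norm_le_Lp_mul_Lq (μ := (volume : Measure (Torus d L)))
    (f := f) (g := g) (p := 2) (q := 2) Real.HolderConjugate.two_two
    ((hf.memLp_of_hasCompactSupport (HasCompactSupport.of_compactSpace f)))
    ((hg.memLp_of_hasCompactSupport (HasCompactSupport.of_compactSpace g)))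
  simpa [Real.sqrt_eq_rpow] using h

/-- Multiplication by a bounded function is bounded on `L²`. -/
theorem norm_integral_mul_trigPoly_le {W : Torus d L → ℝ} {c : ℝ}
    (hc : ∀ x, |W x| ≤ c) (K : Finset (Fin d → ℤ)) (a b : (Fin d → ℤ) → ℂ) :
    ‖∫ x, (W x : ℂ) * trigPoly K a x * conj (trigPoly K b x)‖
      ≤ c * L ^ d * (l2Coeff K a * l2Coeff K b) := by
  have hc0 : 0 ≤ c := (abs_nonneg _).trans (hc 0)
  have hLd : 0 ≤ L ^ d := torus_volume_pos.le
  calc ‖∫ x, (W x : ℂ) * trigPoly K a x * conj (trigPoly K b x)‖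
      ≤ ∫ x : Torus d L, c * (‖trigPoly K a x‖ * ‖trigPoly K b x‖) := by
        refine norm_integral_le_of_norm_le (integrable_of_continuous (by fun_prop)) ?_
        refine Eventually.of_forall fun x => ?_
        rw [norm_mul, norm_mul, Complex.norm_real, RCLike.norm_conj, mul_assoc]
        exact mul_le_mul_of_nonneg_right (hc x) (by positivity)
    _ ≤ c * (√(∫ x : Torus d L, ‖trigPoly K a x‖ ^ 2) * √(∫ x : Torus d L, ‖trigPoly K b x‖ ^ 2)) := by
        rw [integral_const_mul]
        exact mul_le_mul_of_nonneg_left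
          (integral_norm_mul_norm_le (by fun_prop) (by fun_prop)) hc0
    _ = c * L ^ d * (l2Coeff K a * l2Coeff K b) := by
        rw [integral_norm_sq_trigPoly, integral_norm_sq_trigPoly, Real.sqrt_mul hLd,
          Real.sqrt_mul hLd, Real.sqrt_sq (l2Coeff_nonneg _ _), Real.sqrt_sq (l2Coeff_nonneg _ _)]
        calc _ = c * (√(L ^ d) * √(L ^ d)) * (l2Coeff K a * l2Coeff K b) := by ring
          _ = _ := by rw [Real.mul_self_sqrt hLd]

end Measure

end VectorMixing

open scoped ComplexConjugate

namespace VectorMixing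

/-! ### The trilinear estimate in terms of the heat semigroup -/

/-- A constant uniform in the exponent, from x^β ≤ 1 + x² ≤ 2 exp x. The smoothing estimates of the
heat semigroup below reduce to it. -/
theorem rpow_mul_exp_neg_le_two {x β : ℝ} (hx : 0 < x) (hβ : 0 ≤ β) (hβ2 : β ≤ 2) :
    x ^ β * Real.exp (-x) ≤ 2 := by
  have h1 : x ^ β ≤ 1 + x ^ 2 := by
    rcases le_total x 1 with h | h
    · have := Real.rpow_le_one hx.le h hβ
      nlinarith [sq_nonneg x]
    · have : x ^ β ≤ x ^ (2 : ℝ) := Real.rpow_le_rpow_of_exponent_le h hβ2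
      rw [Real.rpow_two] at this
      linarith
  have h2 : 1 + x ^ 2 ≤ 2 * Real.exp x := by
    have := Real.quadratic_le_exp_of_nonneg hx.le
    nlinarith
  rw [Real.exp_neg, ← div_eq_mul_inv, div_le_iff₀ (Real.exp_pos x)]
  exact h1.trans h2

section HeatForm

variable {ι : Type} (K : Finset ι) (ν : ι → ℝ) (X : ι → ι → ℂ)

/-- The Fourier multiplier `exp (-s ν)`. -/
noncomputable def heat (ν : ι → ℝ) (s : ℝ) (a : ι → ℂ) (k : ι) : ℂ :=
  (Real.exp (-(s * ν k)) : ℂ) * a k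

/-- The form of the commutator of `exp (-s ν)` with the operator of matrix `X`. -/
noncomputable def heatForm (s : ℝ) (a b : ι → ℂ) : ℂ :=
  ∑ k ∈ K, ∑ l ∈ K,
    a k * conj (b l) * ((Real.exp (-(s * ν l)) - Real.exp (-(s * ν k)) : ℝ) : ℂ) * X k l

/-- The gradient norm `(∑ ν_k |a_k|²)^(1/2)`. -/
noncomputable def gradCoeff (a : ι → ℂ) : ℝ := l2Coeff K (fun k => (√(ν k) : ℂ) * a k)

/-- The negative norm `(∑ ν_k^(-α) |a_k|²)^(1/2)`. -/
noncomputable def negCoeff (α : ℝ) (a : ι → ℂ) : ℝ :=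
  l2Coeff K (fun k => (((ν k) ^ (-(α / 2)) : ℝ) : ℂ) * a k)

variable {K ν X}

/-- With x = exp(-sν_l/2) and z = exp(-sν_k/2) this is x² - z² = (x - z)x + (x - z)z: half of the
time is traded for smoothing one of the two arguments. -/
theorem heatForm_split (s : ℝ) (a b : ι → ℂ) :
    heatForm K ν X s a b = heatForm K ν X (s / 2) a (heat ν (s / 2) b)
      + heatForm K ν X (s / 2) (heat ν (s / 2) a) b := by
  simp only [heatForm, ← Finset.sum_add_distrib]
  refine Finset.sum_congr rfl fun k _ => Finset.sum_congr rfl fun l _ => ?_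
  have h : ∀ m, Real.exp (-(s * ν m)) = Real.exp (-(s / 2 * ν m)) * Real.exp (-(s / 2 * ν m)) := by
    intro m
    rw [← Real.exp_add]
    congr 1
    ring
  simp only [heat, h, map_mul, Complex.conj_ofReal]
  push_cast
  ring

/-- Exchanging the indices flips the sign of the difference of exponentials and, after conjugation,
that of `X`; the signs cancel and the form is Hermitian. -/
theorem norm_heatForm_comm (hX : ∀ k ∈ K, ∀ l ∈ K, conj (X l k) = -X k l) (s : ℝ) (a b : ι → ℂ) :
    ‖heatForm K ν X s a b‖ = ‖heatForm K ν X s b a‖ := by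
  rw [← RCLike.norm_conj]
  congr 1
  simp only [heatForm, map_sum]
  rw [Finset.sum_comm]
  refine Finset.sum_congr rfl fun k hk => Finset.sum_congr rfl fun l hl => ?_
  simp only [map_mul, Complex.conj_ofReal, Complex.conj_conj, hX k hk l hl]
  push_cast
  ring

theorem norm_heat (s : ℝ) (a : ι → ℂ) (k : ι) : ‖heat ν s a k‖ = Real.exp (-(s * ν k)) * ‖a k‖ := by
  rw [heat, norm_mul, Complex.norm_real, Real.norm_of_nonneg (Real.exp_pos _).le]

theorem exp_neg_le_rpow {s y β : ℝ} (hs : 0 < s) (hy : 0 < y) (hβ : 0 ≤ β) (hβ2 : β ≤ 2) :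
    Real.exp (-(s * y)) ≤ 2 * s ^ (-β) * y ^ (-β) := by
  have h := rpow_mul_exp_neg_le_two (mul_pos hs hy) hβ hβ2
  rw [Real.mul_rpow hs.le hy.le] at h
  have h1 : 0 < s ^ β := Real.rpow_pos_of_pos hs β
  have h2 : 0 < y ^ β := Real.rpow_pos_of_pos hy β
  rw [Real.rpow_neg hs.le, Real.rpow_neg hy.le, mul_assoc, ← mul_inv, ← div_eq_mul_inv,
    le_div_iff₀ (mul_pos h1 h2)]
  linarith

theorem l2Coeff_heat_le {α s : ℝ} (hν : ∀ k ∈ K, 0 < ν k) (hs : 0 < s) (hα : 0 ≤ α) (hα1 : α ≤ 1)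
    (a : ι → ℂ) : l2Coeff K (heat ν s a) ≤ 2 * s ^ (-(α / 2)) * negCoeff K ν α a := by
  refine l2Coeff_le_mul (by positivity) fun k hk => ?_
  have h := exp_neg_le_rpow (β := α / 2) hs (hν k hk) (by linarith) (by linarith)
  rw [norm_heat, norm_mul, Complex.norm_real,
    Real.norm_of_nonneg (Real.rpow_nonneg (hν k hk).le _), ← mul_assoc]
  exact mul_le_mul_of_nonneg_right h (norm_nonneg _)

theorem sqrt_mul_exp_neg_le {s y β : ℝ} (hs : 0 < s) (hy : 0 < y) (hβ : 0 ≤ β) (hβ1 : β ≤ 1) :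
    √y * Real.exp (-(s * y)) ≤ 2 * s ^ (-((1 + β) / 2)) * y ^ (-(β / 2)) := by
  have h := exp_neg_le_rpow (β := (1 + β) / 2) hs hy (by linarith) (by linarith)
  calc √y * Real.exp (-(s * y))
      ≤ √y * (2 * s ^ (-((1 + β) / 2)) * y ^ (-((1 + β) / 2))) :=
        mul_le_mul_of_nonneg_left h (Real.sqrt_nonneg _)
    _ = 2 * s ^ (-((1 + β) / 2)) * (y ^ (1 / 2 : ℝ) * y ^ (-((1 + β) / 2))) := by
        rw [Real.sqrt_eq_rpow]; ring
    _ = _ := by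
        rw [← Real.rpow_add hy]
        congr 2
        ring

theorem gradCoeff_heat_le {β s : ℝ} (hν : ∀ k ∈ K, 0 < ν k) (hs : 0 < s) (hβ : 0 ≤ β)
    (hβ1 : β ≤ 1) (a : ι → ℂ) :
    gradCoeff K ν (heat ν s a) ≤ 2 * s ^ (-((1 + β) / 2)) * negCoeff K ν β a := by
  refine l2Coeff_le_mul (by positivity) fun k hk => ?_
  have h := sqrt_mul_exp_neg_le hs (hν k hk) hβ hβ1
  rw [norm_mul, norm_heat, norm_mul, Complex.norm_real, Complex.norm_real,
    Real.norm_of_nonneg (Real.rpow_nonneg (hν k hk).le _), Real.norm_of_nonneg (Real.sqrt_nonneg _),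
    ← mul_assoc, ← mul_assoc]
  exact mul_le_mul_of_nonneg_right h (norm_nonneg _)

theorem gradCoeff_heat_le_self {s : ℝ} (hν : ∀ k ∈ K, 0 < ν k) (hs : 0 < s) (a : ι → ℂ) :
    gradCoeff K ν (heat ν s a) ≤ gradCoeff K ν a := by
  refine l2Coeff_mono fun k hk => ?_
  rw [norm_mul, norm_mul, norm_heat]
  refine mul_le_mul_of_nonneg_left ?_ (norm_nonneg _)
  refine mul_le_of_le_one_left (norm_nonneg _) (Real.exp_le_one_iff.2 ?_)
  have := mul_pos hs (hν k hk)
  linarith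

theorem negCoeff_zero (a : ι → ℂ) : negCoeff K ν 0 a = l2Coeff K a := by
  simp [negCoeff]

theorem negCoeff_nonneg (α : ℝ) (a : ι → ℂ) : 0 ≤ negCoeff K ν α a := l2Coeff_nonneg _ _

theorem gradCoeff_nonneg (a : ι → ℂ) : 0 ≤ gradCoeff K ν a := l2Coeff_nonneg _ _

/-- Halving the time repeatedly until the scale `s₀` at which `s₀^(α/2) ‖a‖ = ‖a‖_{-α}`. -/
theorem norm_heatForm_le_of_le_two_pow {α A s₀ : ℝ} (hν : ∀ k ∈ K, 0 < ν k) (hα : 0 ≤ α)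
    (hα1 : α ≤ 1) (hA : 0 ≤ A) {a : ι → ℂ}
    (hK : ∀ s : ℝ, 0 < s → ∀ v w : ι → ℂ,
      ‖heatForm K ν X s v w‖ ≤ A * s ^ (α / 2) * gradCoeff K ν v * l2Coeff K w)
    (hsa : s₀ ^ (α / 2) * l2Coeff K a ≤ negCoeff K ν α a) (m : ℕ) :
    ∀ s : ℝ, 0 < s → s ≤ 2 ^ m * s₀ → ∀ v : ι → ℂ,
      ‖heatForm K ν X s v a‖ ≤ 2 * (m + 1) * A * gradCoeff K ν v * negCoeff K ν α a := by
  induction m with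
  | zero =>
    intro s hs hle v
    have hg := gradCoeff_nonneg (K := K) (ν := ν) v
    have hn := negCoeff_nonneg (K := K) (ν := ν) α a
    -- Below the scale s₀, `hsa` lets the negative norm replace the L² norm.
    have h1 : s ^ (α / 2) * l2Coeff K a ≤ negCoeff K ν α a := by
      refine le_trans (mul_le_mul_of_nonneg_right ?_ (l2Coeff_nonneg _ _)) hsa
      exact Real.rpow_le_rpow hs.le (by simpa using hle) (by linarith)
    calc ‖heatForm K ν X s v a‖ ≤ A * s ^ (α / 2) * gradCoeff K ν v * l2Coeff K a := hK s hs v a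
      _ = A * gradCoeff K ν v * (s ^ (α / 2) * l2Coeff K a) := by ring
      _ ≤ A * gradCoeff K ν v * negCoeff K ν α a :=
        mul_le_mul_of_nonneg_left h1 (mul_nonneg hA hg)
      _ ≤ _ := by
        have : 0 ≤ A * gradCoeff K ν v * negCoeff K ν α a := by positivity
        push_cast
        linarith
  | succ m ih =>
    intro s hs hle v
    have hg := gradCoeff_nonneg (K := K) (ν := ν) v
    have hn := negCoeff_nonneg (K := K) (ν := ν) α a
    have hs2 : 0 < s / 2 := by linarith
    rw [heatForm_split]
    refine (norm_add_le _ _).trans ?_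
    -- When the smoothing falls on `a`, the commutator gain (s/2)^(α/2) exactly pays for passing to
    -- the negative norm; when it falls on `v`, the induction hypothesis applies and the gradient
    -- does not grow. Each halving thus costs only an additive 2A.
    have h1 := hK (s / 2) hs2 v (heat ν (s / 2) a)
    have h2 := l2Coeff_heat_le hν hs2 hα hα1 a
    have h3 := ih (s / 2) hs2 (by rw [pow_succ] at hle; linarith) (heat ν (s / 2) v)
    have h4 := gradCoeff_heat_le_self hν hs2 v
    have h5 : (s / 2) ^ (α / 2) * (s / 2) ^ (-(α / 2)) = 1 := by
      rw [← Real.rpow_add hs2]; simp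
    have hpos : 0 ≤ (s / 2) ^ (α / 2) := Real.rpow_nonneg hs2.le _
    have h6 : ‖heatForm K ν X (s / 2) v (heat ν (s / 2) a)‖
        ≤ 2 * A * gradCoeff K ν v * negCoeff K ν α a := by
      calc _ ≤ _ := h1
        _ ≤ A * (s / 2) ^ (α / 2) * gradCoeff K ν v
            * (2 * (s / 2) ^ (-(α / 2)) * negCoeff K ν α a) :=
          mul_le_mul_of_nonneg_left h2 (by positivity)
        _ = 2 * A * gradCoeff K ν v * negCoeff K ν α a
            * ((s / 2) ^ (α / 2) * (s / 2) ^ (-(α / 2))) := by ring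
        _ = _ := by rw [h5, mul_one]
    have h7 : ‖heatForm K ν X (s / 2) (heat ν (s / 2) v) a‖
        ≤ 2 * (m + 1) * A * gradCoeff K ν v * negCoeff K ν α a := by
      refine h3.trans (mul_le_mul_of_nonneg_right ?_ hn)
      exact mul_le_mul_of_nonneg_left h4 (by positivity)
    push_cast
    linarith

theorem half_rpow_neg_le {s β : ℝ} (hs : 0 < s) (hβ1 : β ≤ 1) :
    (s / 2) ^ (-β) ≤ 2 * s ^ (-β) := by
  rw [Real.div_rpow hs.le (by norm_num), Real.rpow_neg (by norm_num : (0 : ℝ) ≤ 2) β, div_inv_eq_mul,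
    mul_comm]
  refine mul_le_mul_of_nonneg_right ?_ (Real.rpow_nonneg hs.le _)
  calc (2 : ℝ) ^ β ≤ 2 ^ (1 : ℝ) := Real.rpow_le_rpow_of_exponent_le (by norm_num) hβ1
    _ = 2 := Real.rpow_one 2

theorem norm_heatForm_self_le_two_mul (hX : ∀ k ∈ K, ∀ l ∈ K, conj (X l k) = -X k l) (s : ℝ)
    (a : ι → ℂ) :
    ‖heatForm K ν X s a a‖ ≤ 2 * ‖heatForm K ν X (s / 2) (heat ν (s / 2) a) a‖ := by
  rw [heatForm_split]
  refine (norm_add_le _ _).trans ?_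
  rw [norm_heatForm_comm hX]
  linarith

/-- The estimate for short times: half of the time smooths the argument that carries the derivative,
at the price s^(-1/2). -/
theorem norm_heatForm_self_le {α A s : ℝ} (hν : ∀ k ∈ K, 0 < ν k)
    (hX : ∀ k ∈ K, ∀ l ∈ K, conj (X l k) = -X k l) (hα : 0 ≤ α) (hA : 0 ≤ A)
    (hK : ∀ s : ℝ, 0 < s → ∀ v w : ι → ℂ,
      ‖heatForm K ν X s v w‖ ≤ A * s ^ (α / 2) * gradCoeff K ν v * l2Coeff K w)
    (hs : 0 < s) (a : ι → ℂ) :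
    ‖heatForm K ν X s a a‖ ≤ 8 * A * s ^ ((α - 1) / 2) * l2Coeff K a ^ 2 := by
  have hs2 : 0 < s / 2 := by linarith
  have h1 := norm_heatForm_self_le_two_mul (ν := ν) hX s a
  have h2 := hK (s / 2) hs2 (heat ν (s / 2) a) a
  have h3 := gradCoeff_heat_le hν hs2 le_rfl zero_le_one a
  rw [negCoeff_zero, add_zero] at h3
  have he := l2Coeff_nonneg K a
  have h4 : (s / 2) ^ (α / 2) * (s / 2) ^ (-(1 / 2 : ℝ)) ≤ 2 * s ^ ((α - 1) / 2) := by
    rw [← Real.rpow_add hs2]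
    have := half_rpow_neg_le (β := -(α / 2 + -(1 / 2))) hs (by linarith)
    rw [neg_neg] at this
    rwa [show (α - 1) / 2 = α / 2 + -(1 / 2) by ring]
  have hp : 0 ≤ (s / 2) ^ (α / 2) := Real.rpow_nonneg hs2.le _
  calc _ ≤ _ := h1
    _ ≤ 2 * (A * (s / 2) ^ (α / 2) * (2 * (s / 2) ^ (-(1 / 2 : ℝ)) * l2Coeff K a)
        * l2Coeff K a) := by
      refine mul_le_mul_of_nonneg_left (h2.trans ?_) zero_le_two
      exact mul_le_mul_of_nonneg_right (mul_le_mul_of_nonneg_left h3 (by positivity)) he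
    _ = 4 * A * l2Coeff K a ^ 2 * ((s / 2) ^ (α / 2) * (s / 2) ^ (-(1 / 2 : ℝ))) := by ring
    _ ≤ 4 * A * l2Coeff K a ^ 2 * (2 * s ^ ((α - 1) / 2)) :=
      mul_le_mul_of_nonneg_left h4 (by positivity)
    _ = _ := by ring

/-- The number of halvings that lead from x down to scale one is logarithmic in x. The logarithm is
absorbed into an arbitrarily small power, so that only powers have to be integrated in time. -/
theorem exists_two_pow_bound {ε : ℝ} (hε : 0 < ε) :
    ∃ C : ℝ, 0 < C ∧ ∀ x : ℝ, 1 ≤ x → ∃ m : ℕ, x ≤ 2 ^ (m + 1) ∧ (m + 1 : ℝ) ≤ C * x ^ ε := by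
  -- From 1 + m ε log 2 ≤ (2^m)^ε: the minimum makes c(m + 1) at most the left-hand side.
  set c : ℝ := min 1 (ε * Real.log 2) with hc
  have hc0 : 0 < c := lt_min one_pos (mul_pos hε (Real.log_pos (by norm_num)))
  refine ⟨c⁻¹, inv_pos.2 hc0, fun x hx => ?_⟩
  obtain ⟨m, hm1, hm2⟩ := exists_nat_pow_near hx (by norm_num : (1 : ℝ) < 2)
  refine ⟨m, hm2.le, ?_⟩
  rw [inv_mul_eq_div, le_div_iff₀ hc0]
  have h1 : (1 : ℝ) + m * (ε * Real.log 2) ≤ x ^ ε := by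
    calc (1 : ℝ) + m * (ε * Real.log 2) ≤ Real.exp (m * (ε * Real.log 2)) := by
          linarith [Real.add_one_le_exp (m * (ε * Real.log 2))]
      _ = ((2 : ℝ) ^ m) ^ ε := by
          rw [← Real.rpow_natCast, ← Real.rpow_mul (by norm_num), Real.rpow_def_of_pos (by norm_num)]
          congr 1
          ring
      _ ≤ x ^ ε := Real.rpow_le_rpow (by positivity) hm1 hε.le
  have h2 : c ≤ 1 := min_le_left _ _
  have h3 : (m : ℝ) * c ≤ m * (ε * Real.log 2) :=
    mul_le_mul_of_nonneg_left (min_le_right _ _) (Nat.cast_nonneg m)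
  linarith

/-- The estimate for long times: half of the time smooths one argument, the other half is halved
until it falls below s₀. Both arguments end up measured in the negative norm. -/
theorem norm_heatForm_self_le_of_ge {α A s s₀ C ε : ℝ} (hν : ∀ k ∈ K, 0 < ν k)
    (hX : ∀ k ∈ K, ∀ l ∈ K, conj (X l k) = -X k l) (hα : 0 ≤ α) (hα1 : α ≤ 1) (hA : 0 ≤ A)
    (hK : ∀ s : ℝ, 0 < s → ∀ v w : ι → ℂ,
      ‖heatForm K ν X s v w‖ ≤ A * s ^ (α / 2) * gradCoeff K ν v * l2Coeff K w)
    (hC : ∀ x : ℝ, 1 ≤ x → ∃ m : ℕ, x ≤ 2 ^ (m + 1) ∧ (m + 1 : ℝ) ≤ C * x ^ ε)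
    (hs₀ : 0 < s₀) {a : ι → ℂ} (hsa : s₀ ^ (α / 2) * l2Coeff K a ≤ negCoeff K ν α a)
    (hs : s₀ ≤ s) :
    ‖heatForm K ν X s a a‖
      ≤ 16 * A * C * (s / s₀) ^ ε * s ^ (-((1 + α) / 2)) * negCoeff K ν α a ^ 2 := by
  have hs0 : 0 < s := hs₀.trans_le hs
  have hs2 : 0 < s / 2 := by linarith
  obtain ⟨m, hm1, hm2⟩ := hC (s / s₀) ((one_le_div hs₀).2 hs)
  have h1 := norm_heatForm_self_le_two_mul (ν := ν) hX s a
  have h2 := norm_heatForm_le_of_le_two_pow hν hα hα1 hA hK hsa m (s / 2) hs2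
    (by rw [div_le_iff₀ hs₀, pow_succ] at hm1; linarith) (heat ν (s / 2) a)
  have h3 := gradCoeff_heat_le hν hs2 hα hα1 a
  have h4 := half_rpow_neg_le (β := (1 + α) / 2) hs0 (by linarith)
  have hn := negCoeff_nonneg (K := K) (ν := ν) α a
  have hp : 0 ≤ s ^ (-((1 + α) / 2)) := Real.rpow_nonneg hs0.le _
  calc _ ≤ _ := h1
    _ ≤ 2 * (2 * (m + 1) * A * (2 * (2 * s ^ (-((1 + α) / 2))) * negCoeff K ν α a)
        * negCoeff K ν α a) := by
      refine mul_le_mul_of_nonneg_left (h2.trans ?_) zero_le_two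
      refine mul_le_mul_of_nonneg_right (mul_le_mul_of_nonneg_left (h3.trans ?_) (by positivity)) hn
      exact mul_le_mul_of_nonneg_right (by linarith) hn
    _ = (m + 1) * (16 * A * s ^ (-((1 + α) / 2)) * negCoeff K ν α a ^ 2) := by ring
    _ ≤ (C * (s / s₀) ^ ε) * (16 * A * s ^ (-((1 + α) / 2)) * negCoeff K ν α a ^ 2) :=
      mul_le_mul_of_nonneg_right hm2 (by positivity)
    _ = _ := by ring

/-- The commutator form of `ν^(-α)` as a superposition of the heat forms. -/
theorem integral_rpow_mul_heatForm {α : ℝ} (hν : ∀ k ∈ K, 0 < ν k) (hα : 0 < α) (a : ι → ℂ) :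
    ∫ s in Ioi (0 : ℝ), ((s ^ (α - 1) : ℝ) : ℂ) * heatForm K ν X s a a
      = (Real.Gamma α : ℂ) * ∑ k ∈ K, ∑ l ∈ K,
        a k * conj (a l) * (((ν l) ^ (-α) - (ν k) ^ (-α) : ℝ) : ℂ) * X k l := by
  have hI : ∀ k ∈ K, IntegrableOn (fun s : ℝ => s ^ (α - 1) * Real.exp (-(s * ν k))) (Ioi 0) := by
    intro k hk
    have h := integrableOn_rpow_mul_exp_neg_mul_rpow (p := 1) (s := α - 1) (b := ν k)
      (by linarith) one_pos (hν k hk)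
    refine h.congr_fun (fun s _ => ?_) measurableSet_Ioi
    simp only [Real.rpow_one]
    rw [mul_comm s, neg_mul]
  have hV : ∀ k ∈ K, ∫ s in Ioi (0 : ℝ), s ^ (α - 1) * Real.exp (-(s * ν k))
      = Real.Gamma α * (ν k) ^ (-α) := by
    intro k hk
    have h := Real.integral_rpow_mul_exp_neg_mul_Ioi hα (hν k hk)
    simp only [mul_comm (ν k)] at h
    rw [h, one_div, Real.inv_rpow (hν k hk).le, Real.rpow_neg (hν k hk).le, mul_comm]
  have hterm : ∀ k ∈ K, ∀ l ∈ K,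
      IntegrableOn (fun s : ℝ => (((s ^ (α - 1) * Real.exp (-(s * ν l))
        - s ^ (α - 1) * Real.exp (-(s * ν k)) : ℝ) : ℂ)) * (a k * conj (a l) * X k l)) (Ioi 0) := by
    intro k hk l hl
    exact (((hI l hl).sub (hI k hk)).ofReal (𝕜 := ℂ)).mul_const _
  have hval : ∀ k ∈ K, ∀ l ∈ K,
      ∫ s in Ioi (0 : ℝ), (((s ^ (α - 1) * Real.exp (-(s * ν l))
        - s ^ (α - 1) * Real.exp (-(s * ν k)) : ℝ) : ℂ)) * (a k * conj (a l) * X k l)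
      = (Real.Gamma α : ℂ)
        * (a k * conj (a l) * (((ν l) ^ (-α) - (ν k) ^ (-α) : ℝ) : ℂ) * X k l) := by
    intro k hk l hl
    rw [integral_mul_const]
    have : ∫ s in Ioi (0 : ℝ), ((s ^ (α - 1) * Real.exp (-(s * ν l))
        - s ^ (α - 1) * Real.exp (-(s * ν k)) : ℝ) : ℂ)
        = ((∫ s in Ioi (0 : ℝ), (s ^ (α - 1) * Real.exp (-(s * ν l))
        - s ^ (α - 1) * Real.exp (-(s * ν k))) : ℝ) : ℂ) := integral_ofReal
    rw [this, integral_sub (hI l hl) (hI k hk), hV l hl, hV k hk]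
    push_cast
    ring
  have hsum : ∀ s : ℝ, ((s ^ (α - 1) : ℝ) : ℂ) * heatForm K ν X s a a
      = ∑ k ∈ K, ∑ l ∈ K, (((s ^ (α - 1) * Real.exp (-(s * ν l))
        - s ^ (α - 1) * Real.exp (-(s * ν k)) : ℝ) : ℂ)) * (a k * conj (a l) * X k l) := by
    intro s
    simp only [heatForm, Finset.mul_sum]
    refine Finset.sum_congr rfl fun k _ => Finset.sum_congr rfl fun l _ => ?_
    push_cast
    ring
  simp only [hsum]
  rw [integral_finsetSum _ fun k hk => integrable_finsetSum _ fun l hl => hterm k hk l hl,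
    Finset.mul_sum]
  refine Finset.sum_congr rfl fun k hk => ?_
  rw [integral_finsetSum _ fun l hl => hterm k hk l hl, Finset.mul_sum]
  exact Finset.sum_congr rfl fun l hl => hval k hk l hl

end HeatForm

/-- If the commutator of the matrix `X` with the heat semigroup loses one derivative and gains the
power `s^(α/2)`, then its commutator with `ν^(-α)` is bounded by interpolated norms. -/
theorem exists_negCommutator_bound {α : ℝ} (hα : 1 / 2 ≤ α) (hα1 : α < 1) :
    ∃ C : ℝ, 0 < C ∧ ∀ {ι : Type} (K : Finset ι) (ν : ι → ℝ) (X : ι → ι → ℂ) (A : ℝ),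
      (∀ k ∈ K, 0 < ν k) → (∀ k ∈ K, ∀ l ∈ K, conj (X l k) = -X k l) → 0 ≤ A →
      (∀ s : ℝ, 0 < s → ∀ v w : ι → ℂ,
        ‖heatForm K ν X s v w‖ ≤ A * s ^ (α / 2) * gradCoeff K ν v * l2Coeff K w) →
      ∀ a : ι → ℂ,
        ‖∑ k ∈ K, ∑ l ∈ K, a k * conj (a l) * (((ν l) ^ (-α) - (ν k) ^ (-α) : ℝ) : ℂ) * X k l‖
          ≤ C * A * negCoeff K ν α a ^ (2 - (1 - α) / α) * l2Coeff K a ^ ((1 - α) / α) := by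
  have hα0 : 0 < α := by linarith
  have hΓ : 0 < Real.Gamma α := Real.Gamma_pos_of_pos hα0
  -- Half of the decay margin (1 - α)/2 at infinity; the factor (s/s₀)^ε left by the halvings must
  -- remain integrable.
  set ε : ℝ := (1 - α) / 4 with hε
  have hε0 : 0 < ε := by rw [hε]; linarith
  obtain ⟨C₁, hC₁, hC₁'⟩ := exists_two_pow_bound hε0
  -- Integrability at zero of s^(α-1) s^((α-1)/2), which needs α > 1/3.
  have hc1 : 0 < (3 * α - 1) / 2 := by linarith
  have hc2 : 0 < (1 - α) / 2 - ε := by rw [hε]; linarith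
  set C₂ : ℝ := 8 / ((3 * α - 1) / 2) + 16 * C₁ / ((1 - α) / 2 - ε) with hC₂
  have hC₂0 : 0 < C₂ := by positivity
  refine ⟨C₂ / Real.Gamma α, by positivity, ?_⟩
  intro ι K ν X A hν hX hA hK a
  set h : ℝ := negCoeff K ν α a with hh
  set e : ℝ := l2Coeff K a with he
  have hh0 : 0 ≤ h := negCoeff_nonneg _ _
  have he0 : 0 ≤ e := l2Coeff_nonneg _ _
  rcases hh0.eq_or_lt with h0 | hpos
  · have hz : ∀ k ∈ K, a k = 0 := by
      have h1 : h ^ 2 = 0 := by rw [← h0]; simp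
      rw [hh, negCoeff, sq_l2Coeff, Finset.sum_eq_zero_iff_of_nonneg (fun _ _ => by positivity)] at h1
      intro k hk
      have h2 := h1 k hk
      rw [sq_eq_zero_iff, norm_eq_zero, mul_eq_zero] at h2
      refine h2.resolve_left ?_
      exact_mod_cast (Real.rpow_pos_of_pos (hν k hk) _).ne'
    have : ∑ k ∈ K, ∑ l ∈ K, a k * conj (a l) * (((ν l) ^ (-α) - (ν k) ^ (-α) : ℝ) : ℂ) * X k l
        = 0 :=
      Finset.sum_eq_zero fun k hk => Finset.sum_eq_zero fun l _ => by rw [hz k hk]; simp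
    rw [this, norm_zero]
    positivity
  have hepos : 0 < e := by
    refine he0.lt_of_ne fun h0 => hpos.ne' ?_
    have h1 : e ^ 2 = 0 := by rw [← h0]; simp
    rw [he, sq_l2Coeff, Finset.sum_eq_zero_iff_of_nonneg (fun _ _ => by positivity)] at h1
    have hz : ∀ k ∈ K, a k = 0 := fun k hk => by simpa using h1 k hk
    rw [hh, negCoeff, l2Coeff, Finset.sum_eq_zero fun k hk => by rw [hz k hk]; simp, Real.sqrt_zero]
  -- The time at which the short-time and long-time estimates balance, s₀^(α/2) e = h.
  set s₀ : ℝ := (h / e) ^ (2 / α) with hs₀def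
  have hq : 0 < h / e := div_pos hpos hepos
  have hs₀ : 0 < s₀ := Real.rpow_pos_of_pos hq _
  have hs₀pow : ∀ β : ℝ, s₀ ^ β = (h / e) ^ (2 * β / α) := by
    intro β
    rw [hs₀def, ← Real.rpow_mul hq.le]
    congr 1
    ring
  have hsa : s₀ ^ (α / 2) * e ≤ h := by
    rw [hs₀pow, show 2 * (α / 2) / α = 1 by field_simp, Real.rpow_one, div_mul_cancel₀ _ hepos.ne']
  set S := ∑ k ∈ K, ∑ l ∈ K, a k * conj (a l) * (((ν l) ^ (-α) - (ν k) ^ (-α) : ℝ) : ℂ) * X k l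
    with hS
  have hInt := integral_rpow_mul_heatForm (X := X) hν hα0 a
  -- the contribution of small times
  have hsmall : ‖∫ s in Ioc (0 : ℝ) s₀, ((s ^ (α - 1) : ℝ) : ℂ) * heatForm K ν X s a a‖
      ≤ 8 * A * e ^ 2 * (s₀ ^ ((3 * α - 1) / 2) / ((3 * α - 1) / 2)) := by
    have hval : ∫ s in Ioc (0 : ℝ) s₀, s ^ ((3 * α - 3) / 2)
        = s₀ ^ ((3 * α - 1) / 2) / ((3 * α - 1) / 2) := by
      rw [← intervalIntegral.integral_of_le hs₀.le, integral_rpow (Or.inl (by linarith)),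
        show (3 * α - 3) / 2 + 1 = (3 * α - 1) / 2 by ring, Real.zero_rpow hc1.ne', sub_zero]
    have hI : IntegrableOn (fun s : ℝ => s ^ ((3 * α - 3) / 2)) (Ioc 0 s₀) := by
      have := (intervalIntegral.intervalIntegrable_rpow' (a := 0) (b := s₀)
        (r := (3 * α - 3) / 2) (by linarith))
      exact (intervalIntegrable_iff_integrableOn_Ioc_of_le hs₀.le).1 this
    rw [← hval, ← integral_const_mul]
    refine norm_integral_le_of_norm_le (hI.const_mul _) ?_
    refine (ae_restrict_iff' measurableSet_Ioc).2 (Eventually.of_forall fun s hs => ?_)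
    have hs0 : 0 < s := hs.1
    have h1 := norm_heatForm_self_le hν hX hα0.le hA hK hs0 a
    have h2 : 0 ≤ s ^ (α - 1) := Real.rpow_nonneg hs0.le _
    rw [norm_mul, Complex.norm_real, Real.norm_of_nonneg h2]
    calc _ ≤ s ^ (α - 1) * (8 * A * s ^ ((α - 1) / 2) * e ^ 2) := mul_le_mul_of_nonneg_left h1 h2
      _ = 8 * A * e ^ 2 * (s ^ (α - 1) * s ^ ((α - 1) / 2)) := by ring
      _ = _ := by
        rw [← Real.rpow_add hs0]
        congr 2
        ring
  -- the contribution of large times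
  have hlarge : ‖∫ s in Ioi s₀, ((s ^ (α - 1) : ℝ) : ℂ) * heatForm K ν X s a a‖
      ≤ 16 * A * C₁ * h ^ 2 * (s₀ ^ ((α - 1) / 2) / ((1 - α) / 2 - ε)) := by
    have hexp : (α - 3) / 2 + ε < -1 := by rw [hε]; linarith
    have hval : s₀ ^ (-ε) * ∫ s in Ioi s₀, s ^ ((α - 3) / 2 + ε)
        = s₀ ^ ((α - 1) / 2) / ((1 - α) / 2 - ε) := by
      rw [integral_Ioi_rpow_of_lt hexp hs₀,
        show (α - 3) / 2 + ε + 1 = -((1 - α) / 2 - ε) by ring, neg_div_neg_eq, ← mul_div_assoc,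
        ← Real.rpow_add hs₀]
      congr 2
      ring
    have hI : IntegrableOn (fun s : ℝ => s ^ ((α - 3) / 2 + ε)) (Ioi s₀) :=
      integrableOn_Ioi_rpow_of_lt hexp hs₀
    rw [← hval, ← mul_assoc, ← integral_const_mul]
    refine norm_integral_le_of_norm_le (hI.const_mul _) ?_
    refine (ae_restrict_iff' measurableSet_Ioi).2 (Eventually.of_forall fun s hs => ?_)
    have hs0 : 0 < s := hs₀.trans hs
    have h1 := norm_heatForm_self_le_of_ge hν hX hα0.le hα1.le hA hK hC₁' hs₀ hsa (le_of_lt hs)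
    have h2 : 0 ≤ s ^ (α - 1) := Real.rpow_nonneg hs0.le _
    rw [norm_mul, Complex.norm_real, Real.norm_of_nonneg h2]
    calc _ ≤ s ^ (α - 1) * (16 * A * C₁ * (s / s₀) ^ ε * s ^ (-((1 + α) / 2)) * h ^ 2) :=
          mul_le_mul_of_nonneg_left h1 h2
      _ = 16 * A * C₁ * h ^ 2 * s₀ ^ (-ε) * (s ^ (α - 1) * s ^ ε * s ^ (-((1 + α) / 2))) := by
          rw [Real.div_rpow hs0.le hs₀.le, Real.rpow_neg hs₀.le]
          ring
      _ = _ := by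
        rw [← Real.rpow_add hs0, ← Real.rpow_add hs0]
        congr 2
        ring
  -- both are the interpolated quantity
  have hT : h ^ (2 - (1 - α) / α) * e ^ ((1 - α) / α) = e ^ 2 * (h / e) ^ (2 - (1 - α) / α) := by
    rw [Real.div_rpow hpos.le hepos.le, mul_div_assoc', mul_comm, eq_div_iff
      (Real.rpow_pos_of_pos hepos _).ne', mul_right_comm, ← Real.rpow_add hepos]
    congr 1
    rw [show (1 - α) / α + (2 - (1 - α) / α) = (2 : ℝ) by ring, Real.rpow_two]
  have hT1 : e ^ 2 * s₀ ^ ((3 * α - 1) / 2) = h ^ (2 - (1 - α) / α) * e ^ ((1 - α) / α) := by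
    rw [hT, hs₀pow]
    congr 2
    field_simp
    ring
  have hT2 : h ^ 2 * s₀ ^ ((α - 1) / 2) = h ^ (2 - (1 - α) / α) * e ^ ((1 - α) / α) := by
    rw [hT, hs₀pow]
    have : h ^ 2 = e ^ 2 * (h / e) ^ (2 : ℝ) := by
      rw [Real.rpow_two]; field_simp
    rw [this, mul_assoc, ← Real.rpow_add hq]
    congr 2
    field_simp
    ring
  -- If the integrand were not integrable, its integral would be zero by convention and the bound
  -- trivial; so integrability need not be established.
  have hunion : ∫ s in Ioi (0 : ℝ), ((s ^ (α - 1) : ℝ) : ℂ) * heatForm K ν X s a a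
      = (∫ s in Ioc (0 : ℝ) s₀, ((s ^ (α - 1) : ℝ) : ℂ) * heatForm K ν X s a a)
        + ∫ s in Ioi s₀, ((s ^ (α - 1) : ℝ) : ℂ) * heatForm K ν X s a a ∨
      ∫ s in Ioi (0 : ℝ), ((s ^ (α - 1) : ℝ) : ℂ) * heatForm K ν X s a a = 0 := by
    by_cases hi : IntegrableOn (fun s : ℝ => ((s ^ (α - 1) : ℝ) : ℂ) * heatForm K ν X s a a) (Ioi 0)
    · left
      rw [← Ioc_union_Ioi_eq_Ioi hs₀.le] at hi ⊢
      exact setIntegral_union (Ioc_disjoint_Ioi le_rfl) measurableSet_Ioi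
        (hi.mono_set subset_union_left) (hi.mono_set subset_union_right)
    · exact Or.inr (integral_undef hi)
  have hbound : ‖∫ s in Ioi (0 : ℝ), ((s ^ (α - 1) : ℝ) : ℂ) * heatForm K ν X s a a‖
      ≤ C₂ * A * (h ^ (2 - (1 - α) / α) * e ^ ((1 - α) / α)) := by
    rcases hunion with hu | hu
    · rw [hu]
      refine (norm_add_le _ _).trans ((add_le_add hsmall hlarge).trans (le_of_eq ?_))
      rw [hC₂]
      calc _ = 8 / ((3 * α - 1) / 2) * A * (e ^ 2 * s₀ ^ ((3 * α - 1) / 2))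
            + 16 * C₁ / ((1 - α) / 2 - ε) * A * (h ^ 2 * s₀ ^ ((α - 1) / 2)) := by ring
        _ = _ := by rw [hT1, hT2]; ring
    · rw [hu, norm_zero]
      positivity
  rw [hInt, norm_mul, Complex.norm_real, Real.norm_of_nonneg hΓ.le] at hbound
  rw [div_mul_eq_mul_div, div_mul_eq_mul_div, div_mul_eq_mul_div, le_div_iff₀ hΓ]
  linarith

end VectorMixing

open scoped ComplexConjugate
open ProbabilityTheory

namespace VectorMixing

variable {d : ℕ} {L : ℝ}

/-! ### Commutators of multiplication operators with the heat semigroup -/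

theorem l2Coeff_mul_character (K : Finset (Fin d → ℤ)) (a : (Fin d → ℤ) → ℂ) (y : Torus d L) :
    l2Coeff K (fun k => a k * character k y) = l2Coeff K a := by
  simp [l2Coeff]

section

variable [hL : Fact (0 < L)]

/-- The matrix entries `∫ V e_k conj(e_l)` of the multiplication by `V`. -/
noncomputable def mulCoeff (V : Torus d L → ℝ) (k l : Fin d → ℤ) : ℂ :=
  ∫ x, (V x : ℂ) * character k x * conj (character l x)

theorem integral_mul_trigPoly_mul_conj {V : Torus d L → ℝ} (hV : Continuous V)
    (K : Finset (Fin d → ℤ)) (a b : (Fin d → ℤ) → ℂ) :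
    ∫ x, (V x : ℂ) * trigPoly K a x * conj (trigPoly K b x)
      = ∑ k ∈ K, ∑ l ∈ K, a k * conj (b l) * mulCoeff V k l := by
  have h : ∀ x, (V x : ℂ) * trigPoly K a x * conj (trigPoly K b x)
      = ∑ k ∈ K, ∑ l ∈ K, a k * conj (b l) *
        ((V x : ℂ) * character k x * conj (character l x)) := by
    intro x
    simp only [trigPoly, map_sum, Finset.mul_sum, Finset.sum_mul, map_mul]
    rw [Finset.sum_comm]
    exact Finset.sum_congr rfl fun k _ => Finset.sum_congr rfl fun l _ => by ring
  have hc : ∀ k l : Fin d → ℤ, Integrable (fun x : Torus d L => a k * conj (b l) *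
        ((V x : ℂ) * character k x * conj (character l x))) volume :=
    fun k l => integrable_of_continuous (by fun_prop)
  simp only [h]
  rw [integral_finsetSum _ fun k _ => integrable_finsetSum _ fun l _ => hc k l]
  refine Finset.sum_congr rfl fun k _ => ?_
  rw [integral_finsetSum _ fun l _ => hc k l]
  exact Finset.sum_congr rfl fun l _ => by rw [integral_const_mul, mulCoeff]

/-- The commutator of the multiplication by `V` with a translation. -/
theorem norm_translation_commutator_le {V : Torus d L → ℝ} (hV : Continuous V) {c : ℝ}
    {y : Torus d L} (hc : ∀ x, |V (x + y) - V x| ≤ c)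
    (K : Finset (Fin d → ℤ)) (a b : (Fin d → ℤ) → ℂ) :
    ‖∑ k ∈ K, ∑ l ∈ K, a k * conj (b l) * (character l y - character k y) * mulCoeff V k l‖
      ≤ c * L ^ d * (l2Coeff K a * l2Coeff K b) := by
  have h1 : ∫ x, (V x : ℂ) * trigPoly K (fun k => a k * character k y) x * conj (trigPoly K b x)
      = ∑ k ∈ K, ∑ l ∈ K, (a k * character k y) * conj (b l) * mulCoeff V k l :=
    integral_mul_trigPoly_mul_conj hV K _ b
  -- Translation invariance of the measure moves the shift from `V` and `a` onto `b`.
  have h2 : ∫ x, (V (x + y) : ℂ) * trigPoly K (fun k => a k * character k y) x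
        * conj (trigPoly K b x)
      = ∑ k ∈ K, ∑ l ∈ K, a k * conj (b l * character l (-y)) * mulCoeff V k l := by
    rw [← integral_mul_trigPoly_mul_conj hV K a (fun l => b l * character l (-y))]
    refine Eq.trans ?_ (integral_add_right_eq_self (fun x => (V x : ℂ) * trigPoly K a x
      * conj (trigPoly K (fun l => b l * character l (-y)) x)) y)
    refine integral_congr_ae (Eventually.of_forall fun x => ?_)
    simp only [← trigPoly_add_apply, add_neg_cancel_right]
  have h3 : ∫ x, ((V (x + y) - V x : ℝ) : ℂ) * trigPoly K (fun k => a k * character k y) x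
        * conj (trigPoly K b x)
      = ∑ k ∈ K, ∑ l ∈ K, a k * conj (b l) * (character l y - character k y)
        * mulCoeff V k l := by
    have : ∀ x, ((V (x + y) - V x : ℝ) : ℂ) * trigPoly K (fun k => a k * character k y) x
        * conj (trigPoly K b x) = (V (x + y) : ℂ) * trigPoly K (fun k => a k * character k y) x
        * conj (trigPoly K b x)
        - (V x : ℂ) * trigPoly K (fun k => a k * character k y) x * conj (trigPoly K b x) := by
      intro x
      push_cast
      ring
    simp only [this]
    rw [integral_sub (integrable_of_continuous (by fun_prop))
      (integrable_of_continuous (by fun_prop)), h1, h2, ← Finset.sum_sub_distrib]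
    refine Finset.sum_congr rfl fun k _ => ?_
    rw [← Finset.sum_sub_distrib]
    refine Finset.sum_congr rfl fun l _ => ?_
    have hneg : conj (character l (-y)) = character l y := by
      have h4 : character l (-y) * character l y = 1 := by
        rw [← character_add_apply]; simp
      have h5 : conj (character l y) * character l y = 1 := by
        rw [mul_comm, Complex.mul_conj']; simp
      have h6 : character l y ≠ 0 := by
        intro h0; rw [h0] at h4; simp at h4
      rw [mul_right_cancel₀ h6 (h4.trans h5.symm), Complex.conj_conj]
    rw [map_mul, hneg]
    ring
  rw [← h3]
  refine (norm_integral_mul_trigPoly_le hc K _ b).trans (le_of_eq ?_)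
  rw [l2Coeff_mul_character]

end

/-- The Gaussian measure of covariance `2 s` on `ℝ^d`. -/
noncomputable def heatMeasure (d : ℕ) (s : ℝ) : Measure (Fin d → ℝ) :=
  Measure.pi fun _ => gaussianReal 0 (2 * s).toNNReal

instance (s : ℝ) : IsProbabilityMeasure (heatMeasure d s) := by
  unfold heatMeasure; infer_instance

/-- The characteristic function of the Gaussian at the frequency 2πk/L. It exhibits the heat
multiplier as an average of translations, so that commutators with translations control those with
the semigroup. -/
theorem integral_character_heatMeasure (k : Fin d → ℤ) {s : ℝ} (hs : 0 ≤ s) :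
    ∫ y, character k (toTorus L y) ∂(heatMeasure d s)
      = (Real.exp (-(s * laplaceSymbol L k)) : ℂ) := by
  have h : ∀ i : Fin d, ∫ y : ℝ, fourier (k i) (y : AddCircle L) ∂(gaussianReal 0 (2 * s).toNNReal)
      = Complex.exp (-(s * (2 * Real.pi / L) ^ 2 * (k i : ℝ) ^ 2 : ℝ)) := by
    intro i
    have h1 := charFun_gaussianReal (μ := 0) (v := (2 * s).toNNReal) (2 * Real.pi / L * k i)
    rw [charFun_apply_real] at h1
    have h2 : ∀ y : ℝ, (fourier (k i) (y : AddCircle L) : ℂ)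
        = Complex.exp (((2 * Real.pi / L * k i : ℝ) : ℂ) * y * Complex.I) := by
      intro y
      rw [fourier_coe_apply]
      congr 1
      push_cast
      ring
    simp only [h2]
    rw [h1, Real.coe_toNNReal _ (by linarith)]
    congr 1
    push_cast
    ring
  unfold character toTorus heatMeasure
  rw [integral_fintype_prod_eq_prod (fun i (y : ℝ) => (fourier (k i) (y : AddCircle L) : ℂ))]
  simp only [h, ← Complex.exp_sum]
  rw [Complex.ofReal_exp]
  congr 1
  rw [laplaceSymbol]
  push_cast
  rw [Finset.sum_neg_distrib, ← Finset.mul_sum]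
  ring

theorem integrable_sq_heatMeasure (i : Fin d) (s : ℝ) :
    Integrable (fun y : Fin d → ℝ => y i ^ 2) (heatMeasure d s) := by
  have h : Integrable (fun y : ℝ => y ^ 2) (gaussianReal 0 (2 * s).toNNReal) :=
    (memLp_id_gaussianReal (μ := 0) (v := (2 * s).toNNReal) 2).integrable_sq
  exact (measurePreserving_eval (fun _ : Fin d => gaussianReal 0 (2 * s).toNNReal) i).integrable_comp_of_integrable h

theorem integral_sq_heatMeasure (i : Fin d) {s : ℝ} (hs : 0 ≤ s) :
    ∫ y, y i ^ 2 ∂(heatMeasure d s) = 2 * s := by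
  have h1 : ∫ y : ℝ, y ^ 2 ∂(gaussianReal 0 (2 * s).toNNReal) = 2 * s := by
    have h := variance_fun_id_gaussianReal (μ := 0) (v := (2 * s).toNNReal)
    rw [variance_of_integral_eq_zero (by fun_prop) (by simp)] at h
    rw [h, Real.coe_toNNReal _ (by linarith)]
  have hp := measurePreserving_eval (fun _ : Fin d => gaussianReal 0 (2 * s).toNNReal) i
  rw [← h1, ← hp.map_eq, integral_map hp.measurable.aemeasurable (by fun_prop)]
  rfl

/-- The fractional moment is bounded by the second moment at the length scale √s. It serves the
Gaussian at time s, and the Fejér kernel with s = 1/(N+1). -/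
theorem norm_rpow_le_one_add {α s : ℝ} (hα : 0 ≤ α) (hα1 : α ≤ 1) (hs : 0 < s) {t q : ℝ}
    (ht : 0 ≤ t) (htq : t ^ 2 ≤ q) : t ^ α ≤ s ^ (α / 2) * (1 + q / s) := by
  have hss : s ^ (α / 2) = (√s) ^ α := by
    rw [Real.sqrt_eq_rpow, ← Real.rpow_mul hs.le]
    congr 1
    ring
  have hsq : 0 < √s := Real.sqrt_pos.2 hs
  have h1 : (t / √s) ^ α ≤ 1 + q / s := by
    have h2 : (t / √s) ^ 2 ≤ q / s := by
      rw [div_pow, Real.sq_sqrt hs.le]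
      exact div_le_div_of_nonneg_right htq hs.le
    rcases le_total (t / √s) 1 with h | h
    · have := Real.rpow_le_one (by positivity) h hα
      nlinarith [sq_nonneg (t / √s)]
    · have : (t / √s) ^ α ≤ (t / √s) ^ (2 : ℝ) :=
        Real.rpow_le_rpow_of_exponent_le h (by linarith)
      rw [Real.rpow_two] at this
      linarith
  rw [Real.div_rpow ht hsq.le, div_le_iff₀ (Real.rpow_pos_of_pos hsq _)] at h1
  rw [hss]
  linarith

theorem norm_sq_le_sum_sq (y : Fin d → ℝ) : ‖y‖ ^ 2 ≤ ∑ i, y i ^ 2 := by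
  have h : ‖y‖ ≤ √(∑ i, y i ^ 2) := by
    refine (pi_norm_le_iff_of_nonneg (Real.sqrt_nonneg _)).2 fun i => ?_
    refine Real.le_sqrt_of_sq_le ?_
    rw [Real.norm_eq_abs, sq_abs]
    exact Finset.single_le_sum (f := fun i => y i ^ 2) (fun _ _ => sq_nonneg _) (Finset.mem_univ i)
  have h2 := pow_le_pow_left₀ (norm_nonneg y) h 2
  rwa [Real.sq_sqrt (Finset.sum_nonneg fun _ _ => sq_nonneg _)] at h2

section

variable [hL : Fact (0 < L)]

/-- The commutator of the heat semigroup with the multiplication by a Hölder function. -/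
theorem norm_heat_mul_commutator_le {α H s : ℝ} (hα : 0 ≤ α) (hα1 : α ≤ 1) (hH : 0 ≤ H)
    {V : Torus d L → ℝ} (hV : Continuous V) (hVH : ∀ x y, |V (x + y) - V x| ≤ H * ‖y‖ ^ α)
    (hs : 0 < s) (K : Finset (Fin d → ℤ)) (a b : (Fin d → ℤ) → ℂ) :
    ‖heatForm K (laplaceSymbol L) (mulCoeff V) s a b‖
      ≤ (1 + 2 * d) * H * L ^ d * s ^ (α / 2) * (l2Coeff K a * l2Coeff K b) := by
  have hLd : 0 ≤ L ^ d := torus_volume_pos.le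
  have hI : ∀ k : Fin d → ℤ, Integrable (fun y => character k (toTorus L y)) (heatMeasure d s) := by
    intro k
    refine Integrable.of_bound (C := 1) (Continuous.aestronglyMeasurable (by fun_prop)) ?_
    exact Eventually.of_forall fun y => by simp
  have hterm : ∀ k l : Fin d → ℤ, Integrable (fun y => a k * conj (b l) *
      (character l (toTorus L y) - character k (toTorus L y)) * mulCoeff V k l) (heatMeasure d s) :=
    fun k l => (((hI l).sub (hI k)).const_mul _).mul_const _
  -- The heat commutator is the Gaussian average of the translation commutators.
  have h1 : heatForm K (laplaceSymbol L) (mulCoeff V) s a b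
      = ∫ y, ∑ k ∈ K, ∑ l ∈ K, a k * conj (b l) *
        (character l (toTorus L y) - character k (toTorus L y)) * mulCoeff V k l
          ∂(heatMeasure d s) := by
    rw [integral_finsetSum _ fun k _ => integrable_finsetSum _ fun l _ => hterm k l, heatForm]
    refine Finset.sum_congr rfl fun k _ => ?_
    rw [integral_finsetSum _ fun l _ => hterm k l]
    refine Finset.sum_congr rfl fun l _ => ?_
    rw [integral_mul_const, integral_const_mul, integral_sub (hI l) (hI k),
      integral_character_heatMeasure l hs.le, integral_character_heatMeasure k hs.le]
    push_cast
    rfl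
  have hQ : Integrable (fun y : Fin d → ℝ => 1 + (∑ i, y i ^ 2) / s) (heatMeasure d s) :=
    (integrable_const _).add ((integrable_finsetSum _ fun i _ =>
      integrable_sq_heatMeasure i s).div_const s)
  -- The second moment is 2s in each coordinate; this is the source of the constant 1 + 2d.
  have hQv : ∫ y : Fin d → ℝ, (1 + (∑ i, y i ^ 2) / s) ∂(heatMeasure d s) = 1 + 2 * d := by
    rw [integral_add (integrable_const _) ((integrable_finsetSum _ fun i _ =>
      integrable_sq_heatMeasure i s).div_const s), integral_div,
      integral_finsetSum _ fun i _ => integrable_sq_heatMeasure i s]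
    simp only [integral_sq_heatMeasure _ hs.le]
    simp
    field_simp
  rw [h1]
  calc _ ≤ ∫ y : Fin d → ℝ, (H * s ^ (α / 2) * L ^ d * (l2Coeff K a * l2Coeff K b))
          * (1 + (∑ i, y i ^ 2) / s) ∂(heatMeasure d s) := by
        refine norm_integral_le_of_norm_le (hQ.const_mul _) (Eventually.of_forall fun y => ?_)
        refine (norm_translation_commutator_le hV (fun x => hVH x (toTorus L y)) K a b).trans ?_
        have h2 : ‖toTorus L y‖ ^ α ≤ s ^ (α / 2) * (1 + (∑ i, y i ^ 2) / s) := by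
          refine norm_rpow_le_one_add hα hα1 hs (norm_nonneg _) ?_
          exact (pow_le_pow_left₀ (norm_nonneg _) (norm_toTorus_le y) 2).trans (norm_sq_le_sum_sq y)
        have h3 : 0 ≤ l2Coeff K a * l2Coeff K b :=
          mul_nonneg (l2Coeff_nonneg _ _) (l2Coeff_nonneg _ _)
        calc _ ≤ H * (s ^ (α / 2) * (1 + (∑ i, y i ^ 2) / s)) * L ^ d
              * (l2Coeff K a * l2Coeff K b) := by gcongr
          _ = _ := by ring
    _ = _ := by
        rw [integral_const_mul, hQv]
        ring

/-- The matrix `∑_j ∫ V_j ∂_j e_k conj(e_l)` of the transport operator `V · ∇`. -/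
noncomputable def transportCoeff (V : Fin d → Torus d L → ℝ) (k l : Fin d → ℤ) : ℂ :=
  ∑ j, derivSymbol L j k * mulCoeff (V j) k l

/-- The derivative is a Fourier multiplier and commutes with the semigroup, so only the
multiplications by the components contribute to the commutator. The derivative stays on `a` and
costs its gradient norm. -/
theorem norm_heat_transport_commutator_le {α H s : ℝ} (hα : 0 ≤ α) (hα1 : α ≤ 1) (hH : 0 ≤ H)
    {V : Fin d → Torus d L → ℝ} (hV : ∀ j, Continuous (V j))
    (hVH : ∀ j x y, |V j (x + y) - V j x| ≤ H * ‖y‖ ^ α)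
    (hs : 0 < s) (K : Finset (Fin d → ℤ)) (a b : (Fin d → ℤ) → ℂ) :
    ‖heatForm K (laplaceSymbol L) (transportCoeff V) s a b‖
      ≤ (d * ((1 + 2 * d) * H * L ^ d)) * s ^ (α / 2) *
        gradCoeff K (laplaceSymbol L) a * l2Coeff K b := by
  have hLd : 0 ≤ L ^ d := torus_volume_pos.le
  have h1 : heatForm K (laplaceSymbol L) (transportCoeff V) s a b
      = ∑ j, heatForm K (laplaceSymbol L) (mulCoeff (V j)) s (fun k => derivSymbol L j k * a k) b := by
    simp only [heatForm, transportCoeff, Finset.mul_sum]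
    conv_rhs => rw [Finset.sum_comm]
    refine Finset.sum_congr rfl fun k _ => ?_
    conv_rhs => rw [Finset.sum_comm]
    refine Finset.sum_congr rfl fun j _ => Finset.sum_congr rfl fun l _ => ?_
    ring
  rw [h1]
  refine (norm_sum_le _ _).trans ?_
  have h2 : ∀ j ∈ (Finset.univ : Finset (Fin d)),
      ‖heatForm K (laplaceSymbol L) (mulCoeff (V j)) s (fun k => derivSymbol L j k * a k) b‖
      ≤ (1 + 2 * d) * H * L ^ d * s ^ (α / 2) * (gradCoeff K (laplaceSymbol L) a * l2Coeff K b) := by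
    intro j _
    refine (norm_heat_mul_commutator_le hα hα1 hH (hV j) (hVH j) hs K _ b).trans ?_
    refine mul_le_mul_of_nonneg_left ?_ (by positivity)
    refine mul_le_mul_of_nonneg_right ?_ (l2Coeff_nonneg _ _)
    refine l2Coeff_mono fun k _ => ?_
    rw [norm_mul, norm_mul, Complex.norm_real, Real.norm_of_nonneg (Real.sqrt_nonneg _)]
    exact mul_le_mul_of_nonneg_right (norm_derivSymbol_le j k) (norm_nonneg _)
  refine (Finset.sum_le_card_nsmul _ _ _ h2).trans (le_of_eq ?_)
  simp
  ring

end

end VectorMixing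

namespace VectorMixing

variable {d : ℕ} {L : ℝ}

/-! ### Morrey's inequality on the torus -/

theorem hasDerivAt_character_line (k : Fin d → ℤ) (x : Torus d L) (w : Fin d → ℝ) (t : ℝ) :
    HasDerivAt (fun t : ℝ => character k (x + toTorus L (t • w)))
      ((∑ j, (w j : ℂ) * derivSymbol L j k) * character k (x + toTorus L (t • w))) t := by
  have h1 : ∀ t : ℝ, character k (x + toTorus L (t • w))
      = character k x * Complex.exp ((t : ℂ) * ∑ j, (w j : ℂ) * derivSymbol L j k) := by
    intro t
    rw [character_add_apply, show toTorus L (t • w) = fun i => (((t • w) i : ℝ) : AddCircle L) from rfl,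
      character_coe]
    congr 2
    simp only [derivSymbol, Finset.mul_sum]
    push_cast
    rw [Finset.mul_sum]
    refine Finset.sum_congr rfl fun i _ => ?_
    simp only [Pi.smul_apply, smul_eq_mul]
    push_cast
    ring
  simp only [h1]
  have h2 : HasDerivAt (fun t : ℝ => (t : ℂ) * ∑ j, (w j : ℂ) * derivSymbol L j k)
      (1 * ∑ j, (w j : ℂ) * derivSymbol L j k) t := (Complex.ofRealCLM.hasDerivAt).mul_const _
  have h3 := (h2.cexp).const_mul (character k x)
  refine h3.congr_deriv ?_
  ring

theorem hasDerivAt_trigPoly_line (K : Finset (Fin d → ℤ)) (a : (Fin d → ℤ) → ℂ) (x : Torus d L)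
    (w : Fin d → ℝ) (t : ℝ) :
    HasDerivAt (fun t : ℝ => trigPoly K a (x + toTorus L (t • w)))
      (∑ j, (w j : ℂ) * trigPoly K (fun k => derivSymbol L j k * a k) (x + toTorus L (t • w))) t := by
  unfold trigPoly
  have h := HasDerivAt.fun_sum (u := K) fun k (_ : k ∈ K) =>
    (hasDerivAt_character_line k x w t).const_mul (a k)
  refine h.congr_deriv ?_
  simp only [Finset.mul_sum, Finset.sum_mul]
  rw [Finset.sum_comm]
  exact Finset.sum_congr rfl fun j _ => Finset.sum_congr rfl fun k _ => by ring

/-- The fundamental theorem of calculus along a segment, stated in `ℝ≥0∞` so that Tonelli applies to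
the averages that follow. -/
theorem enorm_trigPoly_line_sub_le (K : Finset (Fin d → ℤ)) (a : (Fin d → ℤ) → ℂ) (x : Torus d L)
    (w : Fin d → ℝ) :
    ‖trigPoly K a (x + toTorus L w) - trigPoly K a x‖ₑ
      ≤ ∑ j, ENNReal.ofReal ‖w‖ * ∫⁻ t in Ioc (0 : ℝ) 1,
        ‖trigPoly K (fun k => derivSymbol L j k * a k) (x + toTorus L (t • w))‖ₑ := by
  have hsm : Continuous fun t : ℝ => toTorus L (t • w) :=
    continuous_toTorus.comp (continuous_id.smul continuous_const)
  have hcont : ∀ j : Fin d, Continuous fun t : ℝ => (w j : ℂ) *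
      trigPoly K (fun k => derivSymbol L j k * a k) (x + toTorus L (t • w)) := by
    intro j
    fun_prop
  have h0 : toTorus L (0 : Fin d → ℝ) = 0 := by funext i; simp [toTorus]
  have h := intervalIntegral.integral_eq_sub_of_hasDerivAt (a := 0) (b := 1)
    (fun t _ => hasDerivAt_trigPoly_line K a x w t)
    ((continuous_finsetSum _ fun j _ => hcont j).intervalIntegrable 0 1)
  simp only [one_smul, zero_smul, h0, add_zero] at h
  rw [← h, intervalIntegral.integral_of_le zero_le_one]
  refine (enorm_integral_le_lintegral_enorm _).trans ?_
  calc _ ≤ ∫⁻ t in Ioc (0 : ℝ) 1, ∑ j, ENNReal.ofReal ‖w‖ *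
        ‖trigPoly K (fun k => derivSymbol L j k * a k) (x + toTorus L (t • w))‖ₑ := by
        refine lintegral_mono fun t => (enorm_sum_le _ _).trans (Finset.sum_le_sum fun j _ => ?_)
        rw [enorm_mul]
        refine mul_le_mul_left ?_ _
        rw [← ofReal_norm, Complex.norm_real]
        exact ENNReal.ofReal_le_ofReal (norm_le_pi_norm w j)
    _ = _ := by
        rw [lintegral_finsetSum']
        · refine Finset.sum_congr rfl fun j _ => ?_
          rw [lintegral_const_mul' _ _ ENNReal.ofReal_ne_top]
        · intro j _
          refine AEMeasurable.const_mul ?_ _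
          refine Continuous.aemeasurable ?_
          fun_prop

section

variable [hL : Fact (0 < L)]

theorem measurePreserving_toTorus :
    MeasurePreserving (toTorus L : (Fin d → ℝ) → Torus d L)
      (volume.restrict (Set.univ.pi fun _ => Ioc 0 L)) volume := by
  have h := measurePreserving_pi (fun _ : Fin d => volume.restrict (Ioc 0 (0 + L)))
    (fun _ : Fin d => (volume : Measure (AddCircle L))) (fun _ => AddCircle.measurePreserving_mk L 0)
  rw [zero_add] at h
  rw [volume_pi, Measure.restrict_pi_pi]
  exact h

/-- The unit cube. -/
def unitCube (d : ℕ) : Set (Fin d → ℝ) := Set.univ.pi fun _ => Ioc 0 1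

theorem volume_unitCube : volume (unitCube d) = 1 := by
  simp [unitCube, Real.volume_pi_Ioc]

theorem measurableSet_unitCube : MeasurableSet (unitCube d) :=
  MeasurableSet.univ_pi fun _ => measurableSet_Ioc

/-- For σ ≤ L the dilated cube lies in one fundamental domain, so no point of the torus is covered
twice and the pushforward has density at most σ^(-d). -/
theorem map_dilation_le {σ : ℝ} (hσ : 0 < σ) (hσL : σ ≤ L) :
    Measure.map (fun z : Fin d → ℝ => toTorus L (σ • z)) (volume.restrict (unitCube d))
      ≤ ENNReal.ofReal ((σ ^ d)⁻¹) • (volume : Measure (Torus d L)) := by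
  have hm : Measurable fun z : Fin d → ℝ => toTorus L (σ • z) :=
    (continuous_toTorus.comp (continuous_const_smul σ)).measurable
  have hm' : Measurable (toTorus L : (Fin d → ℝ) → Torus d L) := continuous_toTorus.measurable
  refine Measure.le_iff.2 fun A hA => ?_
  rw [Measure.map_apply hm hA, Measure.restrict_apply (hm hA)]
  have hsub : (fun z : Fin d → ℝ => toTorus L (σ • z)) ⁻¹' A ∩ unitCube d
      ⊆ (fun z : Fin d → ℝ => σ • z) ⁻¹' (toTorus L ⁻¹' A ∩ Set.univ.pi fun _ => Ioc 0 L) := by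
    rintro z ⟨hz1, hz2⟩
    refine ⟨hz1, fun i _ => ?_⟩
    have := hz2 i (mem_univ i)
    simp only [Pi.smul_apply, smul_eq_mul, mem_Ioc] at this ⊢
    exact ⟨mul_pos hσ this.1, (mul_le_of_le_one_right hσ.le this.2).trans hσL⟩
  refine (measure_mono hsub).trans ?_
  rw [Measure.addHaar_preimage_smul _ hσ.ne', ← Measure.restrict_apply (hm' hA),
    measurePreserving_toTorus.measure_preimage hA.nullMeasurableSet]
  simp [abs_of_pos hσ]

/-- The unit cube is a probability space, so the mean is at most the L^q mean; the density of the
dilated cube then produces σ^(-d/q). -/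
theorem lintegral_unitCube_le {q σ : ℝ} (hq : 1 ≤ q) (hσ : 0 < σ) (hσL : σ ≤ L)
    {g : Torus d L → ℂ} (hg : Continuous g) (c : Torus d L) :
    ∫⁻ z in unitCube d, ‖g (c + toTorus L (σ • z))‖ₑ
      ≤ ENNReal.ofReal (σ ^ (-(d / q))) * eLpNorm g (ENNReal.ofReal q) volume := by
  have hm : Continuous fun z : Fin d → ℝ => toTorus L (σ • z) :=
    continuous_toTorus.comp (continuous_const_smul σ)
  have hprob : IsProbabilityMeasure ((volume : Measure (Fin d → ℝ)).restrict (unitCube d)) :=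
    ⟨by simp [volume_unitCube]⟩
  have hgc : Continuous fun x => g (c + x) := by fun_prop
  have hq0 : 0 < q := by linarith
  calc ∫⁻ z in unitCube d, ‖g (c + toTorus L (σ • z))‖ₑ
      = eLpNorm (fun z => g (c + toTorus L (σ • z))) 1 (volume.restrict (unitCube d)) :=
        (eLpNorm_one_eq_lintegral_enorm).symm
    _ ≤ eLpNorm (fun z => g (c + toTorus L (σ • z))) (ENNReal.ofReal q)
          (volume.restrict (unitCube d)) := by
        refine eLpNorm_le_eLpNorm_of_exponent_le ?_ (Continuous.aestronglyMeasurable (by fun_prop))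
        rw [← ENNReal.ofReal_one]
        exact ENNReal.ofReal_le_ofReal hq
    _ = eLpNorm (fun x => g (c + x)) (ENNReal.ofReal q)
          (Measure.map (fun z : Fin d → ℝ => toTorus L (σ • z)) (volume.restrict (unitCube d))) :=
        (eLpNorm_map_measure hgc.aestronglyMeasurable hm.aemeasurable).symm
    _ ≤ eLpNorm (fun x => g (c + x)) (ENNReal.ofReal q)
          (ENNReal.ofReal ((σ ^ d)⁻¹) • (volume : Measure (Torus d L))) :=
        eLpNorm_mono_measure _ (map_dilation_le hσ hσL)
    _ = ENNReal.ofReal (σ ^ (-(d / q))) * eLpNorm (fun x => g (c + x)) (ENNReal.ofReal q) volume := by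
        have hq1 : ENNReal.ofReal q ≠ ⊤ := ENNReal.ofReal_ne_top
        rw [eLpNorm_smul_measure_of_ne_top hq1, one_div, ENNReal.toReal_inv,
          ENNReal.toReal_ofReal hq0.le, smul_eq_mul,
          ENNReal.ofReal_rpow_of_pos (by positivity)]
        congr 2
        rw [← Real.rpow_natCast, ← Real.rpow_neg hσ.le, ← Real.rpow_mul hσ.le]
        congr 1
        ring
    _ = _ := by
        congr 1
        exact eLpNorm_comp_measurePreserving hg.aestronglyMeasurable
          (measurePreserving_add_left volume c)

theorem lintegral_rpow_Ioc {β ρ : ℝ} (hβ : β < 1) (hρ : 0 < ρ) :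
    ∫⁻ t in Ioc (0 : ℝ) 1, ENNReal.ofReal ((t * ρ) ^ (-β))
      = ENNReal.ofReal (ρ ^ (-β) / (1 - β)) := by
  have hI : IntegrableOn (fun t : ℝ => (t * ρ) ^ (-β)) (Ioc 0 1) := by
    have := (intervalIntegral.intervalIntegrable_rpow' (a := 0) (b := 1) (r := -β) (by linarith))
    have h2 := ((intervalIntegrable_iff_integrableOn_Ioc_of_le zero_le_one).1 this).mul_const (ρ ^ (-β))
    refine IntegrableOn.congr_fun h2 (fun t ht => ?_) measurableSet_Ioc
    exact (Real.mul_rpow (le_of_lt ht.1) hρ.le).symm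
  rw [← ofReal_integral_eq_lintegral_ofReal hI]
  · congr 1
    rw [setIntegral_congr_fun (g := fun t : ℝ => t ^ (-β) * ρ ^ (-β)) measurableSet_Ioc
      (fun t ht => Real.mul_rpow (le_of_lt ht.1) hρ.le), integral_mul_const,
      ← intervalIntegral.integral_of_le zero_le_one, integral_rpow (Or.inl (by linarith))]
    rw [Real.one_rpow, Real.zero_rpow (by linarith), sub_zero, neg_add_eq_sub]
    ring
  · refine (ae_restrict_iff' measurableSet_Ioc).2 (Eventually.of_forall fun t ht => ?_)
    exact Real.rpow_nonneg (mul_nonneg (le_of_lt ht.1) hρ.le) _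

/-- Morrey's averaging argument. At parameter t the segments from ξ to the points of a cube of side
ρ fill a translate of a cube of side tρ, where the derivative has mean at most (tρ)^(-d/q) times its
L^q norm; this is integrable in t because d/q < 1. -/
theorem lintegral_cube_sub_le {q ρ : ℝ} (hq : 1 ≤ q) (hdq : (d : ℝ) / q < 1) (hρ : 0 < ρ)
    (hρL : ρ ≤ L) (K : Finset (Fin d → ℤ)) (a : (Fin d → ℤ) → ℂ) (c : Torus d L) {ξ : Fin d → ℝ}
    (hξ : ∀ i, ξ i ∈ Icc (0 : ℝ) 1) :
    ∫⁻ z in unitCube d, ‖trigPoly K a (c + toTorus L (ρ • z)) - trigPoly K a (c + toTorus L (ρ • ξ))‖ₑ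
      ≤ ENNReal.ofReal (ρ ^ (1 - d / q) / (1 - d / q)) *
        ∑ j, eLpNorm (trigPoly K (fun k => derivSymbol L j k * a k) : Torus d L → ℂ)
          (ENNReal.ofReal q) volume := by
  set g : Fin d → Torus d L → ℂ := fun j => trigPoly K (fun k => derivSymbol L j k * a k) with hgdef
  have hg : ∀ j, Continuous (g j) := fun j => continuous_trigPoly _ _
  have hpt : ∀ z ∈ unitCube d,
      ‖trigPoly K a (c + toTorus L (ρ • z)) - trigPoly K a (c + toTorus L (ρ • ξ))‖ₑ
      ≤ ∑ j, ENNReal.ofReal ρ * ∫⁻ t in Ioc (0 : ℝ) 1,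
        ‖g j ((c + toTorus L (ρ • ξ)) + toTorus L (t • (ρ • (z - ξ))))‖ₑ := by
    intro z hz
    have h1 := enorm_trigPoly_line_sub_le K a (c + toTorus L (ρ • ξ)) (ρ • (z - ξ))
    have h2 : c + toTorus L (ρ • ξ) + toTorus L (ρ • (z - ξ)) = c + toTorus L (ρ • z) := by
      rw [add_assoc, ← toTorus_add, ← smul_add, add_sub_cancel]
    rw [h2] at h1
    refine h1.trans (Finset.sum_le_sum fun j _ => mul_le_mul_left (ENNReal.ofReal_le_ofReal ?_) _)
    rw [norm_smul, Real.norm_of_nonneg hρ.le]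
    refine mul_le_of_le_one_right hρ.le ((pi_norm_le_iff_of_nonneg zero_le_one).2 fun i => ?_)
    have hz' := hz i (mem_univ i)
    have hx' := hξ i
    rw [Pi.sub_apply, Real.norm_eq_abs, abs_le]
    simp only [mem_Ioc, mem_Icc] at hz' hx'
    constructor <;> linarith
  have hjoint : ∀ j, Continuous fun p : (Fin d → ℝ) × ℝ =>
      g j ((c + toTorus L (ρ • ξ)) + toTorus L (p.2 • (ρ • (p.1 - ξ)))) := by
    intro j
    refine (hg j).comp (continuous_const.add (continuous_toTorus.comp ?_))
    fun_prop
  have hline : ∀ j, ∫⁻ z in unitCube d, ∫⁻ t in Ioc (0 : ℝ) 1,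
        ‖g j ((c + toTorus L (ρ • ξ)) + toTorus L (t • (ρ • (z - ξ))))‖ₑ
      ≤ ENNReal.ofReal (ρ ^ (-(d / q)) / (1 - d / q)) * eLpNorm (g j) (ENNReal.ofReal q) volume := by
    intro j
    rw [lintegral_lintegral_swap ((hjoint j).enorm.aemeasurable)]
    calc _ ≤ ∫⁻ t in Ioc (0 : ℝ) 1, ENNReal.ofReal ((t * ρ) ^ (-(d / q)))
          * eLpNorm (g j) (ENNReal.ofReal q) volume := by
          refine setLIntegral_mono' measurableSet_Ioc fun t ht => ?_
          have h3 := lintegral_unitCube_le (σ := t * ρ) hq (mul_pos ht.1 hρ)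
            ((mul_le_of_le_one_left hρ.le ht.2).trans hρL) (hg j)
            -- The centre absorbs the part of the segment that does not depend on z.
            (c + toTorus L (ρ • ξ) + toTorus L (-((t * ρ) • ξ)))
          refine le_trans (le_of_eq ?_) h3
          refine lintegral_congr fun z => ?_
          rw [add_assoc (c + toTorus L (ρ • ξ)), ← toTorus_add]
          congr 4
          rw [smul_smul, smul_sub]
          abel
      _ = _ := by
          rw [lintegral_mul_const' _ _ ?_, lintegral_rpow_Ioc hdq hρ]
          exact ((hg j).memLp_of_hasCompactSupport
            (HasCompactSupport.of_compactSpace _)).eLpNorm_ne_top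
  calc _ ≤ ∫⁻ z in unitCube d, ∑ j, ENNReal.ofReal ρ * ∫⁻ t in Ioc (0 : ℝ) 1,
        ‖g j ((c + toTorus L (ρ • ξ)) + toTorus L (t • (ρ • (z - ξ))))‖ₑ :=
        setLIntegral_mono' measurableSet_unitCube hpt
    _ = ∑ j, ENNReal.ofReal ρ * ∫⁻ z in unitCube d, ∫⁻ t in Ioc (0 : ℝ) 1,
        ‖g j ((c + toTorus L (ρ • ξ)) + toTorus L (t • (ρ • (z - ξ))))‖ₑ := by
        rw [lintegral_finsetSum]
        · exact Finset.sum_congr rfl fun j _ => lintegral_const_mul' _ _ ENNReal.ofReal_ne_top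
        · intro j _
          exact (Measurable.lintegral_prod_right' ((hjoint j).enorm.measurable)).const_mul _
    _ ≤ ∑ j, ENNReal.ofReal ρ * (ENNReal.ofReal (ρ ^ (-(d / q)) / (1 - d / q))
        * eLpNorm (g j) (ENNReal.ofReal q) volume) :=
        Finset.sum_le_sum fun j _ => mul_le_mul_right (hline j) _
    _ = _ := by
        rw [Finset.mul_sum]
        refine Finset.sum_congr rfl fun j _ => ?_
        rw [← mul_assoc, ← ENNReal.ofReal_mul hρ.le]
        congr 2
        rw [mul_div_assoc', sub_eq_add_neg 1 ((d : ℝ) / q), Real.rpow_add hρ, Real.rpow_one]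

/-- Both values are compared with the value at a running point of the cube, and the triangle
inequality is averaged over that point. -/
theorem enorm_trigPoly_cube_sub_le {q ρ : ℝ} (hq : 1 ≤ q) (hdq : (d : ℝ) / q < 1) (hρ : 0 < ρ)
    (hρL : ρ ≤ L) (K : Finset (Fin d → ℤ)) (a : (Fin d → ℤ) → ℂ) (c : Torus d L) {ξ η : Fin d → ℝ}
    (hξ : ∀ i, ξ i ∈ Icc (0 : ℝ) 1) (hη : ∀ i, η i ∈ Icc (0 : ℝ) 1) :
    ‖trigPoly K a (c + toTorus L (ρ • ξ)) - trigPoly K a (c + toTorus L (ρ • η))‖ₑ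
      ≤ 2 * (ENNReal.ofReal (ρ ^ (1 - d / q) / (1 - d / q)) *
        ∑ j, eLpNorm (trigPoly K (fun k => derivSymbol L j k * a k) : Torus d L → ℂ)
          (ENNReal.ofReal q) volume) := by
  have hm : ∀ ζ : Fin d → ℝ, Measurable fun z : Fin d → ℝ =>
      ‖trigPoly K a (c + toTorus L (ρ • z)) - trigPoly K a (c + toTorus L (ρ • ζ))‖ₑ := by
    intro ζ
    have : Continuous fun z : Fin d → ℝ => toTorus L (ρ • z) :=
      continuous_toTorus.comp (continuous_const_smul ρ)
    exact Continuous.measurable (by fun_prop)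
  calc _ = ∫⁻ z in unitCube d,
        ‖trigPoly K a (c + toTorus L (ρ • ξ)) - trigPoly K a (c + toTorus L (ρ • η))‖ₑ := by
        simp [volume_unitCube]
    _ ≤ ∫⁻ z in unitCube d,
        (‖trigPoly K a (c + toTorus L (ρ • z)) - trigPoly K a (c + toTorus L (ρ • ξ))‖ₑ
        + ‖trigPoly K a (c + toTorus L (ρ • z)) - trigPoly K a (c + toTorus L (ρ • η))‖ₑ) := by
        refine lintegral_mono fun z => ?_
        have h := enorm_sub_le (a := trigPoly K a (c + toTorus L (ρ • z))
          - trigPoly K a (c + toTorus L (ρ • η)))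
          (b := trigPoly K a (c + toTorus L (ρ • z)) - trigPoly K a (c + toTorus L (ρ • ξ)))
        rw [sub_sub_sub_cancel_left] at h
        exact h.trans (le_of_eq (add_comm _ _))
    _ ≤ _ := by
        rw [lintegral_add_left (hm ξ), two_mul]
        exact add_le_add (lintegral_cube_sub_le hq hdq hρ hρL K a c hξ)
          (lintegral_cube_sub_le hq hdq hρ hρL K a c hη)

/-- Morrey's inequality for trigonometric polynomials. -/
theorem norm_trigPoly_add_sub_le {q α : ℝ} (hq : 1 ≤ q) (hα : 0 < α) (hcrit : q * (1 - α) = d)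
    (K : Finset (Fin d → ℤ)) (a : (Fin d → ℤ) → ℂ) {B : ℝ}
    (hB : ∀ j, eLpNorm (trigPoly K (fun k => derivSymbol L j k * a k) : Torus d L → ℂ)
      (ENNReal.ofReal q) volume ≤ ENNReal.ofReal B) (hB0 : 0 ≤ B) (x y : Torus d L) :
    ‖trigPoly K a (x + y) - trigPoly K a x‖ ≤ (2 / α * d * B) * ‖y‖ ^ α := by
  have hq0 : 0 < q := by linarith
  have hdq : (d : ℝ) / q = 1 - α := by rw [← hcrit]; field_simp
  obtain ⟨z, rfl, hz⟩ := exists_toTorus_norm_eq y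
  rcases (norm_nonneg z).eq_or_lt with h0 | hρ
  · have : z = 0 := norm_eq_zero.1 h0.symm
    have h1 : toTorus L z = 0 := by rw [this]; funext i; simp [toTorus]
    simp [h1, Real.zero_rpow hα.ne']
  have hρL : ‖z‖ ≤ L := by
    rw [hz]
    refine (pi_norm_le_iff_of_nonneg hL.out.le).2 fun i => ?_
    have h1 := AddCircle.norm_le_half_period L hL.out.ne' (x := toTorus L z i)
    rw [abs_of_pos hL.out] at h1
    linarith [hL.out]
  set ρ := ‖z‖ with hρdef
  -- The cube of side ‖z‖ with lowest corner x + min(z, 0) contains both points: ξ is the position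
  -- of x in it, η that of x + z.
  set ξ : Fin d → ℝ := fun i => -(min (z i) 0) / ρ with hξ
  set η : Fin d → ℝ := fun i => (z i - min (z i) 0) / ρ with hη
  have hb : ∀ i, |z i| ≤ ρ := fun i => norm_le_pi_norm z i
  have hξ' : ∀ i, ξ i ∈ Icc (0 : ℝ) 1 := by
    intro i
    have h1 := abs_le.1 (hb i)
    have h2 : min (z i) 0 ≤ 0 := min_le_right _ _
    have h3 : -ρ ≤ min (z i) 0 := le_min h1.1 (by linarith)
    exact ⟨div_nonneg (by linarith) hρ.le, (div_le_one hρ).2 (by linarith)⟩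
  have hη' : ∀ i, η i ∈ Icc (0 : ℝ) 1 := by
    intro i
    have h1 := abs_le.1 (hb i)
    refine ⟨div_nonneg (by linarith [min_le_left (z i) 0]) hρ.le, (div_le_one hρ).2 ?_⟩
    rcases le_total (z i) 0 with h | h
    · rw [min_eq_left h]; linarith
    · rw [min_eq_right h]; linarith
  have h := enorm_trigPoly_cube_sub_le hq (by rw [hdq]; linarith) hρ hρL K a
    (x + toTorus L fun i => min (z i) 0) hη' hξ'
  have e1 : x + toTorus L (fun i => min (z i) 0) + toTorus L (ρ • η) = x + toTorus L z := by
    rw [add_assoc, ← toTorus_add]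
    congr 2
    funext i
    simp only [hη, Pi.add_apply, Pi.smul_apply, smul_eq_mul]
    field_simp
    ring
  have e2 : x + toTorus L (fun i => min (z i) 0) + toTorus L (ρ • ξ) = x := by
    rw [add_assoc, ← toTorus_add]
    have : ((fun i => min (z i) 0) + ρ • ξ : Fin d → ℝ) = 0 := by
      funext i
      simp only [hξ, Pi.add_apply, Pi.smul_apply, smul_eq_mul, Pi.zero_apply]
      field_simp
      ring
    rw [this]
    have h1 : toTorus L (0 : Fin d → ℝ) = 0 := by funext i; simp [toTorus]
    rw [h1, add_zero]
  rw [e1, e2, hdq, sub_sub_cancel] at h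
  have hsum : ∑ j, eLpNorm (trigPoly K (fun k => derivSymbol L j k * a k) : Torus d L → ℂ)
      (ENNReal.ofReal q) volume ≤ ENNReal.ofReal (d * B) := by
    refine (Finset.sum_le_card_nsmul _ _ _ fun j _ => hB j).trans (le_of_eq ?_)
    rw [Finset.card_univ, Fintype.card_fin, nsmul_eq_mul, ENNReal.ofReal_mul (Nat.cast_nonneg d),
      ENNReal.ofReal_natCast]
  have h2 : ‖trigPoly K a (x + toTorus L z) - trigPoly K a x‖ₑ
      ≤ ENNReal.ofReal ((2 / α * d * B) * ρ ^ α) := by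
    refine h.trans ((mul_le_mul_right (mul_le_mul_right hsum _) _).trans (le_of_eq ?_))
    rw [← ENNReal.ofReal_mul (by positivity), show (2 : ℝ≥0∞) = ENNReal.ofReal 2 by simp,
      ← ENNReal.ofReal_mul (by norm_num)]
    congr 1
    ring
  rw [← ofReal_norm, ENNReal.ofReal_le_ofReal_iff (by positivity)] at h2
  rw [← hz]
  exact h2

end

end VectorMixing

open scoped ComplexConjugate

namespace VectorMixing

variable {d : ℕ} {L : ℝ}

/-! ### One-dimensional exponential sums -/

/-- The exponential sum `∑_{a ≤ n ≤ b} exp (2 π i n θ / L)`. -/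
noncomputable def expSum (a b : ℤ) (θ : AddCircle L) : ℂ := ∑ n ∈ Finset.Icc a b, fourier n θ

@[fun_prop] theorem continuous_expSum (a b : ℤ) : Continuous (expSum a b : AddCircle L → ℂ) := by
  unfold expSum
  fun_prop

theorem norm_fourier_apply (n : ℤ) (θ : AddCircle L) : ‖(fourier n θ : ℂ)‖ = 1 := by
  rw [fourier_apply, Circle.norm_coe]

theorem norm_expSum_le (a b : ℤ) (θ : AddCircle L) : ‖expSum a b θ‖ ≤ (Finset.Icc a b).card := by
  refine (norm_sum_le _ _).trans ?_
  simp only [norm_fourier_apply, Finset.sum_const, nsmul_eq_mul, mul_one, le_refl]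

theorem one_sub_mul_expSum {a b : ℤ} (hab : a ≤ b) (θ : AddCircle L) :
    (1 - fourier 1 θ) * expSum a b θ = fourier a θ - fourier (b + 1) θ := by
  have h1 : expSum a b θ = ∑ n ∈ Finset.range (b + 1 - a).toNat, (fourier (a + n) θ : ℂ) := by
    rw [expSum, Int.Icc_eq_finset_map, Finset.sum_map]
    refine Finset.sum_congr rfl fun n _ => ?_
    simp
  have h2 : ∀ n : ℕ, (1 - fourier 1 θ) * (fourier (a + n) θ : ℂ)
      = fourier (a + n) θ - fourier (a + (n + 1 : ℕ)) θ := by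
    intro n
    rw [sub_mul, one_mul, ← fourier_add]
    congr 3
    push_cast
    ring
  rw [h1, Finset.mul_sum, Finset.sum_congr rfl fun n _ => h2 n,
    Finset.sum_range_sub' (fun n : ℕ => (fourier (a + n) θ : ℂ))]
  have h3 : a + ((b + 1 - a).toNat : ℤ) = b + 1 := by
    rw [Int.toNat_of_nonneg (by linarith)]
    ring
  rw [h3]
  simp

theorem norm_one_sub_mul_expSum_le {a b : ℤ} (hab : a ≤ b) (θ : AddCircle L) :
    ‖1 - fourier 1 θ‖ * ‖expSum a b θ‖ ≤ 2 := by
  rw [← norm_mul, one_sub_mul_expSum hab]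
  refine (norm_sub_le _ _).trans ?_
  rw [norm_fourier_apply, norm_fourier_apply]
  norm_num

theorem exists_coe_norm_eq [Fact (0 < L)] (θ : AddCircle L) :
    ∃ z : ℝ, (z : AddCircle L) = θ ∧ |z| = ‖θ‖ := by
  obtain ⟨y, hy, hn⟩ := exists_toTorus_norm_eq (d := 1) (fun _ => θ)
  refine ⟨y 0, congrFun hy 0, ?_⟩
  have h1 : y = fun _ => y 0 := by funext i; rw [Subsingleton.elim i 0]
  rw [h1, pi_norm_const, pi_norm_const] at hn
  exact hn

/-- Jordan's inequality |1 - exp(iw)| ≥ 2|w|/π on [-π, π], with w = 2πz/L for the shortest lift z of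
θ. -/
theorem norm_le_norm_one_sub_fourier [hL : Fact (0 < L)] (θ : AddCircle L) :
    4 * ‖θ‖ / L ≤ ‖1 - (fourier 1 θ : ℂ)‖ := by
  obtain ⟨z, rfl, hz⟩ := exists_coe_norm_eq θ
  have hL0 := hL.out
  have hz2 : |z| ≤ L / 2 := by
    rw [hz]
    have h1 := AddCircle.norm_le_half_period L hL0.ne' (x := (z : AddCircle L))
    rwa [abs_of_pos hL0] at h1
  rw [← hz]
  set w : ℝ := 2 * Real.pi * z / L with hw
  have hf : (fourier 1 (z : AddCircle L) : ℂ) = Complex.exp (w * Complex.I) := by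
    rw [fourier_coe_apply, hw]
    congr 1
    push_cast
    ring
  have hwpi : |w| ≤ Real.pi := by
    rw [hw, abs_div, abs_mul, abs_of_pos hL0, abs_of_pos (by positivity : (0 : ℝ) < 2 * Real.pi),
      div_le_iff₀ hL0]
    nlinarith [Real.pi_pos]
  have hcos := Real.cos_le_one_sub_mul_cos_sq hwpi
  have hsq : ‖1 - (fourier 1 (z : AddCircle L) : ℂ)‖ ^ 2 = 2 - 2 * Real.cos w := by
    rw [hf, Complex.exp_mul_I, ← Complex.ofReal_cos, ← Complex.ofReal_sin, ← Complex.normSq_eq_norm_sq,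
      Complex.normSq_apply]
    simp only [Complex.sub_re, Complex.one_re, Complex.add_re, Complex.ofReal_re, Complex.mul_re,
      Complex.I_re, Complex.ofReal_im, Complex.I_im, Complex.sub_im, Complex.one_im, Complex.add_im,
      Complex.mul_im]
    nlinarith [Real.sin_sq_add_cos_sq w]
  refine le_of_sq_le_sq ?_ (norm_nonneg _)
  rw [hsq]
  have h3 : (4 * |z| / L) ^ 2 = 2 * (2 / Real.pi ^ 2 * w ^ 2) := by
    rw [hw, div_pow, mul_pow, sq_abs]
    field_simp
    ring
  rw [h3]
  linarith

section

variable [hL : Fact (0 < L)]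

theorem integrable_circle_of_continuous {E : Type*} [NormedAddCommGroup E] {f : AddCircle L → E}
    (hf : Continuous f) : Integrable f volume :=
  hf.integrable_of_hasCompactSupport (HasCompactSupport.of_compactSpace f)

theorem integral_norm_sq_expSum (a b : ℤ) :
    ∫ θ : AddCircle L, ‖expSum a b θ‖ ^ 2 = L * (Finset.Icc a b).card := by
  have h1 : ∀ θ : AddCircle L, ((‖expSum a b θ‖ ^ 2 : ℝ) : ℂ)
      = ∑ n ∈ Finset.Icc a b, ∑ m ∈ Finset.Icc a b, (fourier (n + -m) θ : ℂ) := by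
    intro θ
    push_cast
    rw [← Complex.mul_conj', expSum, map_sum, Finset.sum_mul_sum]
    simp only [fourier_add, fourier_neg]
  have h2 : ((∫ θ : AddCircle L, ‖expSum a b θ‖ ^ 2 : ℝ) : ℂ)
      = ∫ θ : AddCircle L, ((‖expSum a b θ‖ ^ 2 : ℝ) : ℂ) := integral_ofReal.symm
  have h3 : ((∫ θ : AddCircle L, ‖expSum a b θ‖ ^ 2 : ℝ) : ℂ)
      = ((L * (Finset.Icc a b).card : ℝ) : ℂ) := by
    rw [h2]
    simp only [h1]
    rw [integral_finsetSum _ fun n _ => integrable_circle_of_continuous (by fun_prop)]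
    have h4 : ∀ n ∈ Finset.Icc a b, ∫ θ : AddCircle L, ∑ m ∈ Finset.Icc a b,
        (fourier (n + -m) θ : ℂ) = L := by
      intro n hn
      rw [integral_finsetSum _ fun m _ => integrable_circle_of_continuous (by fun_prop)]
      simp only [integral_fourier]
      rw [Finset.sum_eq_single n]
      · simp
      · intro m _ hm
        rw [if_neg]
        rw [← sub_eq_add_neg, sub_eq_zero]
        exact fun h => hm h.symm
      · exact fun h => absurd hn h
    rw [Finset.sum_congr rfl h4]
    simp [mul_comm]
  exact_mod_cast h3

theorem integrable_norm_rpow_circle {r : ℝ} (hr : -1 < r) :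
    Integrable (fun θ : AddCircle L => ‖θ‖ ^ r) volume := by
  have hL0 := hL.out
  have hmp := AddCircle.measurePreserving_mk L (-(L / 2))
  rw [show -(L / 2) + L = L / 2 by ring] at hmp
  have hae : AEStronglyMeasurable (fun θ : AddCircle L => ‖θ‖ ^ r) volume :=
    (measurable_norm.pow_const r).aestronglyMeasurable
  refine (hmp.integrable_comp hae).1 ?_
  have hpos : IntervalIntegrable (fun x : ℝ => |x| ^ r) volume 0 (L / 2) := by
    refine (intervalIntegral.intervalIntegrable_rpow' hr).congr ?_
    intro x hx
    rw [uIoc_of_le (by linarith)] at hx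
    simp only [abs_of_pos hx.1]
  have hneg : IntervalIntegrable (fun x : ℝ => |x| ^ r) volume (-(L / 2)) 0 := by
    have h := (IntervalIntegrable.iff_comp_neg).1 hpos
    simpa using h.symm
  have hall := hneg.trans hpos
  rw [intervalIntegrable_iff_integrableOn_Ioc_of_le (by linarith)] at hall
  refine IntegrableOn.congr_fun hall (fun x hx => ?_) measurableSet_Ioc
  have : ‖(x : AddCircle L)‖ = |x| := by
    rw [AddCircle.norm_coe_eq_abs_iff L hL0.ne', abs_of_pos hL0, abs_le]
    exact ⟨hx.1.le, hx.2⟩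
  simp only [Function.comp_apply]
  rw [← this]

/-- The `L¹` norm of the Dirichlet kernel grows slower than any power. -/
theorem exists_integral_norm_dirichlet_le {ε : ℝ} (hε : 0 < ε) (hε1 : ε ≤ 1) :
    ∃ C : ℝ, 0 ≤ C ∧ ∀ N : ℕ,
      ∫ θ : AddCircle L, ‖expSum (-(N : ℤ)) N θ‖ ≤ C * (2 * N + 1 : ℝ) ^ ε := by
  have hL0 := hL.out
  -- The kernel D is bounded both by 2N + 1 and by L/(2‖θ‖). Writing D = D^(1-ε) D^ε and using the
  -- second bound in the first factor leaves a singularity of order 1 - ε < 1; its integral is the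
  -- constant.
  refine ⟨∫ θ : AddCircle L, (L / 2) ^ (1 - ε) * ‖θ‖ ^ (-(1 - ε)), ?_, fun N => ?_⟩
  · exact integral_nonneg fun θ => mul_nonneg (Real.rpow_nonneg (by linarith) _)
      (Real.rpow_nonneg (norm_nonneg _) _)
  rw [← integral_mul_const]
  have hI : Integrable (fun θ : AddCircle L => (L / 2) ^ (1 - ε) * ‖θ‖ ^ (-(1 - ε))
      * (2 * N + 1 : ℝ) ^ ε) volume :=
    ((integrable_norm_rpow_circle (by linarith)).const_mul _).mul_const _
  refine integral_mono_ae (integrable_circle_of_continuous (by fun_prop)) hI ?_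
  have hne : ∀ᵐ θ : AddCircle L, θ ≠ 0 := by
    have : (volume : Measure (AddCircle L)) {0} = 0 := by
      have h := AddCircle.volume_closedBall L (x := 0) 0
      simp only [Metric.closedBall_zero, mul_zero] at h
      rw [h]
      simp [hL0.le]
    exact measure_eq_zero_iff_ae_notMem.1 this
  filter_upwards [hne] with θ hθ
  have hθ0 : 0 < ‖θ‖ := norm_pos_iff.2 hθ
  set D := ‖expSum (-(N : ℤ)) N θ‖ with hD
  have hD0 : 0 ≤ D := norm_nonneg _
  have h1 : D ≤ 2 * N + 1 := by
    refine (norm_expSum_le _ _ _).trans (le_of_eq ?_)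
    rw [Int.card_Icc]
    have : ((N : ℤ) + 1 - -(N : ℤ)).toNat = 2 * N + 1 := by omega
    rw [this]
    push_cast
    ring
  have h2 : D ≤ L / 2 * ‖θ‖⁻¹ := by
    have h3 := norm_one_sub_mul_expSum_le (a := -(N : ℤ)) (b := N) (by omega) θ
    have h4 := mul_le_mul_of_nonneg_right (norm_le_norm_one_sub_fourier θ) hD0
    have h5 : 4 * ‖θ‖ / L * D ≤ 2 := h4.trans h3
    rw [div_mul_eq_mul_div, div_le_iff₀ hL0] at h5
    rw [← div_eq_mul_inv, le_div_iff₀ hθ0]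
    linarith
  calc D = D ^ (1 - ε) * D ^ ε := by
        rcases hD0.eq_or_lt with h0 | h0
        · rw [← h0, Real.zero_rpow hε.ne', mul_zero]
        · rw [← Real.rpow_add h0, sub_add_cancel, Real.rpow_one]
    _ ≤ (L / 2 * ‖θ‖⁻¹) ^ (1 - ε) * (2 * N + 1 : ℝ) ^ ε := by
        gcongr
    _ = _ := by
        rw [Real.mul_rpow (by linarith) (by positivity), Real.inv_rpow hθ0.le,
          ← Real.rpow_neg hθ0.le]

end

end VectorMixing

open scoped ComplexConjugate

namespace VectorMixing

variable {d : ℕ} {L : ℝ}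

/-! ### Fejér means -/

/-- The frequencies with `0 ≤ k_i ≤ N`. -/
noncomputable def fejerBox (d N : ℕ) : Finset (Fin d → ℤ) := Fintype.piFinset fun _ => Finset.Icc 0 (N : ℤ)

/-- The Fejér kernel, normalized to have mean one. -/
noncomputable def fejerKernel (N : ℕ) (y : Torus d L) : ℝ :=
  ‖trigPoly (fejerBox d N) (fun _ => 1) y‖ ^ 2 / (N + 1) ^ d

theorem fejerKernel_nonneg (N : ℕ) (y : Torus d L) : 0 ≤ fejerKernel N y := by
  unfold fejerKernel
  positivity

@[fun_prop] theorem continuous_fejerKernel (N : ℕ) :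
    Continuous (fejerKernel N : Torus d L → ℝ) := by
  unfold fejerKernel
  fun_prop

theorem trigPoly_piFinset (s : Finset ℤ) (y : Torus d L) :
    trigPoly (Fintype.piFinset fun _ => s) (fun _ => 1) y = ∏ i, ∑ n ∈ s, fourier n (y i) := by
  simp only [trigPoly, one_mul, character]
  exact (Finset.prod_univ_sum (fun _ : Fin d => s) (fun i n => (fourier n (y i) : ℂ))).symm

theorem mem_freqBox {N : ℕ} {k : Fin d → ℤ} : k ∈ freqBox d N ↔ ∀ i, |k i| ≤ N := by
  simp [freqBox, Fintype.mem_piFinset, abs_le]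

theorem neg_mem_freqBox {N : ℕ} {k : Fin d → ℤ} : -k ∈ freqBox d N ↔ k ∈ freqBox d N := by
  simp [mem_freqBox]

theorem freqBox_mono {M N : ℕ} (h : M ≤ N) : freqBox d M ⊆ freqBox d N := by
  intro k hk
  rw [mem_freqBox] at hk ⊢
  exact fun i => (hk i).trans (by exact_mod_cast h)

theorem sub_mem_freqBox {N : ℕ} {k l : Fin d → ℤ} (hk : k ∈ fejerBox d N) (hl : l ∈ fejerBox d N) :
    k - l ∈ freqBox d N := by
  rw [mem_freqBox]
  intro i
  simp only [fejerBox, Fintype.mem_piFinset, Finset.mem_Icc] at hk hl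
  have h1 := hk i
  have h2 := hl i
  rw [Pi.sub_apply, abs_le]
  constructor <;> linarith

theorem card_fejerBox (N : ℕ) : ((fejerBox d N).card : ℝ) = (N + 1) ^ d := by
  simp [fejerBox, Fintype.card_piFinset]

section

variable [hL : Fact (0 < L)]

/-- Fourier coefficients of complex-valued functions. -/
noncomputable def scalarCoeff (f : Torus d L → ℂ) (k : Fin d → ℤ) : ℂ :=
  ((L ^ d)⁻¹ : ℝ) * ∫ x, f x * character (-k) x

theorem coe_inv_mul_cancel (z : ℂ) : ((L ^ d)⁻¹ : ℝ) * (((L ^ d : ℝ) : ℂ) * z) = z := by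
  have h : (L ^ d : ℝ) ≠ 0 := torus_volume_pos.ne'
  rw [← mul_assoc, ← Complex.ofReal_mul, inv_mul_cancel₀ h, Complex.ofReal_one, one_mul]

theorem scalarCoeff_trigPoly (K : Finset (Fin d → ℤ)) (a : (Fin d → ℤ) → ℂ) (k : Fin d → ℤ) :
    scalarCoeff (trigPoly K a : Torus d L → ℂ) k = if k ∈ K then a k else 0 := by
  rw [scalarCoeff, integral_trigPoly_mul_character]
  split_ifs
  · exact coe_inv_mul_cancel _
  · simp

theorem integrable_mul_character {f : Torus d L → ℂ} (hf : Integrable f volume) (k : Fin d → ℤ) :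
    Integrable (fun x => f x * character k x) volume := by
  refine hf.mul_bdd (c := 1) (continuous_character k).aestronglyMeasurable ?_
  exact Eventually.of_forall fun x => by simp

theorem scalarCoeff_sub {f g : Torus d L → ℂ} (hf : Integrable f volume) (hg : Integrable g volume)
    (k : Fin d → ℤ) :
    scalarCoeff (fun x => f x - g x) k = scalarCoeff f k - scalarCoeff g k := by
  simp only [scalarCoeff, sub_mul]
  rw [integral_sub (integrable_mul_character hf _) (integrable_mul_character hg _)]
  ring

/-- The Fourier multipliers of the Fejér mean. -/
noncomputable def fejerCoeff (L : ℝ) [Fact (0 < L)] (N : ℕ) (k : Fin d → ℤ) : ℂ :=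
  ((L ^ d)⁻¹ : ℝ) * ∫ y : Torus d L, (fejerKernel N y : ℂ) * character k y

theorem integral_fejerKernel (N : ℕ) : ∫ y : Torus d L, fejerKernel N y = L ^ d := by
  simp only [fejerKernel]
  rw [integral_div, integral_norm_sq_trigPoly, sq_l2Coeff]
  simp only [norm_one, one_pow, Finset.sum_const, nsmul_eq_mul, mul_one]
  rw [card_fejerBox]
  have : ((N : ℝ) + 1) ^ d ≠ 0 := by positivity
  field_simp

/-- Expanding the square gives the differences of two frequencies with entries between 0 and N,
which fill the box |k|_∞ ≤ N. Fejér means and cubic partial sums therefore live on the same set of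
modes. -/
theorem fejerKernel_eq_sum (N : ℕ) (z : Torus d L) :
    (fejerKernel N z : ℂ) = ∑ m ∈ freqBox d N, fejerCoeff L N m * character (-m) z := by
  set w : ℂ := (((N : ℝ) + 1) ^ d : ℝ)⁻¹ with hw
  have h1 : ∀ z : Torus d L, (fejerKernel N z : ℂ)
      = ∑ j ∈ fejerBox d N, ∑ l ∈ fejerBox d N, w * character (-(j - l)) z := by
    intro z
    rw [fejerKernel, Complex.ofReal_div, div_eq_mul_inv, Complex.ofReal_pow, ← Complex.mul_conj',
      trigPoly, map_sum, Finset.sum_mul_sum, Finset.sum_comm, Finset.sum_mul]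
    refine Finset.sum_congr rfl fun j _ => ?_
    rw [Finset.sum_mul]
    refine Finset.sum_congr rfl fun l _ => ?_
    rw [one_mul, one_mul, character_mul_conj, neg_sub, hw]
    push_cast
    ring
  have h2 : ∀ m : Fin d → ℤ, fejerCoeff L N m
      = ∑ j ∈ fejerBox d N, ∑ l ∈ fejerBox d N, w * (if m = j - l then 1 else 0) := by
    intro m
    rw [fejerCoeff]
    simp only [h1, Finset.sum_mul]
    rw [integral_finsetSum _ fun j _ => integrable_finsetSum _ fun l _ =>
      integrable_of_continuous (by fun_prop), Finset.mul_sum]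
    refine Finset.sum_congr rfl fun j _ => ?_
    rw [integral_finsetSum _ fun l _ => integrable_of_continuous (by fun_prop), Finset.mul_sum]
    refine Finset.sum_congr rfl fun l _ => ?_
    simp only [mul_assoc, ← character_add]
    rw [integral_const_mul, integral_character, mul_left_comm]
    congr 1
    by_cases h : m = j - l
    · rw [if_pos h, if_pos (by rw [h]; simp), ← Complex.ofReal_mul,
        inv_mul_cancel₀ torus_volume_pos.ne', Complex.ofReal_one]
    · rw [if_neg h, if_neg, mul_zero]
      rw [neg_add_eq_sub, sub_eq_zero]
      exact h
  rw [h1]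
  simp only [h2, Finset.sum_mul]
  conv_rhs => rw [Finset.sum_comm]
  refine Finset.sum_congr rfl fun j hj => ?_
  conv_rhs => rw [Finset.sum_comm]
  refine Finset.sum_congr rfl fun l hl => ?_
  rw [Finset.sum_eq_single (j - l)]
  · simp
  · intro m _ hm
    rw [if_neg hm, mul_zero, zero_mul]
  · exact fun h => absurd (sub_mem_freqBox hj hl) h

/-- The Fejér mean is the convolution with the Fejér kernel. -/
theorem integral_fejerKernel_mul {f : Torus d L → ℂ} (hf : Integrable f volume) (N : ℕ)
    (x : Torus d L) :
    ((L ^ d)⁻¹ : ℝ) * ∫ y, (fejerKernel N y : ℂ) * f (x + y)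
      = trigPoly (freqBox d N) (fun k => fejerCoeff L N k * scalarCoeff f k) x := by
  have h1 : ∫ y, (fejerKernel N y : ℂ) * f (x + y) = ∫ y, (fejerKernel N (y - x) : ℂ) * f y := by
    rw [← integral_add_left_eq_self (fun y => (fejerKernel N (y - x) : ℂ) * f y) x]
    simp only [add_sub_cancel_left]
  have h2 : ∀ y, (fejerKernel N (y - x) : ℂ) * f y = ∑ m ∈ freqBox d N,
      (fejerCoeff L N m * character m x) * (f y * character (-m) y) := by
    intro y
    rw [fejerKernel_eq_sum, Finset.sum_mul]
    refine Finset.sum_congr rfl fun m _ => ?_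
    have h3 : character (-m) (-x) = character m x := by
      simp [character, fourier_apply]
    rw [sub_eq_add_neg, character_add_apply, h3]
    ring
  rw [h1]
  simp only [h2]
  rw [integral_finsetSum _ fun m _ => (integrable_mul_character hf _).const_mul _, Finset.mul_sum,
    trigPoly]
  refine Finset.sum_congr rfl fun m _ => ?_
  rw [integral_const_mul, scalarCoeff]
  ring

/-- The kernel is a product over the coordinates. In the i-th one the factor 1 - exp(2πi y_i/L)
telescopes the geometric sum to something of modulus at most 2; in the others Parseval gives the
full mass. -/
theorem integral_fejerKernel_mul_norm_sq_le (N : ℕ) (i : Fin d) :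
    ∫ y : Torus d L, fejerKernel N y * ‖1 - (fourier 1 (y i) : ℂ)‖ ^ 2 ≤ 4 / (N + 1) * L ^ d := by
  have hL0 := hL.out
  have hN : (0 : ℝ) < N + 1 := by positivity
  have hcard : ((Finset.Icc (0 : ℤ) N).card : ℝ) = N + 1 := by simp
  set φ : Fin d → AddCircle L → ℝ := fun j θ =>
    ‖expSum 0 N θ‖ ^ 2 * (if j = i then ‖1 - (fourier 1 θ : ℂ)‖ ^ 2 else 1) with hφ
  have h1 : ∀ y : Torus d L, fejerKernel N y * ‖1 - (fourier 1 (y i) : ℂ)‖ ^ 2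
      = (∏ j, φ j (y j)) / (N + 1) ^ d := by
    intro y
    simp only [hφ]
    rw [Finset.prod_mul_distrib, Finset.prod_ite_eq' Finset.univ i
      (fun j => ‖1 - (fourier 1 (y j) : ℂ)‖ ^ 2), if_pos (Finset.mem_univ i), fejerKernel, fejerBox,
      trigPoly_piFinset, norm_prod, Finset.prod_pow]
    simp only [expSum]
    ring
  simp only [h1]
  rw [integral_div, integral_fintype_prod_volume_eq_prod φ, div_le_iff₀ (by positivity)]
  have h2 : ∀ j, ∫ θ, φ j θ ≤ (if j = i then 4 / ((N : ℝ) + 1) else 1) * (L * (N + 1)) := by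
    intro j
    by_cases hj : j = i
    · simp only [hφ, hj, if_true]
      have h3 : ∀ θ : AddCircle L, ‖expSum 0 N θ‖ ^ 2 * ‖1 - (fourier 1 θ : ℂ)‖ ^ 2 ≤ 4 := by
        intro θ
        have h4 := norm_one_sub_mul_expSum_le (a := 0) (b := (N : ℤ)) (by omega) θ
        rw [← mul_pow, mul_comm]
        calc _ ≤ (2 : ℝ) ^ 2 := pow_le_pow_left₀ (by positivity) h4 2
          _ = 4 := by norm_num
      calc ∫ θ : AddCircle L, ‖expSum 0 N θ‖ ^ 2 * ‖1 - (fourier 1 θ : ℂ)‖ ^ 2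
          ≤ ∫ _ : AddCircle L, (4 : ℝ) :=
            integral_mono (integrable_circle_of_continuous (by fun_prop)) (integrable_const _) h3
        _ = 4 / ((N : ℝ) + 1) * (L * (N + 1)) := by
            rw [integral_const, Measure.real, AddCircle.measure_univ, ENNReal.toReal_ofReal hL0.le]
            simp
            field_simp
    · simp only [hφ, hj, if_false, mul_one, one_mul]
      rw [integral_norm_sq_expSum, hcard]
  calc _ ≤ ∏ j, ((if j = i then 4 / ((N : ℝ) + 1) else 1) * (L * (N + 1))) := by
        refine Finset.prod_le_prod (fun j _ => integral_nonneg fun θ => ?_) fun j _ => h2 j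
        simp only [hφ]
        split_ifs <;> positivity
    _ = _ := by
        rw [Finset.prod_mul_distrib, Finset.prod_ite_eq' Finset.univ i (fun _ => 4 / ((N : ℝ) + 1)),
          if_pos (Finset.mem_univ i), Finset.prod_const, Finset.card_univ, Fintype.card_fin, mul_pow]
        ring

/-- Moments of the Fejér kernel. -/
theorem integral_fejerKernel_mul_norm_rpow_le {α : ℝ} (hα : 0 ≤ α) (hα1 : α ≤ 1) (N : ℕ) :
    ∫ y : Torus d L, fejerKernel N y * ‖y‖ ^ α
      ≤ ((N : ℝ) + 1) ^ (-(α / 2)) * (1 + d * L ^ 2) * L ^ d := by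
  have hL0 := hL.out
  have hN : (0 : ℝ) < N + 1 := by positivity
  have hpt : ∀ y : Torus d L, fejerKernel N y * ‖y‖ ^ α ≤ ((N : ℝ) + 1) ^ (-(α / 2)) *
      (fejerKernel N y + ((N + 1) * L ^ 2 / 16) *
        ∑ i, fejerKernel N y * ‖1 - (fourier 1 (y i) : ℂ)‖ ^ 2) := by
    intro y
    have h1 : ‖y‖ ^ 2 ≤ L ^ 2 / 16 * ∑ i, ‖1 - (fourier 1 (y i) : ℂ)‖ ^ 2 := by
      have h2 : ‖y‖ ≤ √(L ^ 2 / 16 * ∑ i, ‖1 - (fourier 1 (y i) : ℂ)‖ ^ 2) := by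
        refine (pi_norm_le_iff_of_nonneg (Real.sqrt_nonneg _)).2 fun i => Real.le_sqrt_of_sq_le ?_
        have h3 := norm_le_norm_one_sub_fourier (y i)
        have h4 : ‖y i‖ ^ 2 ≤ L ^ 2 / 16 * ‖1 - (fourier 1 (y i) : ℂ)‖ ^ 2 := by
          have h5 := pow_le_pow_left₀ (by positivity) h3 2
          calc ‖y i‖ ^ 2 = L ^ 2 / 16 * (4 * ‖y i‖ / L) ^ 2 := by field_simp; ring
            _ ≤ _ := mul_le_mul_of_nonneg_left h5 (by positivity)
        refine h4.trans (mul_le_mul_of_nonneg_left ?_ (by positivity))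
        exact Finset.single_le_sum (f := fun i => ‖1 - (fourier 1 (y i) : ℂ)‖ ^ 2)
          (fun _ _ => sq_nonneg _) (Finset.mem_univ i)
      have h6 := pow_le_pow_left₀ (norm_nonneg y) h2 2
      rwa [Real.sq_sqrt (mul_nonneg (by positivity)
        (Finset.sum_nonneg fun _ _ => sq_nonneg _))] at h6
    -- The second moment of the kernel is of order 1/(N+1), which dictates the squared length scale.
    have h7 := norm_rpow_le_one_add (s := ((N : ℝ) + 1)⁻¹) hα hα1 (by positivity) (norm_nonneg y) h1
    rw [Real.inv_rpow hN.le, ← Real.rpow_neg hN.le] at h7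
    calc _ ≤ fejerKernel N y * _ := mul_le_mul_of_nonneg_left h7 (fejerKernel_nonneg N y)
      _ = _ := by
        rw [← Finset.mul_sum, div_inv_eq_mul]
        ring
  have hI : ∀ i, Integrable (fun y : Torus d L =>
      fejerKernel N y * ‖1 - (fourier 1 (y i) : ℂ)‖ ^ 2) volume :=
    fun i => integrable_of_continuous (by fun_prop)
  have hIs : Integrable (fun y : Torus d L => ((N + 1) * L ^ 2 / 16) *
        ∑ i, fejerKernel N y * ‖1 - (fourier 1 (y i) : ℂ)‖ ^ 2) volume :=
    (integrable_finsetSum _ fun i _ => hI i).const_mul _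
  have hIf : Integrable (fejerKernel N : Torus d L → ℝ) volume :=
    integrable_of_continuous (by fun_prop)
  calc _ ≤ ∫ y : Torus d L, ((N : ℝ) + 1) ^ (-(α / 2)) *
      (fejerKernel N y + ((N + 1) * L ^ 2 / 16) *
        ∑ i, fejerKernel N y * ‖1 - (fourier 1 (y i) : ℂ)‖ ^ 2) := by
        refine integral_mono (integrable_of_continuous ?_) ((hIf.add hIs).const_mul _) hpt
        exact (continuous_fejerKernel N).mul (continuous_norm.rpow_const fun _ => Or.inr hα)
    _ ≤ ((N : ℝ) + 1) ^ (-(α / 2)) * (L ^ d + ((N + 1) * L ^ 2 / 16) *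
        ∑ _i : Fin d, (4 / ((N : ℝ) + 1) * L ^ d)) := by
        rw [integral_const_mul, integral_add hIf hIs, integral_fejerKernel, integral_const_mul,
          integral_finsetSum _ fun i _ => hI i]
        gcongr with i _
        exact integral_fejerKernel_mul_norm_sq_le N i
    _ = ((N : ℝ) + 1) ^ (-(α / 2)) * (1 + d * L ^ 2 / 4) * L ^ d := by
        simp
        field_simp
        ring
    _ ≤ _ := by
        have : (0 : ℝ) ≤ d * L ^ 2 := by positivity
        gcongr
        linarith

theorem one_sub_fejerCoeff (N : ℕ) (k : Fin d → ℤ) :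
    1 - fejerCoeff L N k
      = ((L ^ d)⁻¹ : ℝ) * ∫ y : Torus d L, (fejerKernel N y : ℂ) * (1 - character k y) := by
  have h1 : ∫ y : Torus d L, (fejerKernel N y : ℂ) = ((L ^ d : ℝ) : ℂ) := by
    rw [← integral_fejerKernel (d := d) (L := L) N]
    exact integral_ofReal
  simp only [mul_sub, mul_one]
  rw [integral_sub (integrable_of_continuous (by fun_prop))
    (integrable_of_continuous (by fun_prop)), h1, fejerCoeff, mul_sub]
  congr 1
  have h := coe_inv_mul_cancel (d := d) (L := L) 1
  rw [mul_one] at h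
  exact h.symm

theorem norm_one_sub_character_le (k : Fin d → ℤ) (y : Torus d L) :
    ‖1 - character k y‖ ≤ (∑ j, ‖derivSymbol L j k‖) * ‖y‖ := by
  obtain ⟨z, rfl, hz⟩ := exists_toTorus_norm_eq y
  rw [← hz]
  have h := (convex_univ : Convex ℝ (univ : Set ℝ)).norm_image_sub_le_of_norm_hasDerivWithin_le
    (f := fun t : ℝ => character k ((0 : Torus d L) + toTorus L (t • z)))
    (C := (∑ j, ‖derivSymbol L j k‖) * ‖z‖)
    (fun t _ => (hasDerivAt_character_line k 0 z t).hasDerivWithinAt) (fun t _ => ?_)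
    (mem_univ 1) (mem_univ 0)
  · have h0 : toTorus L (0 : Fin d → ℝ) = 0 := by funext i; simp [toTorus]
    simpa [h0] using h
  · rw [norm_mul, norm_character, mul_one, Finset.sum_mul]
    refine (norm_sum_le _ _).trans (Finset.sum_le_sum fun j _ => ?_)
    rw [norm_mul, Complex.norm_real, mul_comm]
    exact mul_le_mul_of_nonneg_left (norm_le_pi_norm z j) (norm_nonneg _)

/-- The defect of the multiplier from one is the mean of 1 - e_k against the kernel; e_k is
Lipschitz, so the first moment controls it. -/
theorem tendsto_fejerCoeff (k : Fin d → ℤ) :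
    Tendsto (fun N : ℕ => fejerCoeff L N k) atTop (𝓝 1) := by
  have hLd : 0 < L ^ d := torus_volume_pos
  have hb : ∀ N : ℕ, ‖fejerCoeff L N k - 1‖
      ≤ (∑ j, ‖derivSymbol L j k‖) * (1 + d * L ^ 2) * ((N : ℝ) + 1) ^ (-(1 / 2 : ℝ)) := by
    intro N
    rw [norm_sub_rev, one_sub_fejerCoeff, norm_mul, Complex.norm_real,
      Real.norm_of_nonneg (inv_nonneg.2 hLd.le)]
    have h1 : ‖∫ y : Torus d L, (fejerKernel N y : ℂ) * (1 - character k y)‖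
        ≤ ∫ y : Torus d L, (∑ j, ‖derivSymbol L j k‖) * (fejerKernel N y * ‖y‖ ^ (1 : ℝ)) := by
      refine norm_integral_le_of_norm_le (integrable_of_continuous ?_)
        (Eventually.of_forall fun y => ?_)
      · simp only [Real.rpow_one]
        fun_prop
      · rw [norm_mul, Complex.norm_real, Real.norm_of_nonneg (fejerKernel_nonneg N y), Real.rpow_one]
        have := mul_le_mul_of_nonneg_left (norm_one_sub_character_le k y) (fejerKernel_nonneg N y)
        linarith
    rw [integral_const_mul] at h1
    have h2 := integral_fejerKernel_mul_norm_rpow_le (d := d) (L := L) zero_le_one le_rfl N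
    rw [inv_mul_le_iff₀ hLd]
    refine h1.trans ((mul_le_mul_of_nonneg_left h2
      (Finset.sum_nonneg fun _ _ => norm_nonneg _)).trans (le_of_eq ?_))
    ring
  rw [tendsto_iff_norm_sub_tendsto_zero]
  refine squeeze_zero (fun _ => norm_nonneg _) hb ?_
  have h3 : Tendsto (fun N : ℕ => ((N : ℝ) + 1) ^ (-(1 / 2 : ℝ))) atTop (𝓝 0) :=
    (tendsto_rpow_neg_atTop (by norm_num)).comp
      (tendsto_atTop_add_const_right _ _ tendsto_natCast_atTop_atTop)
  simpa using h3.const_mul ((∑ j, ‖derivSymbol L j k‖) * (1 + d * L ^ 2))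

end

end VectorMixing

/-! ### Fejér means on L^q, and their distance to the cubic partial sums -/

open scoped ComplexConjugate

namespace VectorMixing

variable {d : ℕ} {L : ℝ}

section

variable [hL : Fact (0 < L)]

/-- The mean averages translates of `f` against the probability measure ν. Jensen holds pointwise,
and Tonelli with translation invariance removes the average. Strong measurability makes f(x + y)
jointly measurable. -/
theorem eLpNorm_fejerMean_le_of_stronglyMeasurable {q : ℝ} (hq : 1 ≤ q) {f : Torus d L → ℂ}
    (hf : MemLp f (ENNReal.ofReal q) volume) (hfm : StronglyMeasurable f) (N : ℕ) :
    eLpNorm (trigPoly (freqBox d N) (fun k => fejerCoeff L N k * scalarCoeff f k) : Torus d L → ℂ)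
      (ENNReal.ofReal q) volume ≤ eLpNorm f (ENNReal.ofReal q) volume := by
  have hLd : 0 < L ^ d := torus_volume_pos
  have hq0 : 0 < q := by linarith
  have hp1 : 1 ≤ ENNReal.ofReal q := by
    rw [← ENNReal.ofReal_one]; exact ENNReal.ofReal_le_ofReal hq
  have hp0 : ENNReal.ofReal q ≠ 0 := (zero_lt_one.trans_le hp1).ne'
  have hpt : ENNReal.ofReal q ≠ ⊤ := ENNReal.ofReal_ne_top
  have hfi : Integrable f volume := hf.integrable hp1
  set ρ : Torus d L → ℝ≥0∞ := fun y => ENNReal.ofReal ((L ^ d)⁻¹ * fejerKernel N y) with hρ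
  have hρm : Measurable ρ := by
    have : Continuous fun y : Torus d L => (L ^ d)⁻¹ * fejerKernel N y := by fun_prop
    exact this.measurable.ennreal_ofReal
  set ν : Measure (Torus d L) := volume.withDensity ρ with hν
  have hprob : IsProbabilityMeasure ν := by
    refine ⟨?_⟩
    rw [hν, withDensity_apply _ MeasurableSet.univ, Measure.restrict_univ, hρ,
      ← ofReal_integral_eq_lintegral_ofReal (integrable_of_continuous (by fun_prop))
      (Eventually.of_forall fun y => mul_nonneg (inv_nonneg.2 hLd.le) (fejerKernel_nonneg N y)),
      integral_const_mul, integral_fejerKernel, inv_mul_cancel₀ hLd.ne', ENNReal.ofReal_one]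
  have hpoint : ∀ x, ‖trigPoly (freqBox d N) (fun k => fejerCoeff L N k * scalarCoeff f k) x‖ₑ ^ q
      ≤ ∫⁻ y, ‖f (x + y)‖ₑ ^ q ∂ν := by
    intro x
    have hmx : Measurable fun y => f (x + y) := hfm.measurable.comp (measurable_const_add x)
    have h1 : ‖trigPoly (freqBox d N) (fun k => fejerCoeff L N k * scalarCoeff f k) x‖ₑ
        ≤ ∫⁻ y, ‖f (x + y)‖ₑ ∂ν := by
      rw [← integral_fejerKernel_mul hfi, ← integral_const_mul, hν,
        lintegral_withDensity_eq_lintegral_mul _ hρm hmx.enorm]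
      refine (enorm_integral_le_lintegral_enorm _).trans (lintegral_mono fun y => le_of_eq ?_)
      rw [← mul_assoc, enorm_mul, ← Complex.ofReal_mul, ← ofReal_norm (_ : ℂ), Complex.norm_real,
        Real.norm_of_nonneg (mul_nonneg (inv_nonneg.2 hLd.le) (fejerKernel_nonneg N y))]
      rfl
    have h2 : ∫⁻ y, ‖f (x + y)‖ₑ ∂ν ≤ (∫⁻ y, ‖f (x + y)‖ₑ ^ q ∂ν) ^ (1 / q) := by
      have h3 := eLpNorm_le_eLpNorm_of_exponent_le (μ := ν) hp1
        (hmx.aestronglyMeasurable (μ := ν))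
      rw [eLpNorm_one_eq_lintegral_enorm, eLpNorm_eq_lintegral_rpow_enorm_toReal hp0 hpt,
        ENNReal.toReal_ofReal hq0.le] at h3
      exact h3
    calc _ ≤ ((∫⁻ y, ‖f (x + y)‖ₑ ^ q ∂ν) ^ (1 / q)) ^ q :=
          ENNReal.rpow_le_rpow (h1.trans h2) hq0.le
      _ = _ := by rw [← ENNReal.rpow_mul, one_div_mul_cancel hq0.ne', ENNReal.rpow_one]
  rw [eLpNorm_eq_lintegral_rpow_enorm_toReal hp0 hpt, eLpNorm_eq_lintegral_rpow_enorm_toReal hp0 hpt,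
    ENNReal.toReal_ofReal hq0.le]
  refine ENNReal.rpow_le_rpow ?_ (by positivity)
  calc _ ≤ ∫⁻ x, ∫⁻ y, ‖f (x + y)‖ₑ ^ q ∂ν := lintegral_mono hpoint
    _ = ∫⁻ y, (∫⁻ x, ‖f (x + y)‖ₑ ^ q) ∂ν := by
        refine lintegral_lintegral_swap (Measurable.aemeasurable ?_)
        exact ((hfm.measurable.comp (measurable_fst.add measurable_snd)).enorm.pow_const q)
    _ = ∫⁻ _y, (∫⁻ x, ‖f x‖ₑ ^ q) ∂ν := by
        refine lintegral_congr fun y => ?_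
        exact lintegral_add_right_eq_self (fun x => ‖f x‖ₑ ^ q) y
    _ = _ := by simp

/-- Fejér means are contractions on `L^q`. -/
theorem eLpNorm_fejerMean_le {q : ℝ} (hq : 1 ≤ q) {f : Torus d L → ℂ}
    (hf : MemLp f (ENNReal.ofReal q) volume) (N : ℕ) :
    eLpNorm (trigPoly (freqBox d N) (fun k => fejerCoeff L N k * scalarCoeff f k) : Torus d L → ℂ)
      (ENNReal.ofReal q) volume ≤ eLpNorm f (ENNReal.ofReal q) volume := by
  obtain ⟨f', hf', hae⟩ := hf.aestronglyMeasurable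
  have hc : ∀ k, scalarCoeff f k = scalarCoeff f' k := by
    intro k
    rw [scalarCoeff, scalarCoeff]
    congr 1
    refine integral_congr_ae ?_
    filter_upwards [hae] with x hx
    rw [hx]
  simp only [hc]
  rw [eLpNorm_congr_ae hae]
  exact eLpNorm_fejerMean_le_of_stronglyMeasurable hq ((memLp_congr_ae hae).1 hf) hf' N

theorem trigPoly_scalarCoeff_eq_integral {g : Torus d L → ℂ} (hg : Continuous g)
    (K : Finset (Fin d → ℤ)) (x : Torus d L) :
    trigPoly K (scalarCoeff g) x
      = ((L ^ d)⁻¹ : ℝ) * ∫ y, g y * trigPoly K (fun _ => 1) (x - y) := by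
  have h1 : ∀ y, g y * trigPoly K (fun _ => 1) (x - y)
      = ∑ k ∈ K, character k x * (g y * character (-k) y) := by
    intro y
    rw [trigPoly, Finset.mul_sum]
    refine Finset.sum_congr rfl fun k _ => ?_
    have h3 : character k (-y) = character (-k) y := by
      simp [character, fourier_apply]
    rw [sub_eq_add_neg, character_add_apply, h3]
    ring
  simp only [h1]
  rw [integral_finsetSum _ fun k _ => integrable_of_continuous (by fun_prop), Finset.mul_sum, trigPoly]
  refine Finset.sum_congr rfl fun k _ => ?_
  rw [integral_const_mul, scalarCoeff]
  ring

theorem norm_trigPoly_scalarCoeff_le {g : Torus d L → ℂ} (hg : Continuous g) {c : ℝ}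
    (hc : ∀ x, ‖g x‖ ≤ c) (K : Finset (Fin d → ℤ)) (x : Torus d L) :
    ‖trigPoly K (scalarCoeff g) x‖
      ≤ (L ^ d)⁻¹ * (c * ∫ y : Torus d L, ‖trigPoly K (fun _ => 1) y‖) := by
  have hLd : 0 < L ^ d := torus_volume_pos
  rw [trigPoly_scalarCoeff_eq_integral hg, norm_mul, Complex.norm_real,
    Real.norm_of_nonneg (inv_nonneg.2 hLd.le)]
  refine mul_le_mul_of_nonneg_left ?_ (inv_nonneg.2 hLd.le)
  have hneg : ∀ z : Torus d L, ‖trigPoly K (fun _ => 1) (-z)‖ = ‖trigPoly K (fun _ => 1) z‖ := by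
    intro z
    rw [← RCLike.norm_conj]
    congr 1
    simp only [trigPoly, map_sum, one_mul]
    refine Finset.sum_congr rfl fun k _ => ?_
    rw [← character_neg]
    simp [character, fourier_apply]
  rw [← integral_sub_right_eq_self (fun y => ‖trigPoly K (fun _ => 1) y‖) x, ← integral_const_mul]
  refine norm_integral_le_of_norm_le (integrable_of_continuous (by fun_prop))
    (Eventually.of_forall fun y => ?_)
  rw [norm_mul, ← neg_sub y x, hneg]
  exact mul_le_mul_of_nonneg_right (hc y) (norm_nonneg _)

/-- Approximation of a Hölder function by its Fejér means. -/
theorem norm_sub_fejerMean_le {α H : ℝ} (hα : 0 ≤ α) (hα1 : α ≤ 1) (hH : 0 ≤ H)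
    {f : Torus d L → ℂ} (hf : Continuous f) (hfH : ∀ x y, ‖f (x + y) - f x‖ ≤ H * ‖y‖ ^ α)
    (N : ℕ) (x : Torus d L) :
    ‖f x - trigPoly (freqBox d N) (fun k => fejerCoeff L N k * scalarCoeff f k) x‖
      ≤ H * ((N : ℝ) + 1) ^ (-(α / 2)) * (1 + d * L ^ 2) := by
  have hLd : 0 < L ^ d := torus_volume_pos
  have h1 : f x = ((L ^ d)⁻¹ : ℝ) * ∫ y : Torus d L, (fejerKernel N y : ℂ) * f x := by
    have h2 : ∫ y : Torus d L, (fejerKernel N y : ℂ) = ((L ^ d : ℝ) : ℂ) := by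
      rw [← integral_fejerKernel (d := d) (L := L) N]
      exact integral_ofReal
    rw [integral_mul_const, h2, coe_inv_mul_cancel]
  rw [← integral_fejerKernel_mul (integrable_of_continuous hf)]
  nth_rewrite 1 [h1]
  rw [← mul_sub, ← integral_sub (integrable_of_continuous (by fun_prop))
    (integrable_of_continuous (by fun_prop)), norm_mul, Complex.norm_real,
    Real.norm_of_nonneg (inv_nonneg.2 hLd.le), inv_mul_le_iff₀ hLd]
  have h3 : ‖∫ y : Torus d L, ((fejerKernel N y : ℂ) * f x - (fejerKernel N y : ℂ) * f (x + y))‖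
      ≤ ∫ y : Torus d L, H * (fejerKernel N y * ‖y‖ ^ α) := by
    refine norm_integral_le_of_norm_le (integrable_of_continuous ?_)
      (Eventually.of_forall fun y => ?_)
    · exact continuous_const.mul ((continuous_fejerKernel N).mul
        (continuous_norm.rpow_const fun _ => Or.inr hα))
    · rw [← mul_sub, norm_mul, Complex.norm_real, Real.norm_of_nonneg (fejerKernel_nonneg N y),
        norm_sub_rev]
      have := mul_le_mul_of_nonneg_left (hfH x y) (fejerKernel_nonneg N y)
      linarith
  rw [integral_const_mul] at h3
  refine h3.trans ((mul_le_mul_of_nonneg_left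
    (integral_fejerKernel_mul_norm_rpow_le hα hα1 N) hH).trans (le_of_eq ?_))
  ring

/-- The rate at which cubic partial sums approximate the Fejér means of Hölder functions. -/
noncomputable def dirichletError (d : ℕ) (L : ℝ) [Fact (0 < L)] (α : ℝ) (N : ℕ) : ℝ :=
  (L ^ d)⁻¹ * (((N : ℝ) + 1) ^ (-(α / 2)) * (1 + d * L ^ 2) *
    ∫ y : Torus d L, ‖trigPoly (freqBox d N) (fun _ => 1) y‖)

theorem dirichletError_nonneg (α : ℝ) (N : ℕ) : 0 ≤ dirichletError d L α N := by
  have hLd : 0 < L ^ d := torus_volume_pos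
  have : 0 ≤ ∫ y : Torus d L, ‖trigPoly (freqBox d N) (fun _ => 1) y‖ :=
    integral_nonneg fun _ => norm_nonneg _
  unfold dirichletError
  positivity

/-- If all Fejér means of a Fourier series are uniformly Hölder continuous, then its cubic partial
sums are uniformly close to the Fejér means. -/
theorem norm_trigPoly_sub_fejerMean_le {α H : ℝ} (hα : 0 ≤ α) (hα1 : α ≤ 1) (hH : 0 ≤ H)
    {A : (Fin d → ℤ) → ℂ}
    (hA : ∀ (M : ℕ) (x y : Torus d L), ‖trigPoly (freqBox d M) (fun k => fejerCoeff L M k * A k) (x + y)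
      - trigPoly (freqBox d M) (fun k => fejerCoeff L M k * A k) x‖ ≤ H * ‖y‖ ^ α)
    (N : ℕ) (x : Torus d L) :
    ‖trigPoly (freqBox d N) (fun k => A k - fejerCoeff L N k * A k) x‖
      ≤ H * dirichletError d L α N := by
  -- `A` is not assumed to come from a continuous function. Its Fejér mean of order M stands in for
  -- it, and M → ∞ is taken mode by mode on the fixed box.
  have hlim : Tendsto (fun M : ℕ => trigPoly (freqBox d N)
      (fun k => fejerCoeff L M k * A k - fejerCoeff L N k * (fejerCoeff L M k * A k)) x) atTop
      (𝓝 (trigPoly (freqBox d N) (fun k => A k - fejerCoeff L N k * A k) x)) := by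
    unfold trigPoly
    refine tendsto_finsetSum _ fun k _ => Tendsto.mul_const _ ?_
    have h1 : Tendsto (fun M : ℕ => fejerCoeff L M k * A k) atTop (𝓝 (1 * A k)) :=
      (tendsto_fejerCoeff k).mul_const _
    rw [one_mul] at h1
    exact h1.sub (h1.const_mul _)
  refine le_of_tendsto hlim.norm ?_
  filter_upwards [eventually_ge_atTop N] with M hM
  set f : Torus d L → ℂ := trigPoly (freqBox d M) (fun k => fejerCoeff L M k * A k) with hf
  have hfc : Continuous f := continuous_trigPoly _ _
  have hcoef : ∀ k ∈ freqBox d N, scalarCoeff f k = fejerCoeff L M k * A k := by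
    intro k hk
    rw [hf, scalarCoeff_trigPoly, if_pos (freqBox_mono hM hk)]
  -- g is uniformly of size H(N+1)^(-α/2), up to a constant; its cubic partial sum is the desired
  -- difference and loses only the Lebesgue constant.
  set g : Torus d L → ℂ := fun x =>
    f x - trigPoly (freqBox d N) (fun k => fejerCoeff L N k * scalarCoeff f k) x with hg
  have hgc : Continuous g := by fun_prop
  have hgcoef : ∀ k ∈ freqBox d N, fejerCoeff L M k * A k
      - fejerCoeff L N k * (fejerCoeff L M k * A k) = scalarCoeff g k := by
    intro k hk
    rw [hg, scalarCoeff_sub (integrable_of_continuous hfc)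
      (integrable_of_continuous (by fun_prop)), hcoef k hk, scalarCoeff_trigPoly, if_pos hk,
      hcoef k hk]
  rw [trigPoly_congr hgcoef]
  refine (norm_trigPoly_scalarCoeff_le hgc
    (fun x => norm_sub_fejerMean_le hα hα1 hH hfc (hA M) N x) _ x).trans (le_of_eq ?_)
  rw [dirichletError]
  ring

theorem tendsto_dirichletError {α : ℝ} (hα : 0 < α) (hα1 : α ≤ 1) :
    Tendsto (dirichletError d L α) atTop (𝓝 0) := by
  have hLd : 0 < L ^ d := torus_volume_pos
  -- Chosen so that εd ≤ α/4: the d-dimensional Lebesgue constant then grows at most like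
  -- (N+1)^(α/4) and loses against (N+1)^(-α/2).
  set ε : ℝ := α / (4 * (d + 1)) with hε
  have hε0 : 0 < ε := by positivity
  have hε1 : ε ≤ 1 := by
    rw [hε, div_le_one (by positivity)]
    have : (0 : ℝ) ≤ d := Nat.cast_nonneg d
    linarith
  have hεd : ε * d ≤ α / 4 := by
    rw [hε, div_mul_eq_mul_div, div_le_div_iff₀ (by positivity) (by norm_num)]
    nlinarith
  obtain ⟨C, hC0, hC⟩ := exists_integral_norm_dirichlet_le (L := L) hε0 hε1
  have hleb : ∀ N : ℕ, ∫ y : Torus d L, ‖trigPoly (freqBox d N) (fun _ => 1) y‖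
      ≤ C ^ d * (2 : ℝ) ^ (α / 4) * ((N : ℝ) + 1) ^ (α / 4) := by
    intro N
    have h1 : ∀ y : Torus d L, ‖trigPoly (freqBox d N) (fun _ => 1) y‖
        = ∏ i, ‖expSum (-(N : ℤ)) N (y i)‖ := by
      intro y
      rw [freqBox, trigPoly_piFinset, norm_prod]
      rfl
    simp only [h1]
    rw [integral_fintype_prod_volume_eq_prod (fun _ θ => ‖expSum (-(N : ℤ)) N θ‖), Finset.prod_const,
      Finset.card_univ, Fintype.card_fin]
    calc _ ≤ (C * (2 * N + 1 : ℝ) ^ ε) ^ d :=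
          pow_le_pow_left₀ (integral_nonneg fun _ => norm_nonneg _) (hC N) d
      _ = C ^ d * (2 * N + 1 : ℝ) ^ (ε * d) := by
          rw [mul_pow, ← Real.rpow_natCast ((2 * N + 1 : ℝ) ^ ε), ← Real.rpow_mul (by positivity)]
      _ ≤ C ^ d * (2 * ((N : ℝ) + 1)) ^ (α / 4) := by
          have hN : (0 : ℝ) ≤ N := Nat.cast_nonneg N
          refine mul_le_mul_of_nonneg_left ?_ (by positivity)
          calc (2 * N + 1 : ℝ) ^ (ε * d) ≤ (2 * N + 1 : ℝ) ^ (α / 4) :=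
                Real.rpow_le_rpow_of_exponent_le (by linarith) hεd
            _ ≤ _ := Real.rpow_le_rpow (by positivity) (by linarith) (by positivity)
      _ = _ := by rw [Real.mul_rpow (by norm_num) (by positivity)]; ring
  set C' : ℝ := (L ^ d)⁻¹ * ((1 + d * L ^ 2) * (C ^ d * (2 : ℝ) ^ (α / 4))) with hC'
  have hb : ∀ N : ℕ, dirichletError d L α N ≤ C' * ((N : ℝ) + 1) ^ (-(α / 4)) := by
    intro N
    have hN : (0 : ℝ) < (N : ℝ) + 1 := by positivity
    rw [dirichletError]
    calc _ ≤ (L ^ d)⁻¹ * (((N : ℝ) + 1) ^ (-(α / 2)) * (1 + d * L ^ 2) *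
          (C ^ d * (2 : ℝ) ^ (α / 4) * ((N : ℝ) + 1) ^ (α / 4))) := by
          have := hleb N
          gcongr
      _ = C' * (((N : ℝ) + 1) ^ (-(α / 2)) * ((N : ℝ) + 1) ^ (α / 4)) := by rw [hC']; ring
      _ = _ := by
          rw [← Real.rpow_add hN]
          congr 2
          ring
  refine squeeze_zero (fun N => dirichletError_nonneg α N) hb ?_
  have h3 : Tendsto (fun N : ℕ => ((N : ℝ) + 1) ^ (-(α / 4))) atTop (𝓝 0) :=
    (tendsto_rpow_neg_atTop (by positivity)).comp
      (tendsto_atTop_add_const_right _ _ tendsto_natCast_atTop_atTop)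
  simpa using h3.const_mul C'

end

end VectorMixing

open scoped ComplexConjugate

namespace VectorMixing

variable {d : ℕ} {L : ℝ}

/-! ### Real trigonometric polynomials and distributional derivatives -/

/-- Hermitian coefficients on a symmetric set of modes give real values, so the real parts in the
definitions of the truncations discard nothing. -/
theorem trigPoly_re_coe {K : Finset (Fin d → ℤ)} (hK : ∀ k, -k ∈ K ↔ k ∈ K)
    {a : (Fin d → ℤ) → ℂ} (ha : ∀ k, a (-k) = conj (a k)) (x : Torus d L) :
    ((trigPoly K a x).re : ℂ) = trigPoly K a x := by
  have h : conj (trigPoly K a x) = trigPoly K a x := by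
    simp only [trigPoly, map_sum, map_mul, ← ha, ← character_neg]
    refine Finset.sum_bij' (fun k _ => -k) (fun k _ => -k) ?_ ?_ ?_ ?_ ?_
    · exact fun k hk => (hK k).2 hk
    · exact fun k hk => (hK k).2 hk
    · exact fun k _ => neg_neg k
    · exact fun k _ => neg_neg k
    · exact fun k _ => rfl
  exact (Complex.conj_eq_iff_re.1 h)

theorem isSmooth_re_character (k : Fin d → ℤ) :
    IsSmooth (fun x : Torus d L => (character k x).re) := by
  unfold IsSmooth
  simp only [character_coe]
  have h : ContDiff ℝ ∞ (fun y : Fin d → ℝ =>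
      Complex.exp (Complex.I * ((2 * Real.pi / L * ∑ i, (k i : ℝ) * y i : ℝ) : ℂ))) := by
    have h0 : ContDiff ℝ ∞ fun y : Fin d → ℝ => 2 * Real.pi / L * ∑ i, (k i : ℝ) * y i := by
      fun_prop
    exact ContDiff.cexp (contDiff_const.mul (Complex.ofRealCLM.contDiff.comp h0))
  exact Complex.reCLM.contDiff.comp h

theorem isSmooth_im_character (k : Fin d → ℤ) :
    IsSmooth (fun x : Torus d L => (character k x).im) := by
  unfold IsSmooth
  simp only [character_coe]
  have h : ContDiff ℝ ∞ (fun y : Fin d → ℝ =>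
      Complex.exp (Complex.I * ((2 * Real.pi / L * ∑ i, (k i : ℝ) * y i : ℝ) : ℂ))) := by
    have h0 : ContDiff ℝ ∞ fun y : Fin d → ℝ => 2 * Real.pi / L * ∑ i, (k i : ℝ) * y i := by
      fun_prop
    exact ContDiff.cexp (contDiff_const.mul (Complex.ofRealCLM.contDiff.comp h0))
  exact Complex.imCLM.contDiff.comp h

theorem partialDeriv_re_character (j : Fin d) (k : Fin d → ℤ) (x : Torus d L) :
    partialDeriv j (fun x : Torus d L => (character k x).re) x
      = (derivSymbol L j k * character k x).re := by
  have h := (Complex.reCLM.hasFDerivAt.comp_hasDerivAt (0 : ℝ)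
    (hasDerivAt_character_single k j x 0)).deriv
  simpa [partialDeriv, derivSymbol, Function.comp_def] using h

theorem partialDeriv_im_character (j : Fin d) (k : Fin d → ℤ) (x : Torus d L) :
    partialDeriv j (fun x : Torus d L => (character k x).im) x
      = (derivSymbol L j k * character k x).im := by
  have h := (Complex.imCLM.hasFDerivAt.comp_hasDerivAt (0 : ℝ)
    (hasDerivAt_character_single k j x 0)).deriv
  simpa [partialDeriv, derivSymbol, Function.comp_def] using h

theorem partialDeriv_re_trigPoly (j : Fin d) (K : Finset (Fin d → ℤ)) (a : (Fin d → ℤ) → ℂ)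
    (x : Torus d L) :
    partialDeriv j (fun x : Torus d L => (trigPoly K a x).re) x
      = (trigPoly K (fun k => derivSymbol L j k * a k) x).re := by
  have h := (Complex.reCLM.hasFDerivAt.comp_hasDerivAt (0 : ℝ)
    (hasDerivAt_trigPoly_single K a j x 0)).deriv
  simpa [partialDeriv, Function.comp_def] using h

section

variable [hL : Fact (0 < L)]

theorem fourierCoeffVec_eq_scalarCoeff (f : Torus d L → Vec d) (k : Fin d → ℤ) (i : Fin d) :
    fourierCoeffVec f k i = scalarCoeff (fun x => (f x i : ℂ)) k := rfl

theorem scalarCoeff_neg_of_real (f : Torus d L → ℝ) (k : Fin d → ℤ) :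
    scalarCoeff (fun x => (f x : ℂ)) (-k) = conj (scalarCoeff (fun x => (f x : ℂ)) k) := by
  simp only [scalarCoeff, map_mul, Complex.conj_ofReal, ← integral_conj, character_neg,
    Complex.conj_conj]

theorem integral_re_mul {f : Torus d L → ℝ} (hf : Integrable f volume) {g : Torus d L → ℂ}
    (hg : Continuous g) :
    (∫ x, (f x : ℂ) * g x).re = ∫ x, f x * (g x).re := by
  have hI : Integrable (fun x => (f x : ℂ) * g x) volume := by
    obtain ⟨c, hc⟩ := isCompact_univ.exists_bound_of_continuousOn hg.continuousOn
    exact (hf.ofReal (𝕜 := ℂ)).mul_bdd (c := c) hg.aestronglyMeasurable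
      (Eventually.of_forall fun x => hc x (mem_univ x))
  have h := Complex.reCLM.integral_comp_comm hI
  simpa using h.symm

theorem integral_im_mul {f : Torus d L → ℝ} (hf : Integrable f volume) {g : Torus d L → ℂ}
    (hg : Continuous g) :
    (∫ x, (f x : ℂ) * g x).im = ∫ x, f x * (g x).im := by
  have hI : Integrable (fun x => (f x : ℂ) * g x) volume := by
    obtain ⟨c, hc⟩ := isCompact_univ.exists_bound_of_continuousOn hg.continuousOn
    exact (hf.ofReal (𝕜 := ℂ)).mul_bdd (c := c) hg.aestronglyMeasurable
      (Eventually.of_forall fun x => hc x (mem_univ x))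
  have h := Complex.imCLM.integral_comp_comm hI
  simpa using h.symm

theorem integrable_apply {n : Type*} [Fintype n] {f : Torus d L → EuclideanSpace ℝ n}
    (hf : Integrable f volume) (i : n) : Integrable (fun x => f x i) volume :=
  (EuclideanSpace.proj (𝕜 := ℝ) i : EuclideanSpace ℝ n →L[ℝ] ℝ).integrable_comp hf

/-- The Fourier coefficients of a weak gradient. -/
theorem scalarCoeff_weakGradient {f : Torus d L → Vec d} {G : Torus d L → Mat d}
    (h : IsWeakGradient f G) (hf : Integrable f volume) (hG : Integrable G volume) (i j : Fin d)
    (k : Fin d → ℤ) :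
    scalarCoeff (fun x => (G x (i, j) : ℂ)) k = derivSymbol L j k * fourierCoeffVec f k i := by
  have hfi := integrable_apply hf i
  have hGi := integrable_apply hG (i, j)
  have key : ∫ x, (f x i : ℂ) * (derivSymbol L j (-k) * character (-k) x)
      = -∫ x, (G x (i, j) : ℂ) * character (-k) x := by
    apply Complex.ext
    · rw [integral_re_mul hfi (by fun_prop), Complex.neg_re, integral_re_mul hGi (by fun_prop)]
      have h1 := h _ (isSmooth_re_character (-k)) i j
      simpa only [partialDeriv_re_character] using h1
    · rw [integral_im_mul hfi (by fun_prop), Complex.neg_im, integral_im_mul hGi (by fun_prop)]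
      have h1 := h _ (isSmooth_im_character (-k)) i j
      simpa only [partialDeriv_im_character] using h1
  have h2 : ∀ x, (f x i : ℂ) * (derivSymbol L j (-k) * character (-k) x)
      = derivSymbol L j (-k) * ((f x i : ℂ) * character (-k) x) := fun x => by ring
  simp only [h2] at key
  rw [integral_const_mul, derivSymbol_neg, neg_mul, neg_inj] at key
  rw [scalarCoeff, ← key, fourierCoeffVec]
  ring

/-- Distributional divergence in terms of Fourier coefficients. -/
theorem sum_derivSymbol_mul_fourierCoeffVec {f : Torus d L → Vec d} (h : IsDivFree f)
    (hf : Integrable f volume) (k : Fin d → ℤ) :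
    ∑ j, derivSymbol L j k * fourierCoeffVec f k j = 0 := by
  have hfi := fun j => integrable_apply hf j
  have hcI : ∀ j, Integrable (fun x => (f x j : ℂ) * (derivSymbol L j (-k) * character (-k) x))
      volume := by
    intro j
    have := (integrable_mul_character ((hfi j).ofReal (𝕜 := ℂ)) (-k)).const_mul
      (derivSymbol L j (-k))
    refine this.congr (Eventually.of_forall fun x => ?_)
    simp only [RCLike.ofReal_eq_complex_ofReal] at *
    ring
  have key : ∫ x, ∑ j, (f x j : ℂ) * (derivSymbol L j (-k) * character (-k) x) = 0 := by
    have hre : ∀ (T : ℂ →L[ℝ] ℝ), T (∫ x, ∑ j, (f x j : ℂ) * (derivSymbol L j (-k) * character (-k) x))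
        = ∫ x, ∑ j, T ((f x j : ℂ) * (derivSymbol L j (-k) * character (-k) x)) := by
      intro T
      rw [← T.integral_comp_comm (integrable_finsetSum _ fun j _ => hcI j)]
      simp only [map_sum]
    apply Complex.ext
    · have h1 := h _ (isSmooth_re_character (-k))
      have h2 := hre Complex.reCLM
      simp only [Complex.reCLM_apply, Complex.re_ofReal_mul] at h2
      rw [h2]
      simpa only [partialDeriv_re_character, Complex.zero_re] using h1
    · have h1 := h _ (isSmooth_im_character (-k))
      have h2 := hre Complex.imCLM
      simp only [Complex.imCLM_apply, Complex.im_ofReal_mul] at h2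
      rw [h2]
      simpa only [partialDeriv_im_character, Complex.zero_im] using h1
  rw [integral_finsetSum _ fun j _ => hcI j] at key
  have h2 : ∀ j, ∫ x, (f x j : ℂ) * (derivSymbol L j (-k) * character (-k) x)
      = -(((L ^ d : ℝ) : ℂ) * (derivSymbol L j k * fourierCoeffVec f k j)) := by
    intro j
    have h3 : ∀ x, (f x j : ℂ) * (derivSymbol L j (-k) * character (-k) x)
      = derivSymbol L j (-k) * ((f x j : ℂ) * character (-k) x) := fun x => by ring
    simp only [h3]
    rw [integral_const_mul, derivSymbol_neg, fourierCoeffVec, mul_left_comm (derivSymbol L j k),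
      mul_left_comm ((L ^ d : ℝ) : ℂ), coe_inv_mul_cancel, neg_mul]
  simp only [h2, Finset.sum_neg_distrib, ← Finset.mul_sum, neg_eq_zero] at key
  refine (mul_eq_zero.1 key).resolve_left ?_
  exact_mod_cast torus_volume_pos.ne'

/-! ### Truncations -/

theorem coe_truncate_apply (N : ℕ) (f : Torus d L → Vec d) (x : Torus d L) (i : Fin d) :
    ((truncate N f x i : ℝ) : ℂ) = trigPoly (freqBox d N) (fun k => fourierCoeffVec f k i) x :=
  trigPoly_re_coe (fun _ => neg_mem_freqBox) (fun k => scalarCoeff_neg_of_real (fun x => f x i) k) x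

/-- The Fourier coefficients of the Leray projection. -/
noncomputable def lerayCoeff (f : Torus d L → Vec d) (k : Fin d → ℤ) (i : Fin d) : ℂ :=
  fourierCoeffVec f k i
    - (∑ j, fourierCoeffVec f k j * (k j : ℂ)) / ((freqNorm k ^ 2 : ℝ) : ℂ) * (k i : ℂ)

theorem freqNorm_sq (k : Fin d → ℤ) : freqNorm k ^ 2 = ∑ i, (k i : ℝ) ^ 2 :=
  Real.sq_sqrt (Finset.sum_nonneg fun _ _ => sq_nonneg _)

theorem freqNorm_neg (k : Fin d → ℤ) : freqNorm (-k) = freqNorm k := by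
  simp [freqNorm]

theorem lerayCoeff_neg (f : Torus d L → Vec d) (k : Fin d → ℤ) (i : Fin d) :
    lerayCoeff f (-k) i = conj (lerayCoeff f k i) := by
  have h : ∀ j, fourierCoeffVec f (-k) j = conj (fourierCoeffVec f k j) :=
    fun j => scalarCoeff_neg_of_real (fun x => f x j) k
  simp only [lerayCoeff, h, freqNorm_neg, map_sub, map_mul, map_div₀, map_sum, Complex.conj_ofReal,
    Pi.neg_apply, Int.cast_neg, mul_neg, Finset.sum_neg_distrib, neg_div, neg_mul, neg_neg,
    map_intCast]

theorem coe_lerayTruncate_apply (N : ℕ) (f : Torus d L → Vec d) (x : Torus d L) (i : Fin d) :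
    ((lerayTruncate N f x i : ℝ) : ℂ) = trigPoly (freqBox d N) (fun k => lerayCoeff f k i) x :=
  trigPoly_re_coe (fun _ => neg_mem_freqBox) (fun k => lerayCoeff_neg f k i) x

theorem sum_lerayCoeff_mul (f : Torus d L → Vec d) (k : Fin d → ℤ) :
    ∑ i, lerayCoeff f k i * (k i : ℂ) = 0 := by
  rcases eq_or_ne k 0 with rfl | hk
  · simp
  have h0 : ((freqNorm k ^ 2 : ℝ) : ℂ) ≠ 0 := by
    have h1 := one_le_sum_sq hk
    rw [← freqNorm_sq] at h1
    exact_mod_cast (by linarith : (0 : ℝ) < freqNorm k ^ 2).ne'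
  simp only [lerayCoeff, sub_mul, Finset.sum_sub_distrib]
  have h1 : ∀ i, (∑ j, fourierCoeffVec f k j * (k j : ℂ)) / ((freqNorm k ^ 2 : ℝ) : ℂ) * (k i : ℂ)
      * (k i : ℂ) = (∑ j, fourierCoeffVec f k j * (k j : ℂ)) / ((freqNorm k ^ 2 : ℝ) : ℂ)
      * (k i : ℂ) ^ 2 := fun i => by ring
  simp only [h1, ← Finset.mul_sum]
  have h2 : (∑ i, (k i : ℂ) ^ 2) = ((freqNorm k ^ 2 : ℝ) : ℂ) := by
    rw [freqNorm_sq]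
    push_cast
    rfl
  rw [h2, div_mul_cancel₀ _ h0, sub_self]

theorem lerayCoeff_eq_of_divFree {f : Torus d L → Vec d} (h : IsDivFree f)
    (hf : Integrable f volume) (k : Fin d → ℤ) (i : Fin d) :
    lerayCoeff f k i = fourierCoeffVec f k i := by
  have h1 := sum_derivSymbol_mul_fourierCoeffVec h hf k
  have h2 : ∑ j, fourierCoeffVec f k j * (k j : ℂ) = 0 := by
    have h3 : ∀ j, derivSymbol L j k * fourierCoeffVec f k j
        = (Complex.I * ((2 * Real.pi / L : ℝ) : ℂ)) * (fourierCoeffVec f k j * (k j : ℂ)) := by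
      intro j
      rw [derivSymbol]
      push_cast
      ring
    simp only [h3, ← Finset.mul_sum] at h1
    refine (mul_eq_zero.1 h1).resolve_left (mul_ne_zero Complex.I_ne_zero ?_)
    have : 0 < 2 * Real.pi / L := div_pos (by positivity) hL.out
    exact_mod_cast this.ne'
  rw [lerayCoeff, h2]
  simp

theorem coe_partialDeriv_truncate (N : ℕ) (f : Torus d L → Vec d) (x : Torus d L) (i j : Fin d) :
    ((partialDeriv j (fun y => truncate N f y i) x : ℝ) : ℂ)
      = trigPoly (freqBox d N) (fun k => derivSymbol L j k * fourierCoeffVec f k i) x := by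
  have h : (fun y => truncate N f y i)
      = fun y => (trigPoly (freqBox d N) (fun k => fourierCoeffVec f k i) y).re := rfl
  rw [h, partialDeriv_re_trigPoly]
  refine trigPoly_re_coe (fun _ => neg_mem_freqBox) (fun k => ?_) x
  have h1 : fourierCoeffVec f (-k) i = conj (fourierCoeffVec f k i) :=
    scalarCoeff_neg_of_real (fun x => f x i) k
  rw [h1, map_mul, conj_derivSymbol, derivSymbol_neg]

end

end VectorMixing

open scoped ComplexConjugate

namespace VectorMixing

variable {d : ℕ} {L : ℝ}

/-! ### Estimates of the transport form in negative norms -/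

/-- Averaging the sum with its conjugate and exchanging the indices turns the weight into a
difference of weights. This is where the commutator appears. -/
theorem re_sum_antisymm {ι : Type} {K : Finset ι} {X : ι → ι → ℂ}
    (hX : ∀ k ∈ K, ∀ l ∈ K, conj (X l k) = -X k l) (wt : ι → ℝ) (a : ι → ℂ) :
    (∑ k ∈ K, ∑ l ∈ K, a k * conj (a l) * (wt l : ℂ) * X k l).re
      = (1 / 2) * (∑ k ∈ K, ∑ l ∈ K, a k * conj (a l) * ((wt l - wt k : ℝ) : ℂ) * X k l).re := by
  set T := ∑ k ∈ K, ∑ l ∈ K, a k * conj (a l) * (wt l : ℂ) * X k l with hT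
  have h1 : conj T = -∑ k ∈ K, ∑ l ∈ K, a k * conj (a l) * (wt k : ℂ) * X k l := by
    rw [hT]
    simp only [map_sum]
    rw [Finset.sum_comm, ← Finset.sum_neg_distrib]
    refine Finset.sum_congr rfl fun k hk => ?_
    rw [← Finset.sum_neg_distrib]
    refine Finset.sum_congr rfl fun l hl => ?_
    simp only [map_mul, Complex.conj_ofReal, Complex.conj_conj, hX k hk l hl]
    ring
  have h2 : ∑ k ∈ K, ∑ l ∈ K, a k * conj (a l) * ((wt l - wt k : ℝ) : ℂ) * X k l = T + conj T := by
    rw [h1, hT, ← sub_eq_add_neg, ← Finset.sum_sub_distrib]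
    refine Finset.sum_congr rfl fun k _ => ?_
    rw [← Finset.sum_sub_distrib]
    refine Finset.sum_congr rfl fun l _ => ?_
    push_cast
    ring
  rw [h2, Complex.add_re, Complex.conj_re]
  ring

theorem laplaceSymbol_zero : laplaceSymbol L (0 : Fin d → ℤ) = 0 := by
  simp [laplaceSymbol]

theorem abs_re_add_sub_le {f : Torus d L → ℂ} {x y : Torus d L} {c : ℝ}
    (h : ‖f (x + y) - f x‖ ≤ c) : |(f (x + y)).re - (f x).re| ≤ c := by
  rw [← Complex.sub_re]
  exact (Complex.abs_re_le_norm _).trans h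

/-- The weight of the zero mode is a negative power of zero, which `Real.rpow` evaluates to zero. -/
theorem negCoeff_erase {α : ℝ} (hα : 0 < α) (K : Finset (Fin d → ℤ)) (a : (Fin d → ℤ) → ℂ) :
    negCoeff (K.erase 0) (laplaceSymbol L) α a = negCoeff K (laplaceSymbol L) α a := by
  rw [negCoeff, negCoeff, l2Coeff, l2Coeff]
  congr 1
  refine Finset.sum_subset (Finset.erase_subset _ _) fun k hk hk' => ?_
  have : k = 0 := by
    by_contra h
    exact hk' (Finset.mem_erase.2 ⟨h, hk⟩)
  rw [this, laplaceSymbol_zero, Real.zero_rpow (by linarith)]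
  simp

theorem l2Coeff_subset {ι : Type*} {K K' : Finset ι} (h : K ⊆ K') (a : ι → ℂ) :
    l2Coeff K a ≤ l2Coeff K' a :=
  Real.sqrt_le_sqrt (Finset.sum_le_sum_of_subset_of_nonneg h fun _ _ _ => by positivity)

section

variable [hL : Fact (0 < L)]

theorem mulCoeff_eq_integral (V : Torus d L → ℝ) (k l : Fin d → ℤ) :
    mulCoeff V k l = ∫ x, (V x : ℂ) * character (k - l) x := by
  simp only [mulCoeff, mul_assoc, character_mul_conj]

/-- Divergence-free fields, in terms of Fourier coefficients. -/
def FourierDivFree (V : Fin d → Torus d L → ℝ) : Prop :=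
  ∀ m : Fin d → ℤ, ∑ j, derivSymbol L j m * ∫ x, (V j x : ℂ) * character m x = 0

/-- Integration by parts: for a divergence-free field the derivative may sit on either of the two
modes. -/
theorem transportCoeff_eq_right {V : Fin d → Torus d L → ℝ} (hV : FourierDivFree V)
    (k l : Fin d → ℤ) :
    transportCoeff V k l = ∑ j, derivSymbol L j l * mulCoeff (V j) k l := by
  have h := hV (k - l)
  simp only [← mulCoeff_eq_integral, derivSymbol_sub, sub_mul, Finset.sum_sub_distrib] at h
  exact sub_eq_zero.1 h

theorem conj_transportCoeff {V : Fin d → Torus d L → ℝ} (hV : FourierDivFree V) (k l : Fin d → ℤ) :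
    conj (transportCoeff V l k) = -transportCoeff V k l := by
  rw [transportCoeff_eq_right hV k l, transportCoeff, map_sum, ← Finset.sum_neg_distrib]
  refine Finset.sum_congr rfl fun j _ => ?_
  rw [map_mul, conj_derivSymbol, mulCoeff_eq_integral, mulCoeff_eq_integral, ← integral_conj, neg_mul]
  simp only [map_mul, Complex.conj_ofReal, ← character_neg, neg_sub]

theorem transportCoeff_zero_left (V : Fin d → Torus d L → ℝ) (l : Fin d → ℤ) :
    transportCoeff V 0 l = 0 := by
  simp [transportCoeff]

theorem laplaceSymbol_pos {k : Fin d → ℤ} (hk : k ≠ 0) : 0 < laplaceSymbol L k := by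
  have h : 0 < (2 * Real.pi / L) ^ 2 := pow_pos (div_pos (by positivity) hL.out) 2
  exact h.trans_le (sq_le_laplaceSymbol hk)

/-- The output mode zero is killed by its weight and the input mode zero by the derivative. Only
modes with positive symbol remain, as the heat estimates require. -/
theorem sum_transport_erase {α : ℝ} (hα : 0 < α) (V : Fin d → Torus d L → ℝ)
    (K : Finset (Fin d → ℤ)) (a : (Fin d → ℤ) → ℂ) :
    ∑ k ∈ K, ∑ l ∈ K, a k * conj (a l) * ((laplaceSymbol L l ^ (-α) : ℝ) : ℂ) * transportCoeff V k l
      = ∑ k ∈ K.erase 0, ∑ l ∈ K.erase 0,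
        a k * conj (a l) * ((laplaceSymbol L l ^ (-α) : ℝ) : ℂ) * transportCoeff V k l := by
  have hz : ∀ k ∈ K, k ∉ K.erase 0 → k = 0 := by
    intro k hk hk'
    by_contra h
    exact hk' (Finset.mem_erase.2 ⟨h, hk⟩)
  symm
  refine (Finset.sum_congr rfl fun k _ => ?_).trans
    (Finset.sum_subset (Finset.erase_subset _ _) fun k hk hk' => ?_)
  · refine Finset.sum_subset (Finset.erase_subset _ _) fun l hl hl' => ?_
    rw [hz l hl hl', laplaceSymbol_zero, Real.zero_rpow (by linarith)]
    simp
  · refine Finset.sum_eq_zero fun l _ => ?_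
    rw [hz k hk hk', transportCoeff_zero_left, mul_zero]

/-- Transport by a Hölder field is controlled in the negative norm. -/
theorem exists_transport_bound (d : ℕ) (L : ℝ) [Fact (0 < L)] {α : ℝ} (hα : 1 / 2 ≤ α)
    (hα1 : α < 1) :
    ∃ C : ℝ, 0 < C ∧ ∀ (K : Finset (Fin d → ℤ)) (V : Fin d → Torus d L → ℝ) (H : ℝ), 0 ≤ H →
      (∀ j, Continuous (V j)) → (∀ j x y, |V j (x + y) - V j x| ≤ H * ‖y‖ ^ α) →
      FourierDivFree V → ∀ a : (Fin d → ℤ) → ℂ,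
        |(∑ k ∈ K, ∑ l ∈ K, a k * conj (a l) * ((laplaceSymbol L l ^ (-α) : ℝ) : ℂ) *
          transportCoeff V k l).re|
        ≤ C * H * negCoeff K (laplaceSymbol L) α a ^ (2 - (1 - α) / α)
          * l2Coeff K a ^ ((1 - α) / α) := by
  obtain ⟨C, hC0, hC⟩ := exists_negCommutator_bound hα hα1
  have hα0 : 0 < α := by linarith
  have hLd : 0 < L ^ d := torus_volume_pos
  -- The factor d + 1 in place of d keeps the constant positive when d = 0.
  refine ⟨C * ((d + 1) * ((1 + 2 * d) * L ^ d)), by positivity, ?_⟩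
  intro K V H hH hVc hVH hdiv a
  have h1 := hC (K.erase 0) (laplaceSymbol L) (transportCoeff V) (d * ((1 + 2 * d) * H * L ^ d))
    (fun k hk => laplaceSymbol_pos (Finset.ne_of_mem_erase hk))
    (fun k _ l _ => conj_transportCoeff hdiv k l) (by positivity)
    (fun s hs v w => norm_heat_transport_commutator_le hα0.le hα1.le hH hVc hVH hs _ v w) a
  rw [negCoeff_erase hα0] at h1
  rw [sum_transport_erase hα0, re_sum_antisymm (fun k _ l _ => conj_transportCoeff hdiv k l), abs_mul]
  have hn := negCoeff_nonneg (K := K) (ν := laplaceSymbol L) α a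
  have hp : 0 ≤ (1 - α) / α := div_nonneg (by linarith) hα0.le
  calc _ ≤ 1 * ‖∑ k ∈ K.erase 0, ∑ l ∈ K.erase 0, a k * conj (a l) *
        ((laplaceSymbol L l ^ (-α) - laplaceSymbol L k ^ (-α) : ℝ) : ℂ) * transportCoeff V k l‖ := by
        refine mul_le_mul ?_ (Complex.abs_re_le_norm _) (abs_nonneg _) zero_le_one
        rw [abs_of_pos (by norm_num)]
        norm_num
    _ ≤ _ := by
        rw [one_mul]
        refine h1.trans ?_
        have h2 : l2Coeff (K.erase 0) a ^ ((1 - α) / α) ≤ l2Coeff K a ^ ((1 - α) / α) :=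
          Real.rpow_le_rpow (l2Coeff_nonneg _ _) (l2Coeff_subset (Finset.erase_subset _ _) a) hp
        have h3 : C * (d * ((1 + 2 * d) * H * L ^ d)) ≤ C * ((d + 1) * ((1 + 2 * d) * L ^ d)) * H := by
          have : 0 ≤ (1 + 2 * (d : ℝ)) * H * L ^ d := by positivity
          have h4 : (d : ℝ) * ((1 + 2 * d) * H * L ^ d) ≤ (d + 1) * ((1 + 2 * d) * H * L ^ d) := by
            linarith
          calc _ ≤ C * ((d + 1) * ((1 + 2 * d) * H * L ^ d)) :=
                mul_le_mul_of_nonneg_left h4 hC0.le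
            _ = _ := by ring
        have hn' : 0 ≤ negCoeff K (laplaceSymbol L) α a ^ (2 - (1 - α) / α) :=
          Real.rpow_nonneg hn _
        exact mul_le_mul (mul_le_mul_of_nonneg_right h3 hn') h2
          (Real.rpow_nonneg (l2Coeff_nonneg _ _) _) (by positivity)

/-- Transport by a bounded field, estimated without using any regularity. -/
theorem norm_transport_le {α c : ℝ} (hα : 1 / 2 ≤ α) (K : Finset (Fin d → ℤ))
    {W : Fin d → Torus d L → ℝ} (hW : ∀ j, Continuous (W j)) (hc : ∀ j x, |W j x| ≤ c) (hc0 : 0 ≤ c)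
    (hdiv : FourierDivFree W) (a : (Fin d → ℤ) → ℂ) :
    ‖∑ k ∈ K, ∑ l ∈ K, a k * conj (a l) * ((laplaceSymbol L l ^ (-α) : ℝ) : ℂ) *
        transportCoeff W k l‖
      ≤ d * (c * L ^ d * (2 * Real.pi / L) ^ (1 - 2 * α)) * l2Coeff K a ^ 2 := by
  have hα0 : 0 < α := by linarith
  have hκ : 0 < 2 * Real.pi / L := div_pos (by positivity) hL.out
  have hLd : 0 < L ^ d := torus_volume_pos
  -- b_j holds the coefficients of (-Δ)^(-α) ∂_j of the field, up to sign. It is bounded on L² since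
  -- ν^(1/2 - α) is largest at the smallest nonzero frequency when α ≥ 1/2.
  set b : Fin d → (Fin d → ℤ) → ℂ := fun j l =>
    ((laplaceSymbol L l ^ (-α) : ℝ) : ℂ) * (conj (derivSymbol L j l) * a l) with hb
  have h1 : ∑ k ∈ K, ∑ l ∈ K, a k * conj (a l) * ((laplaceSymbol L l ^ (-α) : ℝ) : ℂ) *
        transportCoeff W k l
      = ∑ j, ∫ x, (W j x : ℂ) * trigPoly K a x * conj (trigPoly K (b j) x) := by
    simp only [integral_mul_trigPoly_mul_conj (hW _)]
    conv_rhs => rw [Finset.sum_comm]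
    refine Finset.sum_congr rfl fun k _ => ?_
    conv_rhs => rw [Finset.sum_comm]
    refine Finset.sum_congr rfl fun l _ => ?_
    rw [transportCoeff_eq_right hdiv, Finset.mul_sum]
    refine Finset.sum_congr rfl fun j _ => ?_
    simp only [hb, map_mul, Complex.conj_conj, Complex.conj_ofReal]
    ring
  rw [h1]
  refine (norm_sum_le _ _).trans ?_
  have h2 : ∀ j ∈ (Finset.univ : Finset (Fin d)),
      ‖∫ x, (W j x : ℂ) * trigPoly K a x * conj (trigPoly K (b j) x)‖
      ≤ c * L ^ d * (2 * Real.pi / L) ^ (1 - 2 * α) * l2Coeff K a ^ 2 := by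
    intro j _
    refine (norm_integral_mul_trigPoly_le (hc j) K a (b j)).trans ?_
    have h3 : l2Coeff K (b j) ≤ (2 * Real.pi / L) ^ (1 - 2 * α) * l2Coeff K a := by
      refine l2Coeff_le_mul (by positivity) fun l _ => ?_
      simp only [hb]
      rw [norm_mul, norm_mul, RCLike.norm_conj, ← mul_assoc, Complex.norm_real]
      refine mul_le_mul_of_nonneg_right ?_ (norm_nonneg _)
      rcases eq_or_ne l 0 with rfl | hl
      · rw [derivSymbol_zero, norm_zero, mul_zero]
        positivity
      have hν : 0 < laplaceSymbol L l := laplaceSymbol_pos hl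
      rw [Real.norm_of_nonneg (Real.rpow_nonneg hν.le _)]
      calc _ ≤ laplaceSymbol L l ^ (-α) * laplaceSymbol L l ^ (1 / 2 : ℝ) := by
            rw [← Real.sqrt_eq_rpow]
            exact mul_le_mul_of_nonneg_left (norm_derivSymbol_le j l) (Real.rpow_nonneg hν.le _)
        _ = laplaceSymbol L l ^ (1 / 2 - α) := by
            rw [← Real.rpow_add hν]
            congr 1
            ring
        _ ≤ ((2 * Real.pi / L) ^ 2) ^ (1 / 2 - α) :=
            Real.rpow_le_rpow_of_nonpos (by positivity) (sq_le_laplaceSymbol hl) (by linarith)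
        _ = _ := by
            rw [← Real.rpow_natCast, ← Real.rpow_mul hκ.le]
            congr 1
            push_cast
            ring
    calc _ ≤ c * L ^ d * (l2Coeff K a * ((2 * Real.pi / L) ^ (1 - 2 * α) * l2Coeff K a)) := by
          refine mul_le_mul_of_nonneg_left (mul_le_mul_of_nonneg_left h3 (l2Coeff_nonneg _ _)) ?_
          positivity
      _ = _ := by ring
  refine (Finset.sum_le_card_nsmul _ _ _ h2).trans (le_of_eq ?_)
  simp
  ring

/-! ### Velocity fields at a fixed time -/

theorem fourierDivFree_re_trigPoly {K : Finset (Fin d → ℤ)} (hK : ∀ k, -k ∈ K ↔ k ∈ K)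
    {A : Fin d → (Fin d → ℤ) → ℂ} (hA : ∀ j k, A j (-k) = conj (A j k))
    (hdiv : ∀ k, ∑ j, derivSymbol L j k * A j k = 0) :
    FourierDivFree (fun j (x : Torus d L) => (trigPoly K (A j) x).re) := by
  intro m
  simp only [trigPoly_re_coe hK (hA _)]
  have h1 : ∀ j, ∫ x : Torus d L, trigPoly K (A j) x * character m x
      = if -m ∈ K then ((L ^ d : ℝ) : ℂ) * A j (-m) else 0 := by
    intro j
    have := integral_trigPoly_mul_character (L := L) K (A j) (-m)
    rwa [neg_neg] at this
  simp only [h1]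
  split_ifs
  · have h2 := hdiv (-m)
    simp only [derivSymbol_neg, neg_mul, Finset.sum_neg_distrib, neg_eq_zero] at h2
    calc _ = ((L ^ d : ℝ) : ℂ) * ∑ j, derivSymbol L j m * A j (-m) := by
          rw [Finset.mul_sum]
          exact Finset.sum_congr rfl fun j _ => by ring
      _ = 0 := by rw [h2, mul_zero]
  · simp

/-- The components of the truncated velocity. -/
noncomputable def truncComp (N : ℕ) (U : Torus d L → Vec d) (j : Fin d) (x : Torus d L) : ℝ :=
  truncate N U x j

theorem truncComp_eq (N : ℕ) (U : Torus d L → Vec d) :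
    truncComp N U = fun j x => (trigPoly (freqBox d N) (fun k => fourierCoeffVec U k j) x).re := rfl

@[fun_prop] theorem continuous_truncComp (N : ℕ) (U : Torus d L → Vec d) (j : Fin d) :
    Continuous (truncComp N U j) := by
  rw [truncComp_eq]
  fun_prop

theorem fourierDivFree_truncComp {U : Torus d L → Vec d} (hU : IsDivFree U)
    (hUi : Integrable U volume) (N : ℕ) : FourierDivFree (truncComp N U) := by
  rw [truncComp_eq]
  exact fourierDivFree_re_trigPoly (fun _ => neg_mem_freqBox)
    (fun j k => scalarCoeff_neg_of_real (fun x => U x j) k)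
    (sum_derivSymbol_mul_fourierCoeffVec hU hUi)

theorem integrable_of_memLp {q : ℝ} (hq : 1 ≤ q) {E : Type*} [NormedAddCommGroup E]
    {f : Torus d L → E} (hf : MemLp f (ENNReal.ofReal q) volume) : Integrable f volume := by
  refine hf.integrable ?_
  rw [← ENNReal.ofReal_one]
  exact ENNReal.ofReal_le_ofReal hq

theorem truncComp_holder {q α B : ℝ} (hq : 1 ≤ q) (hα : 0 < α) (hcrit : q * (1 - α) = d)
    (hB : 0 ≤ B) (N : ℕ) {U : Torus d L → Vec d}
    (hU : eLpNorm (gradient (truncate N U)) (ENNReal.ofReal q) volume ≤ ENNReal.ofReal B) (j : Fin d)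
    (x y : Torus d L) :
    |truncComp N U j (x + y) - truncComp N U j x| ≤ (2 / α * d * B) * ‖y‖ ^ α := by
  refine abs_re_add_sub_le (norm_trigPoly_add_sub_le hq hα hcrit _ _ (fun i => ?_) hB x y)
  refine le_trans (eLpNorm_mono fun x => ?_) hU
  rw [← coe_partialDeriv_truncate, Complex.norm_real]
  exact PiLp.norm_apply_le (gradient (truncate N U) x) (j, i)

/-- The components of the Fejér mean of the velocity. -/
noncomputable def fejerComp (N : ℕ) (U : Torus d L → Vec d) (j : Fin d) (x : Torus d L) : ℝ :=
  (trigPoly (freqBox d N) (fun k => fejerCoeff L N k * fourierCoeffVec U k j) x).re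

@[fun_prop] theorem continuous_fejerComp (N : ℕ) (U : Torus d L → Vec d) (j : Fin d) :
    Continuous (fejerComp N U j) := by
  unfold fejerComp
  fun_prop

theorem fejerCoeff_neg (N : ℕ) (k : Fin d → ℤ) :
    fejerCoeff L N (-k) = conj (fejerCoeff L N k) := by
  simp only [fejerCoeff, map_mul, Complex.conj_ofReal, ← integral_conj, character_neg]

theorem fourierDivFree_fejerComp {U : Torus d L → Vec d} (hU : IsDivFree U)
    (hUi : Integrable U volume) (N : ℕ) : FourierDivFree (fejerComp N U) := by
  refine fourierDivFree_re_trigPoly (fun _ => neg_mem_freqBox) (fun j k => ?_) fun k => ?_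
  · have h : fourierCoeffVec U (-k) j = conj (fourierCoeffVec U k j) :=
      scalarCoeff_neg_of_real (fun x => U x j) k
    rw [h, fejerCoeff_neg, map_mul]
  · have h := sum_derivSymbol_mul_fourierCoeffVec hU hUi k
    calc _ = fejerCoeff L N k * ∑ j, derivSymbol L j k * fourierCoeffVec U k j := by
          rw [Finset.mul_sum]
          exact Finset.sum_congr rfl fun j _ => by ring
      _ = 0 := by rw [h, mul_zero]

/-- Fejér means commute with derivatives and contract L^q, so the gradient of the mean inherits the
bound on `G` without any loss, and Morrey's inequality applies. -/
theorem fejerMean_holder {q α B : ℝ} (hq : 1 ≤ q) (hα : 0 < α) (hcrit : q * (1 - α) = d)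
    (hB : 0 ≤ B) {U : Torus d L → Vec d} {G : Torus d L → Mat d} (hUG : IsWeakGradient U G)
    (hU : MemLp U (ENNReal.ofReal q) volume) (hG : MemLp G (ENNReal.ofReal q) volume)
    (hGB : eLpNorm G (ENNReal.ofReal q) volume ≤ ENNReal.ofReal B) (i : Fin d) (N : ℕ)
    (x y : Torus d L) :
    ‖trigPoly (freqBox d N) (fun k => fejerCoeff L N k * fourierCoeffVec U k i) (x + y)
      - trigPoly (freqBox d N) (fun k => fejerCoeff L N k * fourierCoeffVec U k i) x‖
      ≤ (2 / α * d * B) * ‖y‖ ^ α := by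
  refine norm_trigPoly_add_sub_le hq hα hcrit _ _ (fun j => ?_) hB x y
  have hGi : MemLp (fun x => (G x (i, j) : ℂ)) (ENNReal.ofReal q) volume := by
    refine MemLp.of_le hG ?_ (Eventually.of_forall fun x => ?_)
    · have h1 : AEStronglyMeasurable (fun x => G x (i, j)) volume :=
        (EuclideanSpace.proj (𝕜 := ℝ) (i, j) : Mat d →L[ℝ] ℝ).continuous.comp_aestronglyMeasurable
          hG.aestronglyMeasurable
      exact Complex.continuous_ofReal.comp_aestronglyMeasurable h1
    · rw [Complex.norm_real]
      exact PiLp.norm_apply_le (G x) (i, j)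
  have h2 := eLpNorm_fejerMean_le hq hGi N
  have h3 : (fun k => derivSymbol L j k * (fejerCoeff L N k * fourierCoeffVec U k i))
      = fun k => fejerCoeff L N k * scalarCoeff (fun x => (G x (i, j) : ℂ)) k := by
    funext k
    rw [scalarCoeff_weakGradient hUG (integrable_of_memLp hq hU) (integrable_of_memLp hq hG)]
    ring
  rw [h3]
  refine h2.trans (le_trans (eLpNorm_mono fun x => ?_) hGB)
  rw [Complex.norm_real]
  exact PiLp.norm_apply_le (G x) (i, j)

theorem transportCoeff_add {V W : Fin d → Torus d L → ℝ} (hV : ∀ j, Continuous (V j))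
    (hW : ∀ j, Continuous (W j)) (k l : Fin d → ℤ) :
    transportCoeff (fun j x => V j x + W j x) k l = transportCoeff V k l + transportCoeff W k l := by
  simp only [transportCoeff, ← Finset.sum_add_distrib, ← mul_add]
  refine Finset.sum_congr rfl fun j _ => ?_
  congr 1
  rw [mulCoeff, mulCoeff, mulCoeff, ← integral_add (integrable_of_continuous
    (by have := hV j; fun_prop)) (integrable_of_continuous (by have := hW j; fun_prop))]
  refine integral_congr_ae (Eventually.of_forall fun x => ?_)
  push_cast
  ring

theorem FourierDivFree.sub {V W : Fin d → Torus d L → ℝ} (hV : ∀ j, Continuous (V j))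
    (hW : ∀ j, Continuous (W j)) (h1 : FourierDivFree V) (h2 : FourierDivFree W) :
    FourierDivFree (fun j x => V j x - W j x) := by
  intro m
  have h : ∀ j, ∫ x, ((V j x - W j x : ℝ) : ℂ) * character m x
      = (∫ x, (V j x : ℂ) * character m x) - ∫ x, (W j x : ℂ) * character m x := by
    intro j
    rw [← integral_sub (integrable_of_continuous (by have := hV j; fun_prop))
      (integrable_of_continuous (by have := hW j; fun_prop))]
    refine integral_congr_ae (Eventually.of_forall fun x => ?_)
    push_cast
    ring
  simp only [h, mul_sub, Finset.sum_sub_distrib, h1 m, h2 m, sub_self]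

/-- Transport by the truncation of a Sobolev field: it is controlled by the gradient of the field
itself up to an error that vanishes with the truncation. -/
theorem exists_truncated_transport_bound (d : ℕ) (L : ℝ) [Fact (0 < L)] {α q : ℝ} (hα : 1 / 2 ≤ α)
    (hα1 : α < 1) (hq : 1 ≤ q) (hcrit : q * (1 - α) = d) :
    ∃ C : ℝ, 0 < C ∧ ∃ η : ℕ → ℝ, (∀ N, 0 ≤ η N) ∧ Tendsto η atTop (𝓝 0) ∧
      ∀ (N : ℕ) (U : Torus d L → Vec d), IsDivFree U → MemLp U (ENNReal.ofReal q) volume →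
      ∀ (B : ℝ), 0 ≤ B → ∀ a : (Fin d → ℤ) → ℂ,
      (eLpNorm (gradient (truncate N U)) (ENNReal.ofReal q) volume ≤ ENNReal.ofReal B →
        |(∑ k ∈ freqBox d N, ∑ l ∈ freqBox d N, a k * conj (a l) *
          ((laplaceSymbol L l ^ (-α) : ℝ) : ℂ) * transportCoeff (truncComp N U) k l).re|
        ≤ C * B * negCoeff (freqBox d N) (laplaceSymbol L) α a ^ (2 - (1 - α) / α)
          * l2Coeff (freqBox d N) a ^ ((1 - α) / α)) ∧
      (∀ G : Torus d L → Mat d, IsWeakGradient U G → MemLp G (ENNReal.ofReal q) volume →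
        eLpNorm G (ENNReal.ofReal q) volume ≤ ENNReal.ofReal B →
        |(∑ k ∈ freqBox d N, ∑ l ∈ freqBox d N, a k * conj (a l) *
          ((laplaceSymbol L l ^ (-α) : ℝ) : ℂ) * transportCoeff (truncComp N U) k l).re|
        ≤ C * B * negCoeff (freqBox d N) (laplaceSymbol L) α a ^ (2 - (1 - α) / α)
          * l2Coeff (freqBox d N) a ^ ((1 - α) / α)
          + η N * B * l2Coeff (freqBox d N) a ^ 2) := by
  obtain ⟨C, hC0, hC⟩ := exists_transport_bound d L hα hα1
  have hα0 : 0 < α := by linarith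
  have hLd : 0 < L ^ d := torus_volume_pos
  have hκ : 0 < 2 * Real.pi / L := div_pos (by positivity) (Fact.out : 0 < L)
  set D : ℝ := d * (2 / α * d * L ^ d * (2 * Real.pi / L) ^ (1 - 2 * α)) with hD
  have hD0 : 0 ≤ D := by positivity
  refine ⟨C * (2 / α * (d + 1)), by positivity, fun N => D * dirichletError d L α N,
    fun N => mul_nonneg hD0 (dirichletError_nonneg α N), ?_, ?_⟩
  · simpa using (tendsto_dirichletError (d := d) (L := L) hα0 hα1.le).const_mul D
  intro N U hdiv hU B hB a
  have hUi := integrable_of_memLp hq hU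
  have hn : 0 ≤ negCoeff (freqBox d N) (laplaceSymbol L) α a ^ (2 - (1 - α) / α) :=
    Real.rpow_nonneg (negCoeff_nonneg _ _) _
  have he : 0 ≤ l2Coeff (freqBox d N) a ^ ((1 - α) / α) := Real.rpow_nonneg (l2Coeff_nonneg _ _) _
  have hmain : C * (2 / α * d * B) * negCoeff (freqBox d N) (laplaceSymbol L) α a ^ (2 - (1 - α) / α)
      * l2Coeff (freqBox d N) a ^ ((1 - α) / α)
      ≤ C * (2 / α * (d + 1)) * B * negCoeff (freqBox d N) (laplaceSymbol L) α a ^ (2 - (1 - α) / α)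
      * l2Coeff (freqBox d N) a ^ ((1 - α) / α) := by
    refine mul_le_mul_of_nonneg_right (mul_le_mul_of_nonneg_right ?_ hn) he
    have : 0 ≤ C * (2 / α) * B := by positivity
    nlinarith
  refine ⟨fun hB' => ?_, fun G hUG hG hGB => ?_⟩
  · exact (hC (freqBox d N) (truncComp N U) (2 / α * d * B) (by positivity)
      (continuous_truncComp N U) (fun j x y => truncComp_holder hq hα0 hcrit hB N hB' j x y)
      (fourierDivFree_truncComp hdiv hUi N) a).trans hmain
  -- The truncation is split into the Fejér mean, which is Hölder with a constant given by `G`, and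
  -- a uniformly small remainder for which no regularity is needed.
  · set V := fejerComp N U with hV
    set W : Fin d → Torus d L → ℝ := fun j x => truncComp N U j x - fejerComp N U j x with hW
    have hVc : ∀ j, Continuous (V j) := continuous_fejerComp N U
    have hWc : ∀ j, Continuous (W j) := fun j => by simp only [hW]; fun_prop
    have hVH := fun i => fejerMean_holder hq hα0 hcrit hB hUG hU hG hGB i
    have hsum : ∀ k l, transportCoeff (truncComp N U) k l
        = transportCoeff V k l + transportCoeff W k l := by
      intro k l
      rw [← transportCoeff_add hVc hWc]
      congr 1
      funext j x
      simp [hV, hW]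
    have hWb : ∀ j x, |W j x| ≤ 2 / α * d * B * dirichletError d L α N := by
      intro j x
      have h1 := norm_trigPoly_sub_fejerMean_le (A := fun k => fourierCoeffVec U k j) hα0.le hα1.le
        (by positivity : 0 ≤ 2 / α * d * B) (hVH j) N x
      rw [trigPoly_sub] at h1
      exact (Complex.abs_re_le_norm (trigPoly (freqBox d N) (fun k => fourierCoeffVec U k j) x -
        trigPoly (freqBox d N) (fun k => fejerCoeff L N k * fourierCoeffVec U k j) x)).trans h1
    have hWd : FourierDivFree W := FourierDivFree.sub (continuous_truncComp N U) hVc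
      (fourierDivFree_truncComp hdiv hUi N) (fourierDivFree_fejerComp hdiv hUi N)
    have hS : ∑ k ∈ freqBox d N, ∑ l ∈ freqBox d N, a k * conj (a l) *
          ((laplaceSymbol L l ^ (-α) : ℝ) : ℂ) * transportCoeff (truncComp N U) k l
        = (∑ k ∈ freqBox d N, ∑ l ∈ freqBox d N, a k * conj (a l) *
          ((laplaceSymbol L l ^ (-α) : ℝ) : ℂ) * transportCoeff V k l)
        + ∑ k ∈ freqBox d N, ∑ l ∈ freqBox d N, a k * conj (a l) *
          ((laplaceSymbol L l ^ (-α) : ℝ) : ℂ) * transportCoeff W k l := by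
      simp only [hsum, mul_add, Finset.sum_add_distrib]
    rw [hS, Complex.add_re]
    refine (abs_add_le _ _).trans (add_le_add ?_ ?_)
    · exact (hC (freqBox d N) V (2 / α * d * B) (by positivity) hVc
        (fun j x y => abs_re_add_sub_le (hVH j N x y))
        (fourierDivFree_fejerComp hdiv hUi N) a).trans hmain
    · refine (Complex.abs_re_le_norm _).trans ((norm_transport_le hα (freqBox d N) hWc hWb
        (mul_nonneg (by positivity) (dirichletError_nonneg α N)) hWd a).trans (le_of_eq ?_))
      rw [hD]
      ring

end

end VectorMixing

open scoped ComplexConjugate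

namespace VectorMixing

/-! ### Absolutely continuous functions and a differential inequality -/

/-- The velocity is only measurable in time, so f is merely absolutely continuous. The product rule
for such functions applies, and Lebesgue differentiation identifies the derivative almost
everywhere. -/
theorem sq_sub_sq_eq_integral {f b : ℝ → ℝ} {τ t : ℝ} (hτ : 0 ≤ τ) (hτt : τ ≤ t)
    (hb : IntervalIntegrable b volume 0 t)
    (hf : ∀ s ∈ Icc 0 t, f s = f 0 - ∫ x in (0 : ℝ)..s, b x) :
    f t ^ 2 - f τ ^ 2 = -∫ s in τ..t, 2 * (f s * b s) := by
  set F : ℝ → ℝ := fun s => f 0 - ∫ x in (0 : ℝ)..s, b x with hF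
  have hI : uIcc 0 t = Icc 0 t := uIcc_of_le (hτ.trans hτt)
  have hI' : uIcc τ t = Icc τ t := uIcc_of_le hτt
  have hsub : uIcc τ t ⊆ uIcc 0 t := by
    rw [hI, hI']
    exact Icc_subset_Icc_left hτ
  have hac : AbsolutelyContinuousOnInterval F τ t := by
    refine AbsolutelyContinuousOnInterval.mono ?_ hsub
    exact ((LipschitzWith.const (f 0)).lipschitzOnWith (s := uIcc 0 t)).absolutelyContinuousOnInterval.sub
      (hb.absolutelyContinuousOnInterval_intervalIntegral (c := 0) (by simp))
  have h := hac.integral_deriv_mul_eq_sub hac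
  have hFt : ∀ s ∈ Icc τ t, F s = f s := fun s hs => (hf s ⟨hτ.trans hs.1, hs.2⟩).symm
  rw [hFt t ⟨hτt, le_rfl⟩, hFt τ ⟨le_rfl, hτt⟩, ← sq, ← sq] at h
  rw [← h, ← intervalIntegral.integral_neg]
  refine intervalIntegral.integral_congr_ae ?_
  filter_upwards [hb.ae_hasDerivAt_integral] with s hs hmem
  have hmem' : s ∈ uIcc τ t := uIoc_subset_uIcc hmem
  have hd : HasDerivAt F (-b s) s := by
    simpa using (hs (hsub hmem') 0 (by simp)).const_sub (f 0)
  rw [hd.deriv, hFt s (hI' ▸ hmem')]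
  ring

theorem norm_sq_sub_norm_sq_eq_integral {a b : ℝ → ℂ} {τ t : ℝ} (hτ : 0 ≤ τ) (hτt : τ ≤ t)
    (hb : IntervalIntegrable b volume 0 t)
    (ha : ∀ s ∈ Icc 0 t, a s = a 0 - ∫ x in (0 : ℝ)..s, b x) :
    ‖a t‖ ^ 2 - ‖a τ‖ ^ 2 = -∫ s in τ..t, 2 * (conj (a s) * b s).re := by
  have hac : ContinuousOn a (uIcc τ t) := by
    have h1 := intervalIntegral.continuousOn_primitive_interval' hb (left_mem_uIcc)
    have h2 : ContinuousOn (fun s => a 0 - ∫ x in (0 : ℝ)..s, b x) (uIcc 0 t) :=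
      continuousOn_const.sub h1
    rw [uIcc_of_le (hτ.trans hτt)] at h2
    rw [uIcc_of_le hτt]
    exact (h2.congr ha).mono (Icc_subset_Icc_left hτ)
  have hbt : IntervalIntegrable b volume τ t := by
    refine hb.mono_set ?_
    rw [uIcc_of_le hτt, uIcc_of_le (hτ.trans hτt)]
    exact Icc_subset_Icc_left hτ
  have hpart : ∀ T : ℂ →L[ℝ] ℝ, (T (a t)) ^ 2 - (T (a τ)) ^ 2
      = -∫ s in τ..t, 2 * (T (a s) * T (b s)) := by
    intro T
    refine sq_sub_sq_eq_integral (f := fun s => T (a s)) (b := fun s => T (b s)) hτ hτt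
      ⟨T.integrable_comp hb.1, T.integrable_comp hb.2⟩ fun s hs => ?_
    have hbs : IntervalIntegrable b volume 0 s := by
      refine hb.mono_set ?_
      rw [uIcc_of_le hs.1, uIcc_of_le (hτ.trans hτt)]
      exact Icc_subset_Icc_right hs.2
    rw [ha s hs, map_sub, ← T.intervalIntegral_comp_comm hbs]
  have hInt : ∀ T : ℂ →L[ℝ] ℝ, IntervalIntegrable (fun s => 2 * (T (a s) * T (b s))) volume τ t := by
    intro T
    have h1 : IntervalIntegrable (fun s => T (b s)) volume τ t :=
      ⟨T.integrable_comp hbt.1, T.integrable_comp hbt.2⟩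
    exact (h1.continuousOn_mul (T.continuous.comp_continuousOn hac)).const_mul 2
  have hn : ∀ z : ℂ, ‖z‖ ^ 2 = z.re ^ 2 + z.im ^ 2 := fun z => by
    rw [Complex.sq_norm, Complex.normSq_apply]
    ring
  have h1 := hpart Complex.reCLM
  have h2 := hpart Complex.imCLM
  have h3 := intervalIntegral.integral_add (hInt Complex.reCLM) (hInt Complex.imCLM)
  simp only [Complex.reCLM_apply, Complex.imCLM_apply] at h1 h2 h3
  have h4 : ∀ s, 2 * (conj (a s) * b s).re
      = 2 * ((a s).re * (b s).re) + 2 * ((a s).im * (b s).im) := fun s => by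
    rw [Complex.mul_re, Complex.conj_re, Complex.conj_im]
    ring
  simp only [h4]
  rw [h3, hn, hn]
  linarith

/-- If `y' ≥ -A y^(1 - γ)` in integrated form, then `y^γ` decreases at most with speed `γ A`. -/
theorem rpow_sub_le_rpow_of_integral {y : ℝ → ℝ} {A γ : ℝ} (hγ : 0 < γ) (hγ1 : γ < 1) (hA : 0 ≤ A)
    (hy : ContinuousOn y (Ici 0)) (hy0 : ∀ t, 0 ≤ t → 0 ≤ y t)
    (h : ∀ s t, 0 ≤ s → s ≤ t → y s - y t ≤ ∫ x in s..t, A * y x ^ (1 - γ)) {t : ℝ} (ht : 0 ≤ t) :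
    y 0 ^ γ - γ * A * t ≤ y t ^ γ := by
  have key : ∀ δ > 0, y 0 ^ γ - (γ * A + δ) * t ≤ y t ^ γ := by
    intro δ hδ
    -- The barrier z = β^(1/γ) solves z' = -(A + δ/γ) z^(1-γ). The extra δ makes it strictly steeper
    -- than y at a contact point, as the comparison principle demands.
    set β : ℝ → ℝ := fun s => y 0 ^ γ - (γ * A + δ) * s with hβ
    -- Once β has reached zero the bound is trivial; before that β is positive and its powers are
    -- differentiable.
    rcases le_or_gt (β t) 0 with hneg | hpos
    · exact hneg.trans (Real.rpow_nonneg (hy0 t ht) γ)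
    have hc0 : 0 < γ * A + δ := by positivity
    have hβpos : ∀ s ∈ Icc 0 t, 0 < β s := by
      intro s hs
      refine hpos.trans_le ?_
      simp only [hβ]
      have := mul_le_mul_of_nonneg_left hs.2 hc0.le
      linarith
    have hβd : ∀ s, HasDerivAt β (-(γ * A + δ)) s := by
      intro s
      simpa using ((hasDerivAt_id s).const_mul (γ * A + δ)).const_sub (y 0 ^ γ)
    have hBd : ∀ s ∈ Icc 0 t, HasDerivAt (fun s => -(β s ^ (1 / γ)))
        ((γ * A + δ) / γ * β s ^ (1 / γ - 1)) s := by
      intro s hs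
      have := ((hβd s).rpow_const (p := 1 / γ) (Or.inl (hβpos s hs).ne')).neg
      refine this.congr_deriv ?_
      ring
    have hycont : ContinuousOn (fun x => A * y x ^ (1 - γ)) (Ici 0) :=
      continuousOn_const.mul (hy.rpow_const fun x _ => Or.inr (by linarith))
    have hcmp := image_le_of_liminf_slope_right_lt_deriv_boundary' (f := fun s => -y s)
      (f' := fun s => A * y s ^ (1 - γ)) (a := 0) (b := t)
      (hy.neg.mono Icc_subset_Ici_self) ?_ (B := fun s => -(β s ^ (1 / γ)))
      (B' := fun s => (γ * A + δ) / γ * β s ^ (1 / γ - 1)) ?_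
      (fun s hs => (hBd s hs).continuousAt.continuousWithinAt)
      (fun s hs => (hBd s (Ico_subset_Icc_self hs)).hasDerivWithinAt) ?_ ⟨ht, le_rfl⟩
    · have h1 : β t ^ (1 / γ) ≤ y t := by simpa using hcmp
      calc β t = (β t ^ (1 / γ)) ^ γ := by
            rw [← Real.rpow_mul hpos.le, one_div_mul_cancel hγ.ne', Real.rpow_one]
        _ ≤ y t ^ γ := Real.rpow_le_rpow (Real.rpow_nonneg hpos.le _) h1 hγ.le
    -- The right slopes of -y are bounded by means of A y^(1-γ) over short intervals, hence
    -- asymptotically by its value at s.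
    · intro s hs r hr
      obtain ⟨r', hr1, hr2⟩ := exists_between hr
      have hcw : ContinuousWithinAt (fun x => A * y x ^ (1 - γ)) (Ici s) s :=
        (hycont s hs.1).mono (Ici_subset_Ici.2 hs.1)
      have hev : ∀ᶠ x in 𝓝[≥] s, A * y x ^ (1 - γ) < r' := hcw.eventually (eventually_lt_nhds hr1)
      obtain ⟨z₀, hz₀, hz⟩ := mem_nhdsGE_iff_exists_Icc_subset.1 hev
      refine Eventually.frequently ?_
      filter_upwards [Ioc_mem_nhdsGT hz₀] with z hzm
      have hzs : 0 < z - s := sub_pos.2 hzm.1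
      have hInt : IntervalIntegrable (fun x => A * y x ^ (1 - γ)) volume s z := by
        refine ContinuousOn.intervalIntegrable (hycont.mono ?_)
        rw [uIcc_of_le hzm.1.le]
        exact fun x hx => hs.1.trans hx.1
      have h1 : ∫ x in s..z, A * y x ^ (1 - γ) ≤ ∫ _ in s..z, r' := by
        refine intervalIntegral.integral_mono_on hzm.1.le hInt intervalIntegrable_const fun x hx => ?_
        exact le_of_lt (hz ⟨hx.1, hx.2.trans hzm.2⟩)
      rw [intervalIntegral.integral_const, smul_eq_mul] at h1
      have h2 := h s z hs.1 hzm.1.le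
      rw [slope_def_field, div_lt_iff₀ hzs]
      have h3 : r' * (z - s) < r * (z - s) := mul_lt_mul_of_pos_right hr2 hzs
      linarith
    · simp only [hβ, mul_zero, sub_zero]
      rw [← Real.rpow_mul (hy0 0 le_rfl), mul_one_div_cancel hγ.ne', Real.rpow_one]
    · intro s hs hEq
      have hb := hβpos s (Ico_subset_Icc_self hs)
      have h1 : y s = β s ^ (1 / γ) := by simpa using hEq
      have h2 : y s ^ (1 - γ) = β s ^ (1 / γ - 1) := by
        rw [h1, ← Real.rpow_mul hb.le]
        congr 1
        field_simp
      simp only [h2]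
      refine mul_lt_mul_of_pos_right ?_ (Real.rpow_pos_of_pos hb _)
      rw [lt_div_iff₀ hγ]
      linarith
  have hlim : Tendsto (fun δ : ℝ => y 0 ^ γ - (γ * A + δ) * t) (𝓝[>] 0)
      (𝓝 (y 0 ^ γ - (γ * A + 0) * t)) := by
    refine Tendsto.mono_left ?_ nhdsWithin_le_nhds
    exact Continuous.tendsto (by fun_prop) 0
  rw [add_zero] at hlim
  exact le_of_tendsto hlim (eventually_mem_nhdsWithin.mono key)

/-! ### Changing the power in the lower bound -/

/-- Bernoulli's inequality with the exponent p/p₀ ≥ 1, applied to (b/a)^p₀. -/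
theorem rpow_sub_rpow_le {a b p p₀ : ℝ} (ha : 0 ≤ a) (hb : 0 ≤ b) (hp₀ : 0 < p₀) (hp : p₀ ≤ p) :
    a ^ p - b ^ p ≤ p / p₀ * a ^ (p - p₀) * (a ^ p₀ - b ^ p₀) := by
  have hp0 : 0 < p := hp₀.trans_le hp
  rcases ha.eq_or_lt with rfl | ha
  · rw [Real.zero_rpow hp0.ne', Real.zero_rpow hp₀.ne']
    rcases hp.eq_or_lt with rfl | hlt
    · simp [hp₀.ne']
    · rw [Real.zero_rpow (sub_pos.2 hlt).ne']
      have := Real.rpow_nonneg hb p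
      simpa using this
  have h1 := one_add_mul_self_le_rpow_one_add (s := (b / a) ^ p₀ - 1) (p := p / p₀)
    (by linarith [Real.rpow_nonneg (div_nonneg hb ha.le) p₀]) ((one_le_div hp₀).2 hp)
  rw [add_sub_cancel, ← Real.rpow_mul (div_nonneg hb ha.le), mul_div_cancel₀ _ hp₀.ne',
    Real.div_rpow hb ha.le, Real.div_rpow hb ha.le] at h1
  have hap : 0 < a ^ p := Real.rpow_pos_of_pos ha p
  have hap₀ : 0 < a ^ p₀ := Real.rpow_pos_of_pos ha p₀
  have h2 := mul_le_mul_of_nonneg_left h1 hap.le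
  rw [mul_div_cancel₀ _ hap.ne'] at h2
  rw [Real.rpow_sub ha]
  have h3 : p / p₀ * (a ^ p / a ^ p₀) * (a ^ p₀ - b ^ p₀)
      = -(a ^ p * (p / p₀ * (b ^ p₀ / a ^ p₀ - 1))) := by
    field_simp
    ring
  rw [h3]
  linarith

/-- The lower bound with exponent `p₀` implies the one with any larger exponent. -/
theorem max_rpow_le_of_rpow_sub_le {a b e c M p p₀ : ℝ} (ha : 0 ≤ a) (hb : 0 ≤ b) (he : 0 ≤ e)
    (hc : 0 ≤ c) (hM : 0 ≤ M) (hp₀ : 0 < p₀) (hp : p₀ ≤ p) (hae : a ≤ c * e)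
    (h : a ^ p₀ - p₀ * M * e ^ p₀ ≤ b ^ p₀) :
    (max (a ^ p - p * (c ^ (p - p₀) * M) * e ^ p) 0) ^ (1 / p) ≤ b := by
  have hp0 : 0 < p := hp₀.trans_le hp
  have hmain : a ^ p - p * (c ^ (p - p₀) * M) * e ^ p ≤ b ^ p := by
    have h1 := rpow_sub_rpow_le ha hb hp₀ hp
    -- The surplus power of a is paid with a ≤ c e; this is the origin of the factor c^(p - p₀) and
    -- of the missing power of e.
    have h2 : a ^ (p - p₀) ≤ c ^ (p - p₀) * e ^ (p - p₀) := by
      rw [← Real.mul_rpow hc he]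
      exact Real.rpow_le_rpow ha hae (by linarith)
    have h3 : e ^ (p - p₀) * e ^ p₀ = e ^ p := by
      rw [← Real.rpow_add_of_nonneg he (by linarith) hp₀.le, sub_add_cancel]
    have h4 : p / p₀ * a ^ (p - p₀) * (a ^ p₀ - b ^ p₀)
        ≤ p / p₀ * (c ^ (p - p₀) * e ^ (p - p₀)) * (p₀ * M * e ^ p₀) := by
      have h5 : a ^ p₀ - b ^ p₀ ≤ p₀ * M * e ^ p₀ := by linarith
      calc _ ≤ p / p₀ * a ^ (p - p₀) * (p₀ * M * e ^ p₀) :=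
            mul_le_mul_of_nonneg_left h5 (mul_nonneg (by positivity) (Real.rpow_nonneg ha _))
        _ ≤ _ := by
            refine mul_le_mul_of_nonneg_right (mul_le_mul_of_nonneg_left h2 (by positivity)) ?_
            positivity
    have h6 : p / p₀ * (c ^ (p - p₀) * e ^ (p - p₀)) * (p₀ * M * e ^ p₀)
        = p * (c ^ (p - p₀) * M) * e ^ p := by
      rw [← h3]
      field_simp
    linarith
  calc _ ≤ (b ^ p) ^ (1 / p) :=
        Real.rpow_le_rpow (le_max_right _ _) (max_le hmain (Real.rpow_nonneg hb p)) (by positivity)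
    _ = b := by rw [← Real.rpow_mul hb, mul_one_div_cancel hp0.ne', Real.rpow_one]

end VectorMixing

open scoped ComplexConjugate

namespace VectorMixing

variable {d : ℕ} {L : ℝ} [hL : Fact (0 < L)]

/-! ### Fourier series in `L²` -/

/-- The normalized character as an element of `L²`. -/
noncomputable def characterLp (L : ℝ) [Fact (0 < L)] (k : Fin d → ℤ) :
    Lp ℂ 2 (volume : Measure (Torus d L)) :=
  (((√(L ^ d))⁻¹ : ℝ) : ℂ) • ContinuousMap.toLp 2 volume ℂ ⟨character k, continuous_character k⟩

theorem inner_characterLp (k : Fin d → ℤ) (F : Lp ℂ 2 (volume : Measure (Torus d L))) :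
    inner ℂ (characterLp L k) F = ((√(L ^ d) : ℝ) : ℂ) * scalarCoeff F k := by
  have hLd : 0 < L ^ d := torus_volume_pos
  have hs : √(L ^ d) ≠ 0 := (Real.sqrt_pos.2 hLd).ne'
  have h1 : inner ℂ (ContinuousMap.toLp 2 volume ℂ
      (⟨character k, continuous_character k⟩ : C(Torus d L, ℂ))) F
      = ∫ x, F x * character (-k) x := by
    rw [L2.inner_def]
    refine integral_congr_ae ?_
    filter_upwards [ContinuousMap.coeFn_toLp (p := 2) (𝕜 := ℂ) volume
      (⟨character k, continuous_character k⟩ : C(Torus d L, ℂ))] with x hx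
    rw [hx, RCLike.inner_apply, character_neg]
    rfl
  rw [characterLp, inner_smul_left, h1, Complex.conj_ofReal, scalarCoeff, ← mul_assoc,
    ← Complex.ofReal_mul]
  congr 2
  have := Real.mul_self_sqrt hLd.le
  field_simp
  nlinarith

theorem orthonormal_characterLp :
    Orthonormal ℂ (characterLp L : (Fin d → ℤ) → Lp ℂ 2 (volume : Measure (Torus d L))) := by
  classical
  rw [orthonormal_iff_ite]
  intro k l
  have hLd : 0 < L ^ d := torus_volume_pos
  have hs : √(L ^ d) ≠ 0 := (Real.sqrt_pos.2 hLd).ne'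
  rw [inner_characterLp, scalarCoeff]
  have h1 : ∫ x, (characterLp L l : Lp ℂ 2 (volume : Measure (Torus d L))) x * character (-k) x
      = (((√(L ^ d))⁻¹ : ℝ) : ℂ) * ∫ x : Torus d L, character (l - k) x := by
    rw [← integral_const_mul]
    refine integral_congr_ae ?_
    filter_upwards [ContinuousMap.coeFn_toLp (p := 2) (𝕜 := ℂ) volume
      (⟨character l, continuous_character l⟩ : C(Torus d L, ℂ)),
      Lp.coeFn_smul (((√(L ^ d))⁻¹ : ℝ) : ℂ) (ContinuousMap.toLp 2 volume ℂ
        (⟨character l, continuous_character l⟩ : C(Torus d L, ℂ)))] with x hx hx2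
    rw [characterLp, hx2, Pi.smul_apply, hx, smul_eq_mul, sub_eq_add_neg, character_add, mul_assoc]
    rfl
  rw [h1, integral_character]
  have h2 : (l - k = 0) ↔ k = l := by rw [sub_eq_zero, eq_comm]
  simp only [h2]
  split_ifs
  · have := Real.mul_self_sqrt hLd.le
    rw [← Complex.ofReal_mul, ← Complex.ofReal_mul, ← Complex.ofReal_mul, ← Complex.ofReal_one]
    congr 1
    field_simp
  · simp

theorem integral_norm_sq_eq {E : Type*} [NormedAddCommGroup E] {f : Torus d L → E}
    (hf : MemLp f 2 volume) : (eLpNorm f 2 volume).toReal ^ 2 = ∫ x, ‖f x‖ ^ 2 := by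
  have h0 : 0 ≤ ∫ x, ‖f x‖ ^ (2 : ℝ) := integral_nonneg fun x => by positivity
  have h := hf.eLpNorm_eq_integral_rpow_norm two_ne_zero ENNReal.ofNat_ne_top
  simp only [ENNReal.toReal_ofNat] at h
  rw [h, ENNReal.toReal_ofReal (Real.rpow_nonneg h0 _), ← Real.rpow_natCast, ← Real.rpow_mul h0]
  simp

theorem sum_norm_sq_scalarCoeff_le {f : Torus d L → ℂ} (hf : MemLp f 2 volume)
    (K : Finset (Fin d → ℤ)) :
    L ^ d * ∑ k ∈ K, ‖scalarCoeff f k‖ ^ 2 ≤ ∫ x, ‖f x‖ ^ 2 := by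
  have h := orthonormal_characterLp.sum_inner_products_le (hf.toLp f) (s := K)
  rw [Lp.norm_toLp, integral_norm_sq_eq hf] at h
  refine le_trans (le_of_eq ?_) h
  rw [Finset.mul_sum]
  refine Finset.sum_congr rfl fun k _ => ?_
  have h1 : scalarCoeff (hf.toLp f) k = scalarCoeff f k := by
    rw [scalarCoeff, scalarCoeff]
    congr 1
    refine integral_congr_ae ?_
    filter_upwards [hf.coeFn_toLp] with x hx
    rw [hx]
  rw [inner_characterLp, h1, norm_mul, mul_pow, Complex.norm_real, Real.norm_eq_abs, sq_abs,
    Real.sq_sqrt torus_volume_pos.le]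

theorem memLp_coe_apply {n : Type*} [Fintype n] {f : Torus d L → EuclideanSpace ℝ n} {p : ℝ≥0∞}
    (hf : MemLp f p volume) (i : n) : MemLp (fun x => (f x i : ℂ)) p volume := by
  refine hf.of_le ?_ (Eventually.of_forall fun x => ?_)
  · exact (Complex.continuous_ofReal.comp
      (EuclideanSpace.proj (𝕜 := ℝ) i : EuclideanSpace ℝ n →L[ℝ] ℝ).continuous).comp_aestronglyMeasurable
      hf.aestronglyMeasurable
  · rw [Complex.norm_real]
    exact PiLp.norm_apply_le (f x) i

/-- Bessel's inequality for vector fields. -/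
theorem sum_norm_sq_fourierCoeffVec_le {f : Torus d L → Vec d} (hf : MemLp f 2 volume)
    (K : Finset (Fin d → ℤ)) :
    L ^ d * ∑ k ∈ K, ∑ i, ‖fourierCoeffVec f k i‖ ^ 2 ≤ l2Norm f ^ 2 := by
  have hi := fun i => memLp_coe_apply hf i
  rw [l2Norm, integral_norm_sq_eq hf]
  have h1 : ∀ x, ‖f x‖ ^ 2 = ∑ i, ‖(f x i : ℂ)‖ ^ 2 := fun x => by
    rw [EuclideanSpace.norm_sq_eq]
    simp
  simp only [h1]
  rw [integral_finsetSum _ fun i _ => (hi i).integrable_norm_pow two_ne_zero, Finset.sum_comm,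
    Finset.mul_sum]
  exact Finset.sum_le_sum fun i _ => sum_norm_sq_scalarCoeff_le (hi i) K

/-- The Riesz–Fischer theorem. -/
theorem exists_memLp_scalarCoeff_eq {c : (Fin d → ℤ) → ℂ} (hc : Summable fun k => ‖c k‖ ^ 2) :
    ∃ f : Torus d L → ℂ, MemLp f 2 volume ∧ ∀ k, scalarCoeff f k = c k := by
  have hLd : 0 < L ^ d := torus_volume_pos
  have hs : √(L ^ d) ≠ 0 := (Real.sqrt_pos.2 hLd).ne'
  have hmem : Memℓp (fun k => ((√(L ^ d) : ℝ) : ℂ) * c k) 2 := by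
    refine memℓp_gen ?_
    simp only [ENNReal.toReal_ofNat, norm_mul]
    refine (hc.mul_left (L ^ d)).congr fun k => ?_
    rw [Real.rpow_ofNat, mul_pow, Complex.norm_real, Real.norm_eq_abs, sq_abs, Real.sq_sqrt hLd.le]
  set C : lp (fun _ : Fin d → ℤ => ℂ) 2 := ⟨_, hmem⟩ with hC
  have hV := (orthonormal_characterLp (d := d) (L := L)).orthogonalFamily
  -- Only orthonormality is used: F is the image of the sequence under the isometry from ℓ².
  -- Completeness of the characters plays no role.
  set F := hV.linearIsometry C with hF
  refine ⟨F, Lp.memLp F, fun k => ?_⟩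
  have h1 : inner ℂ (characterLp L k) F = ((√(L ^ d) : ℝ) : ℂ) * c k := by
    have h2 := hV.hasSum_linearIsometry C
    have h3 := (innerSL ℂ (characterLp L k)).hasSum h2
    have h4 : HasSum (fun l => inner ℂ (characterLp L k)
        (C l • (characterLp L l : Lp ℂ 2 (volume : Measure (Torus d L)))))
        (inner ℂ (characterLp L k) F) := h3
    refine h4.unique ?_
    have h5 : ∀ l, l ≠ k → inner ℂ (characterLp L k)
        (C l • (characterLp L l : Lp ℂ 2 (volume : Measure (Torus d L)))) = 0 := by
      intro l hl
      rw [inner_smul_right, orthonormal_characterLp.2 hl.symm, mul_zero]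
    have h6 := hasSum_single k h5
    have h7 : inner ℂ (characterLp L k) (characterLp L k : Lp ℂ 2 (volume : Measure (Torus d L))) = 1 := by
      rw [inner_self_eq_norm_sq_to_K, orthonormal_characterLp.1 k]
      simp
    rw [inner_smul_right, h7, mul_one] at h6
    exact h6
  rw [inner_characterLp] at h1
  exact mul_left_cancel₀ (by exact_mod_cast hs) h1

theorem integrable_of_memLp_two {E : Type*} [NormedAddCommGroup E] {f : Torus d L → E}
    (hf : MemLp f 2 volume) : Integrable f volume :=
  hf.integrable one_le_two

/-- The Riesz–Fischer theorem for real vector fields. -/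
theorem exists_memLp_fourierCoeffVec_eq {c : (Fin d → ℤ) → Fin d → ℂ}
    (hc : ∀ i, Summable fun k => ‖c k i‖ ^ 2) (hconj : ∀ k i, c (-k) i = conj (c k i)) :
    ∃ f : Torus d L → Vec d, MemLp f 2 volume ∧ ∀ k i, fourierCoeffVec f k i = c k i := by
  choose F hF hFc using fun i => exists_memLp_scalarCoeff_eq (L := L) (hc i)
  refine ⟨fun x => WithLp.toLp 2 fun i => (F i x).re, ?_, fun k i => ?_⟩
  · exact MemLp.of_eval_piLp fun i => (hF i).re
  · have hInt := integrable_of_memLp_two (hF i)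
    -- By the Hermitian symmetry F_i and its conjugate have the same coefficients, so the real part
    -- has them too.
    have hconjF : scalarCoeff (fun x => conj (F i x)) k = c k i := by
      have h1 : scalarCoeff (fun x => conj (F i x)) k = conj (scalarCoeff (F i) (-k)) := by
        simp only [scalarCoeff, map_mul, Complex.conj_ofReal, ← integral_conj, character_neg,
          Complex.conj_conj]
      rw [h1, hFc, hconj, Complex.conj_conj]
    have h2 : ∀ x, (((F i x).re : ℝ) : ℂ) = (1 / 2 : ℂ) * (F i x + conj (F i x)) := fun x => by
      rw [Complex.add_conj]
      push_cast
      ring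
    have hconjI : Integrable (fun x => conj (F i x)) volume :=
      (Complex.conjCLE : ℂ →L[ℝ] ℂ).integrable_comp hInt
    rw [fourierCoeffVec_eq_scalarCoeff]
    have h3 : scalarCoeff (fun x => (((F i x).re : ℝ) : ℂ)) k
        = (1 / 2 : ℂ) * (scalarCoeff (F i) k + scalarCoeff (fun x => conj (F i x)) k) := by
      simp only [scalarCoeff, h2]
      rw [← mul_add, ← integral_add (integrable_mul_character hInt _)
        (integrable_mul_character hconjI _), mul_left_comm, ← integral_const_mul (1 / 2 : ℂ)]
      congr 2
      funext x
      ring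
    change scalarCoeff (fun x => (((F i x).re : ℝ) : ℂ)) k = c k i
    rw [h3, hFc, hconjF]
    ring

end VectorMixing

open scoped ComplexConjugate

namespace VectorMixing

variable {d : ℕ} {L : ℝ} [hL : Fact (0 < L)]

/-! ### Trigonometric polynomials are determined by their values -/

theorem eq_of_trigPoly_eq {K : Finset (Fin d → ℤ)} {a b : (Fin d → ℤ) → ℂ}
    (h : ∀ x : Torus d L, trigPoly K a x = trigPoly K b x) {k : Fin d → ℤ} (hk : k ∈ K) :
    a k = b k := by
  have h1 := scalarCoeff_trigPoly (L := L) K a k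
  have h2 := scalarCoeff_trigPoly (L := L) K b k
  rw [if_pos hk] at h1 h2
  rw [← h1, ← h2, funext h]

/-- The coefficients of a trigonometric polynomial depend continuously on its values. -/
theorem continuousOn_coeff_of_trigPoly {K : Finset (Fin d → ℤ)} {a : ℝ → (Fin d → ℤ) → ℂ}
    {S : Set ℝ} (h : ∀ x : Torus d L, ContinuousOn (fun t => trigPoly K (a t) x) S)
    {k : Fin d → ℤ} (hk : k ∈ K) : ContinuousOn (fun t => a t k) S := by
  classical
  -- An injective linear map from a finite-dimensional space into the functions with pointwise
  -- convergence is a closed embedding, so continuity at every point x already gives continuity of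
  -- the coefficients.
  let T : (K → ℂ) →ₗ[ℂ] (Torus d L → ℂ) :=
    { toFun := fun b x => ∑ k : K, b k * character k.1 x
      map_add' := fun b c => by
        funext x
        simp [add_mul, Finset.sum_add_distrib]
      map_smul' := fun c b => by
        funext x
        simp [Finset.mul_sum, mul_assoc] }
  have hT : ∀ (b : (Fin d → ℤ) → ℂ) (x : Torus d L), T (fun k => b k.1) x = trigPoly K b x :=
    fun b x => Finset.sum_coe_sort K fun k => b k * character k x
  have hker : LinearMap.ker T = ⊥ := by
    rw [LinearMap.ker_eq_bot']
    intro b hb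
    set b' : (Fin d → ℤ) → ℂ := fun k => if hk : k ∈ K then b ⟨k, hk⟩ else 0 with hb'
    have hbb : b = fun k : K => b' k.1 := by
      funext k
      simp [hb']
    have h1 : ∀ x : Torus d L, trigPoly K b' x = trigPoly K 0 x := by
      intro x
      rw [← hT, ← hbb, hb]
      simp [trigPoly]
    rw [hbb]
    funext k
    exact eq_of_trigPoly_eq h1 k.2
  have hemb := LinearMap.isClosedEmbedding_of_injective hker
  have hcont : ContinuousOn (fun t => (fun k : K => a t k.1)) S := by
    rw [hemb.isInducing.continuousOn_iff]
    refine continuousOn_pi.2 fun x => ?_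
    refine (h x).congr fun t _ => ?_
    exact hT (a t) x
  exact (continuousOn_pi.1 hcont) ⟨k, hk⟩

/-! ### The coefficients of the transport term -/

theorem mulCoeff_truncComp (N : ℕ) (U : Torus d L → Vec d) (j : Fin d) (l k : Fin d → ℤ) :
    mulCoeff (truncComp N U j) l k
      = if k - l ∈ freqBox d N then ((L ^ d : ℝ) : ℂ) * fourierCoeffVec U (k - l) j else 0 := by
  have h := integral_trigPoly_mul_character (L := L) (freqBox d N) (fun k => fourierCoeffVec U k j)
    (k - l)
  rw [mulCoeff_eq_integral, ← h, neg_sub]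
  refine integral_congr_ae (Eventually.of_forall fun x => ?_)
  simp only [truncComp, coe_truncate_apply]

theorem fourierCoeffVec_advect {N : ℕ} {f : Torus d L → Vec d} (hf : f = truncate N f)
    (U : Torus d L → Vec d) (k : Fin d → ℤ) (i : Fin d) :
    fourierCoeffVec (advect (truncate N U) f) k i
      = ((L ^ d)⁻¹ : ℝ) * ∑ l ∈ freqBox d N,
        fourierCoeffVec f l i * transportCoeff (truncComp N U) l k := by
  rw [fourierCoeffVec]
  congr 1
  have h1 : ∀ x, ((advect (truncate N U) f x i : ℝ) : ℂ) * character (-k) x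
      = ∑ l ∈ freqBox d N, ∑ j, fourierCoeffVec f l i * (derivSymbol L j l *
        ((truncComp N U j x : ℂ) * character l x * conj (character k x))) := by
    intro x
    have h2 : ∀ j, ((partialDeriv j (fun y => f y i) x : ℝ) : ℂ)
        = trigPoly (freqBox d N) (fun k => derivSymbol L j k * fourierCoeffVec f k i) x := by
      intro j
      rw [← coe_partialDeriv_truncate, ← hf]
    simp only [advect, Complex.ofReal_sum, Complex.ofReal_mul, h2, trigPoly, Finset.sum_mul,
      Finset.mul_sum]
    rw [Finset.sum_comm]
    refine Finset.sum_congr rfl fun l _ => Finset.sum_congr rfl fun j _ => ?_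
    rw [character_neg, truncComp]
    ring
  simp only [h1]
  rw [integral_finsetSum _ fun l _ => integrable_finsetSum _ fun j _ =>
    integrable_of_continuous (by fun_prop)]
  refine Finset.sum_congr rfl fun l _ => ?_
  rw [integral_finsetSum _ fun j _ => integrable_of_continuous (by fun_prop), transportCoeff,
    Finset.mul_sum]
  refine Finset.sum_congr rfl fun j _ => ?_
  rw [integral_const_mul, integral_const_mul, mulCoeff]

theorem norm_fourierCoeffVec_le_l2Norm {f : Torus d L → Vec d} (hf : MemLp f 2 volume)
    (k : Fin d → ℤ) (i : Fin d) : ‖fourierCoeffVec f k i‖ ≤ l2Norm f / √(L ^ d) := by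
  have hLd : 0 < L ^ d := torus_volume_pos
  have h := sum_norm_sq_fourierCoeffVec_le hf {k}
  rw [Finset.sum_singleton] at h
  rw [le_div_iff₀ (Real.sqrt_pos.2 hLd)]
  refine abs_le_of_sq_le_sq' ?_ ENNReal.toReal_nonneg |>.2
  rw [mul_pow, Real.sq_sqrt hLd.le, mul_comm]
  refine le_trans ?_ h
  exact mul_le_mul_of_nonneg_left (Finset.single_le_sum
    (f := fun i => ‖fourierCoeffVec f k i‖ ^ 2) (fun _ _ => by positivity) (Finset.mem_univ i)) hLd.le

/-- The transport term is bounded mode by mode, uniformly in the truncation. -/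
theorem norm_fourierCoeffVec_advect_le {N : ℕ} {f U : Torus d L → Vec d} (hf : f = truncate N f)
    (hdiv : IsDivFree U) (hU : MemLp U 2 volume) (k : Fin d → ℤ) (i : Fin d) :
    ‖fourierCoeffVec (advect (truncate N U) f) k i‖
      ≤ (∑ j, ‖derivSymbol L j k‖) *
        (l2Coeff (freqBox d N) (fun l => fourierCoeffVec f l i) * (l2Norm U / √(L ^ d))) := by
  classical
  have hLd : 0 < L ^ d := torus_volume_pos
  have hdf := fourierDivFree_truncComp hdiv (integrable_of_memLp_two hU) N
  set c : Fin d → (Fin d → ℤ) → ℂ := fun j l =>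
    if k - l ∈ freqBox d N then fourierCoeffVec U (k - l) j else 0 with hc
  -- The derivative is placed on the output mode k by incompressibility; otherwise frequencies up to
  -- N would enter the bound.
  have h1 : fourierCoeffVec (advect (truncate N U) f) k i
      = ∑ j, derivSymbol L j k * ∑ l ∈ freqBox d N, fourierCoeffVec f l i * c j l := by
    rw [fourierCoeffVec_advect hf]
    simp only [transportCoeff_eq_right hdf, mulCoeff_truncComp, Finset.mul_sum]
    rw [Finset.sum_comm]
    refine Finset.sum_congr rfl fun j _ => Finset.sum_congr rfl fun l _ => ?_
    simp only [hc]
    split_ifs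
    · calc _ = ((L ^ d)⁻¹ : ℝ) * (((L ^ d : ℝ) : ℂ) *
            (derivSymbol L j k * (fourierCoeffVec f l i * fourierCoeffVec U (k - l) j))) := by ring
        _ = _ := coe_inv_mul_cancel _
    · simp
  have h2 : ∀ j, l2Coeff (freqBox d N) (c j) ≤ l2Norm U / √(L ^ d) := by
    intro j
    have hb := sum_norm_sq_fourierCoeffVec_le hU ((freqBox d N).image fun l => k - l)
    rw [Finset.sum_image fun l _ l' _ h => by simpa using h] at hb
    rw [le_div_iff₀ (Real.sqrt_pos.2 hLd)]
    refine abs_le_of_sq_le_sq' ?_ ENNReal.toReal_nonneg |>.2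
    rw [mul_pow, Real.sq_sqrt hLd.le, mul_comm, sq_l2Coeff]
    refine le_trans (mul_le_mul_of_nonneg_left (Finset.sum_le_sum fun l _ => ?_) hLd.le) hb
    simp only [hc]
    split_ifs
    · exact Finset.single_le_sum (f := fun j => ‖fourierCoeffVec U (k - l) j‖ ^ 2)
        (fun _ _ => by positivity) (Finset.mem_univ j)
    · rw [norm_zero, zero_pow two_ne_zero]
      positivity
  rw [h1, Finset.sum_mul]
  refine (norm_sum_le _ _).trans (Finset.sum_le_sum fun j _ => ?_)
  rw [norm_mul]
  refine mul_le_mul_of_nonneg_left ?_ (norm_nonneg _)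
  refine (norm_sum_le _ _).trans ?_
  simp only [norm_mul]
  refine (Real.sum_mul_le_sqrt_mul_sqrt _ _ _).trans ?_
  exact mul_le_mul_of_nonneg_left (h2 j) (l2Coeff_nonneg _ _)

theorem norm_lerayCoeff_le (f : Torus d L → Vec d) (k : Fin d → ℤ) (i : Fin d) :
    ‖lerayCoeff f k i‖ ≤ 2 * ∑ j, ‖fourierCoeffVec f k j‖ := by
  have h1 : ‖fourierCoeffVec f k i‖ ≤ ∑ j, ‖fourierCoeffVec f k j‖ :=
    Finset.single_le_sum (f := fun j => ‖fourierCoeffVec f k j‖) (fun _ _ => norm_nonneg _)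
      (Finset.mem_univ i)
  have hk : ∀ j, |(k j : ℝ)| ≤ freqNorm k := fun j => by
    refine abs_le_of_sq_le_sq (le_of_le_of_eq ?_ (freqNorm_sq k).symm) (Real.sqrt_nonneg _)
    exact Finset.single_le_sum (f := fun j => (k j : ℝ) ^ 2) (fun _ _ => sq_nonneg _)
      (Finset.mem_univ j)
  have h2 : ‖(∑ j, fourierCoeffVec f k j * (k j : ℂ)) / ((freqNorm k ^ 2 : ℝ) : ℂ) * (k i : ℂ)‖
      ≤ ∑ j, ‖fourierCoeffVec f k j‖ := by
    rw [norm_mul, norm_div, Complex.norm_real, Real.norm_of_nonneg (sq_nonneg _),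
      Complex.norm_intCast, div_mul_eq_mul_div]
    -- This form of the division lemma also covers k = 0, where the quotient is zero by convention.
    refine div_le_of_le_mul₀ (sq_nonneg _) (by positivity) ?_
    have h3 : ‖∑ j, fourierCoeffVec f k j * (k j : ℂ)‖
        ≤ (∑ j, ‖fourierCoeffVec f k j‖) * freqNorm k := by
      rw [Finset.sum_mul]
      refine (norm_sum_le _ _).trans (Finset.sum_le_sum fun j _ => ?_)
      rw [norm_mul, Complex.norm_intCast]
      exact mul_le_mul_of_nonneg_left (hk j) (norm_nonneg _)
    calc _ ≤ (∑ j, ‖fourierCoeffVec f k j‖) * freqNorm k * freqNorm k :=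
          mul_le_mul h3 (hk i) (abs_nonneg _)
            (mul_nonneg (Finset.sum_nonneg fun _ _ => norm_nonneg _) (Real.sqrt_nonneg _))
      _ = _ := by ring
  rw [lerayCoeff]
  refine (norm_sub_le _ _).trans ?_
  linarith

end VectorMixing

open scoped ComplexConjugate

namespace VectorMixing

variable {d : ℕ} {L : ℝ} [hL : Fact (0 < L)]

/-! ### Admissible velocities -/

theorem ae_restrict_of_ae_timeMeasure {P : ℝ → Prop} (h : ∀ᵐ s ∂timeMeasure, P s) {τ : ℝ}
    (hτ : 0 ≤ τ) (t : ℝ) : ∀ᵐ s ∂volume.restrict (Ioc τ t), P s :=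
  ae_mono (Measure.restrict_mono (fun _ hx => hτ.trans_lt hx.1) le_rfl) h

theorem aestronglyMeasurable_fourierCoeffVec {U : ℝ → Torus d L → Vec d}
    (hU : AEStronglyMeasurable (fun p : ℝ × Torus d L => U p.1 p.2) (timeMeasure.prod volume))
    (k : Fin d → ℤ) (i : Fin d) :
    AEStronglyMeasurable (fun s => fourierCoeffVec (U s) k i) timeMeasure := by
  have : SFinite timeMeasure := by unfold timeMeasure; infer_instance
  unfold fourierCoeffVec
  refine AEStronglyMeasurable.const_mul ?_ _
  have h1 : AEStronglyMeasurable (fun p : ℝ × Torus d L => ((U p.1 p.2 i : ℝ) : ℂ))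
      (timeMeasure.prod volume) :=
    (Complex.continuous_ofReal.comp
      (EuclideanSpace.proj (𝕜 := ℝ) i : Vec d →L[ℝ] ℝ).continuous).comp_aestronglyMeasurable hU
  have h2 : Continuous fun p : ℝ × Torus d L => (character (-k) p.2 : ℂ) := by fun_prop
  exact (h1.mul h2.aestronglyMeasurable).integral_prod_right'

/-- The torus has finite volume. With q ≥ 2 the velocity lies in L², where Bessel's inequality is
available. -/
theorem IsAdmissibleVelocity.exists_l2Norm_le {q : ℝ} {U : ℝ → Torus d L → Vec d}
    {G : ℝ → Torus d L → Mat d} (hU : IsAdmissibleVelocity q U G) (hq : 2 ≤ q) :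
    ∃ K : ℝ, 0 ≤ K ∧ ∀ᵐ s ∂timeMeasure, MemLp (U s) 2 volume ∧ l2Norm (U s) ≤ K := by
  obtain ⟨K, hK⟩ := hU.bound
  have hq2 : (2 : ℝ≥0∞) ≤ ENNReal.ofReal q := by
    rw [← ENNReal.ofReal_ofNat]
    exact ENNReal.ofReal_le_ofReal hq
  set c : ℝ≥0∞ := K * (volume (univ : Set (Torus d L))) ^
    (1 / (2 : ℝ≥0∞).toReal - 1 / (ENNReal.ofReal q).toReal) with hc
  have hct : c ≠ ⊤ := by
    refine ENNReal.mul_ne_top ENNReal.coe_ne_top (ENNReal.rpow_ne_top_of_nonneg ?_ (measure_ne_top _ _))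
    rw [ENNReal.toReal_ofReal (by linarith), ENNReal.toReal_ofNat, sub_nonneg]
    exact one_div_le_one_div_of_le two_pos hq
  refine ⟨c.toReal, ENNReal.toReal_nonneg, ?_⟩
  filter_upwards [hK] with s hs
  refine ⟨hs.1.mono_exponent hq2, ENNReal.toReal_mono hct ?_⟩
  refine (eLpNorm_le_eLpNorm_mul_rpow_measure_univ hq2 hs.1.aestronglyMeasurable).trans ?_
  exact mul_le_mul_left (le_self_add.trans hs.2.2) _

/-! ### The coefficients of a spectral solution -/

/-- The Fourier coefficients of the transport term in the spectral approximation. -/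
noncomputable def rateCoeff (N : ℕ) (U v : ℝ → Torus d L → Vec d) (k : Fin d → ℤ) (i : Fin d)
    (s : ℝ) : ℂ :=
  lerayCoeff (advect (truncate N (U s)) (v s)) k i

namespace IsSpectralSolution

variable {N : ℕ} {U v : ℝ → Torus d L → Vec d} {u₀ : Torus d L → Vec d}

theorem coe_apply (hv : IsSpectralSolution N U u₀ v) {t : ℝ} (ht : 0 ≤ t) (x : Torus d L)
    (i : Fin d) :
    ((v t x i : ℝ) : ℂ) = trigPoly (freqBox d N) (fun k => fourierCoeffVec (v t) k i) x := by
  rw [← coe_truncate_apply, ← hv.modes t ht]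

theorem fourierCoeffVec_eq_zero (hv : IsSpectralSolution N U u₀ v) {t : ℝ} (ht : 0 ≤ t)
    {k : Fin d → ℤ} (hk : k ∉ freqBox d N) (i : Fin d) : fourierCoeffVec (v t) k i = 0 := by
  have h := scalarCoeff_trigPoly (L := L) (freqBox d N) (fun k => fourierCoeffVec (v t) k i) k
  rw [if_neg hk] at h
  rw [fourierCoeffVec_eq_scalarCoeff, ← h]
  congr 1
  funext x
  exact hv.coe_apply ht x i

theorem fourierCoeffVec_initial (hv : IsSpectralSolution N U u₀ v) {k : Fin d → ℤ}
    (hk : k ∈ freqBox d N) (i : Fin d) : fourierCoeffVec (v 0) k i = lerayCoeff u₀ k i := by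
  refine eq_of_trigPoly_eq (L := L) (a := fun k => fourierCoeffVec (v 0) k i)
    (b := fun k => lerayCoeff u₀ k i) (fun x => ?_) hk
  rw [← hv.coe_apply le_rfl, ← coe_lerayTruncate_apply, hv.initial]

theorem continuousOn_fourierCoeffVec (hv : IsSpectralSolution N U u₀ v) (k : Fin d → ℤ)
    (i : Fin d) : ContinuousOn (fun t => fourierCoeffVec (v t) k i) (Ici 0) := by
  by_cases hk : k ∈ freqBox d N
  · refine continuousOn_coeff_of_trigPoly (L := L) (K := freqBox d N)
      (a := fun t k => fourierCoeffVec (v t) k i) (fun x => ?_) hk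
    have h1 : ContinuousOn (fun t => ((v t x i : ℝ) : ℂ)) (Ici 0) :=
      (Complex.continuous_ofReal.comp
        (EuclideanSpace.proj (𝕜 := ℝ) i : Vec d →L[ℝ] ℝ).continuous).comp_continuousOn
        (hv.continuous x)
    exact h1.congr fun t ht => (hv.coe_apply ht x i).symm
  · exact continuousOn_const.congr fun t ht => hv.fourierCoeffVec_eq_zero ht hk i

theorem continuousOn_l2Coeff (hv : IsSpectralSolution N U u₀ v) (i : Fin d) :
    ContinuousOn (fun t => l2Coeff (freqBox d N) (fun k => fourierCoeffVec (v t) k i)) (Ici 0) := by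
  unfold l2Coeff
  exact Real.continuous_sqrt.comp_continuousOn (continuousOn_finsetSum _ fun k _ =>
    (hv.continuousOn_fourierCoeffVec k i).norm.pow 2)

/-- The rate is a finite expression in the Fourier coefficients of the velocity and of the solution,
whose dependence on time is measurable and continuous respectively. -/
theorem aestronglyMeasurable_rateCoeff (hv : IsSpectralSolution N U u₀ v)
    (hU : AEStronglyMeasurable (fun p : ℝ × Torus d L => U p.1 p.2) (timeMeasure.prod volume))
    (k : Fin d → ℤ) (i : Fin d) :
    AEStronglyMeasurable (rateCoeff N U v k i) timeMeasure := by
  have hb : ∀ j, AEStronglyMeasurable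
      (fun s => fourierCoeffVec (advect (truncate N (U s)) (v s)) k j) timeMeasure := by
    intro j
    have h1 : AEStronglyMeasurable (fun s => (((L ^ d)⁻¹ : ℝ) : ℂ) * ∑ l ∈ freqBox d N,
        fourierCoeffVec (v s) l j * ∑ m, derivSymbol L m l * (if k - l ∈ freqBox d N then
          ((L ^ d : ℝ) : ℂ) * fourierCoeffVec (U s) (k - l) m else 0)) timeMeasure := by
      refine AEStronglyMeasurable.const_mul ?_ _
      refine Finset.aestronglyMeasurable_fun_sum _ fun l _ => AEStronglyMeasurable.mul ?_ ?_
      · exact ((hv.continuousOn_fourierCoeffVec l j).mono Ioi_subset_Ici_self).aestronglyMeasurable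
          measurableSet_Ioi
      · refine Finset.aestronglyMeasurable_fun_sum _ fun m _ => AEStronglyMeasurable.const_mul ?_ _
        split_ifs
        · exact (aestronglyMeasurable_fourierCoeffVec hU _ _).const_mul _
        · exact aestronglyMeasurable_const
    refine h1.congr ?_
    filter_upwards [ae_restrict_mem measurableSet_Ioi] with s hs
    rw [fourierCoeffVec_advect (hv.modes s (le_of_lt hs))]
    simp only [transportCoeff, mulCoeff_truncComp]
  unfold rateCoeff lerayCoeff
  refine (hb i).sub (AEStronglyMeasurable.mul_const ?_ _)
  simp only [div_eq_mul_inv]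
  exact AEStronglyMeasurable.mul_const (Finset.aestronglyMeasurable_fun_sum _ fun j _ =>
    (hb j).mul_const _) _

theorem norm_rateCoeff_le (hv : IsSpectralSolution N U u₀ v) {s e K : ℝ} (hs : 0 ≤ s)
    (hdiv : IsDivFree (U s)) (hU : MemLp (U s) 2 volume) (hK : l2Norm (U s) ≤ K) (he : 0 ≤ e)
    (hE : ∀ j, l2Coeff (freqBox d N) (fun l => fourierCoeffVec (v s) l j) ≤ e)
    (k : Fin d → ℤ) (i : Fin d) :
    ‖rateCoeff N U v k i s‖ ≤ 2 * (d * ((∑ j, ‖derivSymbol L j k‖) * (e * (K / √(L ^ d))))) := by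
  refine (norm_lerayCoeff_le _ k i).trans (mul_le_mul_of_nonneg_left ?_ two_pos.le)
  have h1 : ∀ j ∈ (Finset.univ : Finset (Fin d)),
      ‖fourierCoeffVec (advect (truncate N (U s)) (v s)) k j‖
      ≤ (∑ j, ‖derivSymbol L j k‖) * (e * (K / √(L ^ d))) := by
    intro j _
    refine (norm_fourierCoeffVec_advect_le (hv.modes s hs) hdiv hU k j).trans ?_
    have h0 : 0 ≤ l2Norm (U s) := ENNReal.toReal_nonneg
    gcongr
    exact hE j
  refine (Finset.sum_le_card_nsmul _ _ _ h1).trans (le_of_eq ?_)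
  simp

/-- Energy conservation is not yet available, as it rests on this integrability. Continuity on a
compact time interval supplies the a priori bound instead. -/
theorem intervalIntegrable_rateCoeff {q : ℝ} {G : ℝ → Torus d L → Mat d}
    (hv : IsSpectralSolution N U u₀ v) (hU : IsAdmissibleVelocity q U G) (hq : 2 ≤ q)
    (k : Fin d → ℤ) (i : Fin d) {t : ℝ} (ht : 0 ≤ t) :
    IntervalIntegrable (rateCoeff N U v k i) volume 0 t := by
  obtain ⟨K, hK0, hK⟩ := hU.exists_l2Norm_le hq
  have hcont : ContinuousOn
      (fun t => ∑ j, l2Coeff (freqBox d N) (fun k => fourierCoeffVec (v t) k j)) (Icc 0 t) :=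
    (continuousOn_finsetSum _ fun j _ => hv.continuousOn_l2Coeff j).mono Icc_subset_Ici_self
  obtain ⟨e, he⟩ := isCompact_Icc.exists_bound_of_continuousOn hcont
  have he0 : 0 ≤ e := (norm_nonneg _).trans (he 0 ⟨le_rfl, ht⟩)
  rw [intervalIntegrable_iff_integrableOn_Ioc_of_le ht]
  refine Integrable.of_bound
    ((hv.aestronglyMeasurable_rateCoeff hU.measurable k i).mono_measure
      (Measure.restrict_mono (fun x hx => hx.1) le_rfl))
    (2 * (d * ((∑ j, ‖derivSymbol L j k‖) * (e * (K / √(L ^ d)))))) ?_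
  filter_upwards [ae_restrict_of_ae_timeMeasure hK le_rfl t,
    ae_restrict_of_ae_timeMeasure hU.divFree le_rfl t, ae_restrict_mem measurableSet_Ioc]
    with s hs hdiv hmem
  refine hv.norm_rateCoeff_le hmem.1.le hdiv hs.1 hs.2 he0 (fun j => ?_) k i
  refine le_trans ?_ ((le_abs_self _).trans (he s ⟨hmem.1.le, hmem.2⟩))
  exact Finset.single_le_sum
    (f := fun j => l2Coeff (freqBox d N) (fun k => fourierCoeffVec (v s) k j))
    (fun _ _ => l2Coeff_nonneg _ _) (Finset.mem_univ j)

/-- The evolution of the Fourier coefficients. -/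
theorem fourierCoeffVec_eq_sub_integral {q : ℝ} {G : ℝ → Torus d L → Mat d}
    (hv : IsSpectralSolution N U u₀ v) (hU : IsAdmissibleVelocity q U G) (hq : 2 ≤ q)
    {k : Fin d → ℤ} (hk : k ∈ freqBox d N) (i : Fin d) {t : ℝ} (ht : 0 ≤ t) :
    fourierCoeffVec (v t) k i
      = fourierCoeffVec (v 0) k i - ∫ s in (0 : ℝ)..t, rateCoeff N U v k i s := by
  have hInt := fun k i => hv.intervalIntegrable_rateCoeff hU hq k i ht
  refine eq_of_trigPoly_eq (L := L) (a := fun k => fourierCoeffVec (v t) k i)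
    (b := fun k => fourierCoeffVec (v 0) k i - ∫ s in (0 : ℝ)..t, rateCoeff N U v k i s)
    (fun x => ?_) hk
  have hcoe : ∀ j s, ((lerayTruncate N (advect (truncate N (U s)) (v s)) x j : ℝ) : ℂ)
      = trigPoly (freqBox d N) (fun k => rateCoeff N U v k j s) x :=
    fun j s => coe_lerayTruncate_apply N _ x j
  have hsum : ∀ j, IntervalIntegrable
      (fun s => trigPoly (freqBox d N) (fun k => rateCoeff N U v k j s) x) volume 0 t := by
    intro j
    unfold trigPoly
    have := IntervalIntegrable.sum (freqBox d N) (μ := volume) (a := 0) (b := t)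
      (f := fun k s => rateCoeff N U v k j s * character k x) fun k _ => (hInt k j).mul_const _
    simpa only [Finset.sum_fn] using this
  have hre : ∀ j, IntervalIntegrable
      (fun s => lerayTruncate N (advect (truncate N (U s)) (v s)) x j) volume 0 t := by
    intro j
    have h1 := hsum j
    simp only [← hcoe] at h1
    exact ⟨by simpa [IntegrableOn] using h1.1.re, by simpa [IntegrableOn] using h1.2.re⟩
  have hvec : IntervalIntegrable (fun s => lerayTruncate N (advect (truncate N (U s)) (v s)) x)
      volume 0 t :=
    ⟨Integrable.of_eval_piLp fun j => (hre j).1, Integrable.of_eval_piLp fun j => (hre j).2⟩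
  have hev := congrArg (fun z : Vec d => z i) (hv.evolution t ht x)
  have hproj := (EuclideanSpace.proj (𝕜 := ℝ) i : Vec d →L[ℝ] ℝ).intervalIntegral_comp_comm hvec
  simp only [PiLp.proj_apply] at hproj
  simp only [PiLp.sub_apply] at hev
  rw [← hproj] at hev
  rw [trigPoly_sub, ← hv.coe_apply ht, ← hv.coe_apply le_rfl, hev, Complex.ofReal_sub,
    ← intervalIntegral.integral_ofReal]
  simp only [hcoe]
  congr 1
  simp only [trigPoly]
  rw [intervalIntegral.integral_finsetSum fun k _ => (hInt k i).mul_const _]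
  simp only [intervalIntegral.integral_mul_const]

/-- The initial field and all rates are Leray projections, so the divergence remains zero. -/
theorem sum_fourierCoeffVec_mul {q : ℝ} {G : ℝ → Torus d L → Mat d}
    (hv : IsSpectralSolution N U u₀ v) (hU : IsAdmissibleVelocity q U G) (hq : 2 ≤ q)
    {k : Fin d → ℤ} (hk : k ∈ freqBox d N) {t : ℝ} (ht : 0 ≤ t) :
    ∑ i, fourierCoeffVec (v t) k i * (k i : ℂ) = 0 := by
  simp only [hv.fourierCoeffVec_eq_sub_integral hU hq hk _ ht, sub_mul, Finset.sum_sub_distrib,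
    hv.fourierCoeffVec_initial hk, sum_lerayCoeff_mul, zero_sub, neg_eq_zero,
    ← intervalIntegral.integral_mul_const]
  rw [← intervalIntegral.integral_finsetSum fun i _ =>
    (hv.intervalIntegrable_rateCoeff hU hq k i ht).mul_const _]
  simp only [rateCoeff, sum_lerayCoeff_mul, intervalIntegral.integral_zero]

end IsSpectralSolution

end VectorMixing

open scoped ComplexConjugate

namespace VectorMixing

variable {d : ℕ} {L : ℝ} [hL : Fact (0 < L)]

/-! ### Weighted energy balances of a spectral solution -/

/-- `∑_{|k|_∞ ≤ N} w_k |f̂_k|²`. -/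
noncomputable def weightedSum (N : ℕ) (w : (Fin d → ℤ) → ℝ) (f : Torus d L → Vec d) : ℝ :=
  ∑ k ∈ freqBox d N, w k * ∑ i, ‖fourierCoeffVec f k i‖ ^ 2

/-- The form `2 Re ∑_k w_k \hat{(P_N U · ∇) f}_k · conj f̂_k`. -/
noncomputable def balanceForm (N : ℕ) (U : Torus d L → Vec d) (w : (Fin d → ℤ) → ℝ)
    (f : Torus d L → Vec d) : ℝ :=
  2 * (L ^ d)⁻¹ * ∑ i, (∑ k ∈ freqBox d N, ∑ l ∈ freqBox d N, fourierCoeffVec f k i *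
    conj (fourierCoeffVec f l i) * (w l : ℂ) * transportCoeff (truncComp N U) k l).re

theorem balanceForm_one {N : ℕ} {U : Torus d L → Vec d} (hU : FourierDivFree (truncComp N U))
    (f : Torus d L → Vec d) : balanceForm N U (fun _ => 1) f = 0 := by
  have h : ∀ i, (∑ k ∈ freqBox d N, ∑ l ∈ freqBox d N, fourierCoeffVec f k i *
      conj (fourierCoeffVec f l i) * ((1 : ℝ) : ℂ) * transportCoeff (truncComp N U) k l).re = 0 := by
    intro i
    rw [re_sum_antisymm (fun k _ l _ => conj_transportCoeff hU k l) (fun _ => 1)]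
    simp
  simp only [balanceForm, h, Finset.sum_const_zero, mul_zero]

theorem weightedSum_nonneg {N : ℕ} {w : (Fin d → ℤ) → ℝ} (hw : ∀ k, 0 ≤ w k)
    (f : Torus d L → Vec d) : 0 ≤ weightedSum N w f :=
  Finset.sum_nonneg fun k _ => mul_nonneg (hw k) (Finset.sum_nonneg fun _ _ => by positivity)

theorem weightedSum_one (N : ℕ) (f : Torus d L → Vec d) :
    weightedSum N (fun _ => 1) f
      = ∑ i, l2Coeff (freqBox d N) (fun k => fourierCoeffVec f k i) ^ 2 := by
  simp only [weightedSum, sq_l2Coeff, one_mul]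
  exact Finset.sum_comm

theorem weightedSum_laplaceSymbol (N : ℕ) (α : ℝ) (f : Torus d L → Vec d) :
    weightedSum N (fun k => laplaceSymbol L k ^ (-α)) f
      = ∑ i, negCoeff (freqBox d N) (laplaceSymbol L) α (fun k => fourierCoeffVec f k i) ^ 2 := by
  simp only [weightedSum, negCoeff, sq_l2Coeff, Finset.mul_sum]
  rw [Finset.sum_comm]
  refine Finset.sum_congr rfl fun i _ => Finset.sum_congr rfl fun k _ => ?_
  have hν : 0 ≤ laplaceSymbol L k := laplaceSymbol_nonneg k
  rw [norm_mul, mul_pow, Complex.norm_real, Real.norm_of_nonneg (Real.rpow_nonneg hν _),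
    ← Real.rpow_natCast (laplaceSymbol L k ^ (-(α / 2))), ← Real.rpow_mul hν]
  congr 2
  push_cast
  ring

namespace IsSpectralSolution

variable {N : ℕ} {U v : ℝ → Torus d L → Vec d} {u₀ : Torus d L → Vec d} {q : ℝ}
  {G : ℝ → Torus d L → Mat d}

theorem continuousOn_weightedSum (hv : IsSpectralSolution N U u₀ v) (w : (Fin d → ℤ) → ℝ) :
    ContinuousOn (fun t => weightedSum N w (v t)) (Ici 0) := by
  unfold weightedSum
  exact continuousOn_finsetSum _ fun k _ => continuousOn_const.mul
    (continuousOn_finsetSum _ fun i _ => (hv.continuousOn_fourierCoeffVec k i).norm.pow 2)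

/-- The gradient part removed by the Leray projection is parallel to k, and the solution is
orthogonal to k. The projection therefore drops out mode by mode, whatever the weight. -/
theorem sum_re_conj_mul_rateCoeff (hv : IsSpectralSolution N U u₀ v)
    (hU : IsAdmissibleVelocity q U G) (hq : 2 ≤ q) (w : (Fin d → ℤ) → ℝ) {s : ℝ} (hs : 0 ≤ s) :
    ∑ k ∈ freqBox d N, w k * ∑ i, 2 * (conj (fourierCoeffVec (v s) k i) * rateCoeff N U v k i s).re
      = balanceForm N (U s) w (v s) := by
  have h1 : ∀ k ∈ freqBox d N,
      ∑ i, conj (fourierCoeffVec (v s) k i) * rateCoeff N U v k i s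
      = ∑ i, conj (fourierCoeffVec (v s) k i) * ((((L ^ d)⁻¹ : ℝ) : ℂ) * ∑ l ∈ freqBox d N,
          fourierCoeffVec (v s) l i * transportCoeff (truncComp N (U s)) l k) := by
    intro k hk
    have h2 : ∑ i, conj (fourierCoeffVec (v s) k i) * (k i : ℂ) = 0 := by
      have := congrArg conj (hv.sum_fourierCoeffVec_mul hU hq hk hs)
      simpa using this
    simp only [rateCoeff, lerayCoeff, mul_sub, Finset.sum_sub_distrib]
    have h3 : ∀ (z : ℂ) (i : Fin d), conj (fourierCoeffVec (v s) k i) * (z * (k i : ℂ))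
        = z * (conj (fourierCoeffVec (v s) k i) * (k i : ℂ)) := fun z i => by ring
    simp only [h3, ← Finset.mul_sum, h2, mul_zero, sub_zero]
    refine Finset.sum_congr rfl fun i _ => ?_
    rw [fourierCoeffVec_advect (hv.modes s hs)]
  have h4 : ∑ k ∈ freqBox d N,
      w k * ∑ i, 2 * (conj (fourierCoeffVec (v s) k i) * rateCoeff N U v k i s).re
      = (∑ k ∈ freqBox d N, ((2 * w k : ℝ) : ℂ) *
        ∑ i, conj (fourierCoeffVec (v s) k i) * rateCoeff N U v k i s).re := by
    rw [Complex.re_sum]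
    refine Finset.sum_congr rfl fun k _ => ?_
    rw [Complex.re_ofReal_mul, Complex.re_sum, ← Finset.mul_sum]
    ring
  rw [h4, Finset.sum_congr rfl fun k hk => by rw [h1 k hk]]
  have h5 : balanceForm N (U s) w (v s)
      = (((2 * (L ^ d)⁻¹ : ℝ) : ℂ) * ∑ i, ∑ k ∈ freqBox d N, ∑ l ∈ freqBox d N,
        fourierCoeffVec (v s) k i * conj (fourierCoeffVec (v s) l i) * (w l : ℂ) *
          transportCoeff (truncComp N (U s)) k l).re := by
    rw [Complex.re_ofReal_mul, Complex.re_sum, balanceForm]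
  rw [h5]
  congr 1
  simp only [Finset.mul_sum]
  rw [Finset.sum_comm]
  refine Finset.sum_congr rfl fun i _ => ?_
  rw [Finset.sum_comm]
  refine Finset.sum_congr rfl fun l _ => Finset.sum_congr rfl fun k _ => ?_
  push_cast
  ring

/-- The balance law of a weighted energy. -/
theorem weightedSum_sub (hv : IsSpectralSolution N U u₀ v) (hU : IsAdmissibleVelocity q U G)
    (hq : 2 ≤ q) (w : (Fin d → ℤ) → ℝ) {τ t : ℝ} (hτ : 0 ≤ τ) (hτt : τ ≤ t) :
    IntervalIntegrable (fun s => balanceForm N (U s) w (v s)) volume τ t ∧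
      weightedSum N w (v t) - weightedSum N w (v τ)
        = -∫ s in τ..t, balanceForm N (U s) w (v s) := by
  have ht := hτ.trans hτt
  have hsub : uIcc τ t ⊆ uIcc 0 t := by
    rw [uIcc_of_le hτt, uIcc_of_le ht]
    exact Icc_subset_Icc_left hτ
  have hI : ∀ k i, IntervalIntegrable
      (fun s => 2 * (conj (fourierCoeffVec (v s) k i) * rateCoeff N U v k i s).re) volume τ t := by
    intro k i
    have h1 : IntervalIntegrable (rateCoeff N U v k i) volume τ t :=
      (hv.intervalIntegrable_rateCoeff hU hq k i ht).mono_set hsub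
    have h2 : ContinuousOn (fun s => conj (fourierCoeffVec (v s) k i)) (uIcc τ t) := by
      refine Complex.continuous_conj.comp_continuousOn
        ((hv.continuousOn_fourierCoeffVec k i).mono ?_)
      rw [uIcc_of_le hτt]
      exact fun x hx => hτ.trans hx.1
    have h3 := h1.continuousOn_mul h2
    have h4 : IntervalIntegrable
        (fun s => (conj (fourierCoeffVec (v s) k i) * rateCoeff N U v k i s).re) volume τ t :=
      ⟨h3.1.re, h3.2.re⟩
    exact h4.const_mul 2
  have hI1 : ∀ k, IntervalIntegrable (fun s => ∑ i,
      2 * (conj (fourierCoeffVec (v s) k i) * rateCoeff N U v k i s).re) volume τ t := by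
    intro k
    simpa only [Finset.sum_fn] using IntervalIntegrable.sum Finset.univ fun i _ => hI k i
  have hI2 : IntervalIntegrable (fun s => ∑ k ∈ freqBox d N, w k * ∑ i,
      2 * (conj (fourierCoeffVec (v s) k i) * rateCoeff N U v k i s).re) volume τ t := by
    simpa only [Finset.sum_fn] using
      IntervalIntegrable.sum (freqBox d N) fun k _ => (hI1 k).const_mul (w k)
  have hEq : EqOn (fun s => ∑ k ∈ freqBox d N, w k * ∑ i,
      2 * (conj (fourierCoeffVec (v s) k i) * rateCoeff N U v k i s).re)
      (fun s => balanceForm N (U s) w (v s)) (uIcc τ t) := by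
    intro s hs
    rw [uIcc_of_le hτt] at hs
    exact hv.sum_re_conj_mul_rateCoeff hU hq w (hτ.trans hs.1)
  refine ⟨hI2.congr fun s hs => hEq (uIoc_subset_uIcc hs), ?_⟩
  rw [← intervalIntegral.integral_congr hEq,
    intervalIntegral.integral_finsetSum fun k _ => (hI1 k).const_mul (w k),
    ← Finset.sum_neg_distrib, weightedSum, weightedSum, ← Finset.sum_sub_distrib]
  refine Finset.sum_congr rfl fun k hk => ?_
  rw [intervalIntegral.integral_const_mul, ← mul_sub, ← mul_neg,
    intervalIntegral.integral_finsetSum fun i _ => hI k i, ← Finset.sum_neg_distrib,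
    ← Finset.sum_sub_distrib]
  congr 1
  refine Finset.sum_congr rfl fun i _ => ?_
  exact norm_sq_sub_norm_sq_eq_integral (a := fun s => fourierCoeffVec (v s) k i) hτ hτt
    (hv.intervalIntegrable_rateCoeff hU hq k i ht)
    fun s hs => hv.fourierCoeffVec_eq_sub_integral hU hq hk i hs.1

/-- Conservation of energy. -/
theorem weightedSum_one_eq (hv : IsSpectralSolution N U u₀ v) (hU : IsAdmissibleVelocity q U G)
    (hq : 2 ≤ q) {t : ℝ} (ht : 0 ≤ t) :
    weightedSum N (fun _ => 1) (v t) = weightedSum N (fun _ => 1) (v 0) := by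
  obtain ⟨K, _, hK⟩ := hU.exists_l2Norm_le hq
  have h := (hv.weightedSum_sub hU hq (fun _ => 1) le_rfl ht).2
  rw [← sub_eq_zero, h, neg_eq_zero, intervalIntegral.integral_of_le ht]
  refine integral_eq_zero_of_ae ?_
  filter_upwards [ae_restrict_of_ae_timeMeasure hK le_rfl t,
    ae_restrict_of_ae_timeMeasure hU.divFree le_rfl t] with s hs hdiv
  exact balanceForm_one (fourierDivFree_truncComp hdiv (integrable_of_memLp_two hs.1) N) _

/-- The differential inequality for the negative norm, in integrated form. -/
theorem weightedSum_sub_le {α C B η E : ℝ} (hα : 1 / 2 ≤ α) (hα1 : α < 1)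
    (hv : IsSpectralSolution N U u₀ v) (hU : IsAdmissibleVelocity q U G) (hq : 2 ≤ q)
    (hC : 0 ≤ C) (hB : 0 ≤ B) (hη : 0 ≤ η)
    (hform : ∀ᵐ s ∂timeMeasure, ∀ a : (Fin d → ℤ) → ℂ,
      |(∑ k ∈ freqBox d N, ∑ l ∈ freqBox d N, a k * conj (a l) *
          ((laplaceSymbol L l ^ (-α) : ℝ) : ℂ) * transportCoeff (truncComp N (U s)) k l).re|
        ≤ C * B * negCoeff (freqBox d N) (laplaceSymbol L) α a ^ (2 - (1 - α) / α)
          * l2Coeff (freqBox d N) a ^ ((1 - α) / α) + η * B * l2Coeff (freqBox d N) a ^ 2)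
    (hE : weightedSum N (fun _ => 1) (v 0) ≤ E) {τ t : ℝ} (hτ : 0 ≤ τ) (hτt : τ ≤ t) :
    weightedSum N (fun k => laplaceSymbol L k ^ (-α)) (v τ)
        - weightedSum N (fun k => laplaceSymbol L k ^ (-α)) (v t)
      ≤ ∫ s in τ..t, (2 * (L ^ d)⁻¹ * d * (C * B * E ^ ((1 - α) / α / 2)) *
          weightedSum N (fun k => laplaceSymbol L k ^ (-α)) (v s) ^ (1 - (1 - α) / α / 2)
          + 2 * (L ^ d)⁻¹ * d * (η * B * E)) := by
  have hα0 : 0 < α := by linarith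
  have hLd : 0 < L ^ d := torus_volume_pos
  set p₀ := (1 - α) / α with hp₀
  have hp0 : 0 ≤ p₀ := div_nonneg (by linarith) hα0.le
  have hp1 : p₀ ≤ 1 := (div_le_one hα0).2 (by linarith)
  have hw : ∀ k : Fin d → ℤ, 0 ≤ laplaceSymbol L k ^ (-α) :=
    fun k => Real.rpow_nonneg (laplaceSymbol_nonneg k) _
  obtain ⟨hInt, hbal⟩ := hv.weightedSum_sub hU hq (fun k => laplaceSymbol L k ^ (-α)) hτ hτt
  have hsubset : uIcc τ t ⊆ Ici 0 := by
    rw [uIcc_of_le hτt]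
    exact fun x hx => hτ.trans hx.1
  have hbd : IntervalIntegrable (fun s => 2 * (L ^ d)⁻¹ * d * (C * B * E ^ (p₀ / 2)) *
      weightedSum N (fun k => laplaceSymbol L k ^ (-α)) (v s) ^ (1 - p₀ / 2)
      + 2 * (L ^ d)⁻¹ * d * (η * B * E)) volume τ t := by
    refine ContinuousOn.intervalIntegrable ?_
    refine (continuousOn_const.mul ?_).add continuousOn_const
    exact ((hv.continuousOn_weightedSum _).mono hsubset).rpow_const fun _ _ =>
      Or.inr (by linarith)
  have hle : ∫ s in τ..t, balanceForm N (U s) (fun k => laplaceSymbol L k ^ (-α)) (v s)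
      ≤ ∫ s in τ..t, (2 * (L ^ d)⁻¹ * d * (C * B * E ^ (p₀ / 2)) *
        weightedSum N (fun k => laplaceSymbol L k ^ (-α)) (v s) ^ (1 - p₀ / 2)
        + 2 * (L ^ d)⁻¹ * d * (η * B * E)) := by
    refine intervalIntegral.integral_mono_ae_restrict hτt hInt hbd ?_
    rw [← restrict_Ioc_eq_restrict_Icc]
    filter_upwards [ae_restrict_of_ae_timeMeasure hform hτ t, ae_restrict_mem measurableSet_Ioc]
      with s hs hmem
    have hs0 : 0 ≤ s := hτ.trans hmem.1.le
    set y := weightedSum N (fun k => laplaceSymbol L k ^ (-α)) (v s) with hy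
    have hy0 : 0 ≤ y := weightedSum_nonneg hw _
    have hEs : weightedSum N (fun _ => 1) (v s) ≤ E := by rwa [hv.weightedSum_one_eq hU hq hs0]
    have hE0 : 0 ≤ E := (weightedSum_nonneg (fun _ => zero_le_one) (v s)).trans hEs
    -- The norms of one component are bounded by those of the whole field; summing over the
    -- components yields the factor d.
    have hcomp : ∀ i ∈ (Finset.univ : Finset (Fin d)),
        (∑ k ∈ freqBox d N, ∑ l ∈ freqBox d N, fourierCoeffVec (v s) k i *
          conj (fourierCoeffVec (v s) l i) * ((laplaceSymbol L l ^ (-α) : ℝ) : ℂ) *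
          transportCoeff (truncComp N (U s)) k l).re
        ≤ C * B * (y ^ (1 - p₀ / 2) * E ^ (p₀ / 2)) + η * B * E := by
      intro i _
      refine (le_abs_self _).trans ((hs fun k => fourierCoeffVec (v s) k i).trans ?_)
      set n := negCoeff (freqBox d N) (laplaceSymbol L) α (fun k => fourierCoeffVec (v s) k i)
      set e := l2Coeff (freqBox d N) (fun k => fourierCoeffVec (v s) k i)
      have hn0 : 0 ≤ n := negCoeff_nonneg _ _
      have he0 : 0 ≤ e := l2Coeff_nonneg _ _
      have hn : n ^ 2 ≤ y := by
        rw [hy, weightedSum_laplaceSymbol]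
        exact Finset.single_le_sum (f := fun i => negCoeff (freqBox d N) (laplaceSymbol L) α
          (fun k => fourierCoeffVec (v s) k i) ^ 2) (fun _ _ => sq_nonneg _) (Finset.mem_univ i)
      have he : e ^ 2 ≤ E := by
        refine le_trans ?_ hEs
        rw [weightedSum_one]
        exact Finset.single_le_sum (f := fun i => l2Coeff (freqBox d N)
          (fun k => fourierCoeffVec (v s) k i) ^ 2) (fun _ _ => sq_nonneg _) (Finset.mem_univ i)
      have hn2 : n ^ (2 - p₀) ≤ y ^ (1 - p₀ / 2) := by
        calc n ^ (2 - p₀) = (n ^ 2) ^ (1 - p₀ / 2) := by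
              rw [← Real.rpow_natCast, ← Real.rpow_mul hn0]
              congr 1
              push_cast
              ring
          _ ≤ _ := Real.rpow_le_rpow (sq_nonneg _) hn (by linarith)
      have he2 : e ^ p₀ ≤ E ^ (p₀ / 2) := by
        calc e ^ p₀ = (e ^ 2) ^ (p₀ / 2) := by
              rw [← Real.rpow_natCast, ← Real.rpow_mul he0]
              congr 1
              push_cast
              ring
          _ ≤ _ := Real.rpow_le_rpow (sq_nonneg _) he (by linarith)
      rw [mul_assoc (C * B)]
      exact add_le_add (mul_le_mul_of_nonneg_left (mul_le_mul hn2 he2 (Real.rpow_nonneg he0 _)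
        (Real.rpow_nonneg hy0 _)) (mul_nonneg hC hB))
        (mul_le_mul_of_nonneg_left he (mul_nonneg hη hB))
    have hsum := Finset.sum_le_card_nsmul _ _ _ hcomp
    simp only [Finset.card_univ, Fintype.card_fin, nsmul_eq_mul] at hsum
    calc _ ≤ 2 * (L ^ d)⁻¹ * (d * (C * B * (y ^ (1 - p₀ / 2) * E ^ (p₀ / 2)) + η * B * E)) :=
          mul_le_mul_of_nonneg_left hsum (by positivity)
      _ = _ := by ring
  linarith

end IsSpectralSolution

end VectorMixing

/-! ### From the differential inequality to the lower bound and the minimal mixing time -/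

open scoped ComplexConjugate

namespace VectorMixing

/-- The lower bound for the negative norm that follows from the differential inequality for its
square. -/
theorem mixingLowerBound_le_sqrt {d : ℕ} {α r C B E V c : ℝ} {y : ℝ → ℝ} (hα : 1 / 2 ≤ α)
    (hα1 : α < 1) (hr : 1 ≤ r) (hC : 0 ≤ C) (hB : 0 ≤ B) (hE : 0 ≤ E) (hV : 0 < V) (hc : 0 ≤ c)
    (hy : ContinuousOn y (Ici 0)) (hy0 : ∀ t, 0 ≤ t → 0 ≤ y t) (hyE : y 0 ≤ c ^ 2 * E)
    (h : ∀ s t, 0 ≤ s → s ≤ t → y s - y t ≤ ∫ x in s..t,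
      2 * V⁻¹ * d * (C * B * E ^ ((1 - α) / α / 2)) * y x ^ (1 - (1 - α) / α / 2))
    {t : ℝ} (ht : 0 ≤ t) :
    mixingLowerBound d α r (c ^ (mixingPower d α r - (1 - α) / α) * (V⁻¹ * d * C)) t
      (√(V * y 0)) (√(V * E)) B ≤ √(V * y t) := by
  have hα0 : 0 < α := by linarith
  have hr0 : 0 < r := by linarith
  set p₀ := (1 - α) / α with hp₀
  have hp0 : 0 < p₀ := div_pos (by linarith) hα0
  have hp1 : p₀ ≤ 1 := (div_le_one hα0).2 (by linarith)
  have hp : p₀ ≤ mixingPower d α r := by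
    rw [mixingPower, hp₀]
    have : 0 ≤ (d : ℝ) / (α * r) := by positivity
    linarith
  have hexp : α * r / (r - α * r + d) = 1 / mixingPower d α r := by
    have h2 : 0 < r - α * r + d := by
      have : 0 < r * (1 - α) := mul_pos hr0 (by linarith)
      have : (0 : ℝ) ≤ d := Nat.cast_nonneg d
      nlinarith
    rw [mixingPower]
    field_simp
  -- The power is p₀/2 because y is the square of the norm. It lies in (0, 1) since α ≥ 1/2 gives p₀
  -- ≤ 1.
  have hode := rpow_sub_le_rpow_of_integral (by linarith : 0 < p₀ / 2) (by linarith)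
    (by positivity) hy hy0 h ht
  have hscale : ∀ z, 0 ≤ z → √(V * z) ^ p₀ = V ^ (p₀ / 2) * z ^ (p₀ / 2) := by
    intro z hz
    rw [Real.sqrt_eq_rpow, ← Real.rpow_mul (by positivity), ← Real.mul_rpow hV.le hz]
    congr 1
    ring
  have hmain : √(V * y 0) ^ p₀ - p₀ * (V⁻¹ * d * C * t * B) * √(V * E) ^ p₀ ≤ √(V * y t) ^ p₀ := by
    rw [hscale _ (hy0 0 le_rfl), hscale _ hE, hscale _ (hy0 t ht)]
    have := mul_le_mul_of_nonneg_left hode (Real.rpow_nonneg hV.le (p₀ / 2))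
    refine le_trans (le_of_eq ?_) this
    ring
  have hae : √(V * y 0) ≤ c * √(V * E) := by
    rw [← Real.sqrt_sq hc, ← Real.sqrt_mul (sq_nonneg c)]
    refine Real.sqrt_le_sqrt ?_
    have := mul_le_mul_of_nonneg_left hyE hV.le
    linarith
  have hfin := max_rpow_le_of_rpow_sub_le (Real.sqrt_nonneg _) (Real.sqrt_nonneg _)
    (Real.sqrt_nonneg _) hc (by positivity : 0 ≤ V⁻¹ * d * C * t * B) hp0 hp hae hmain
  rw [mixingLowerBound, hexp]
  refine le_trans (le_of_eq ?_) hfin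
  congr 3
  ring

/-- Positivity of the norm up to the minimal mixing time. -/
theorem mixingLowerBound_pos {d : ℕ} {α r C t h e g : ℝ} (hα : 1 / 2 ≤ α) (hα1 : α < 1)
    (hr : 1 ≤ r) (hC : 0 ≤ C) (ht : 0 ≤ t) (hh : 0 ≤ h) (he : 0 ≤ e) (hg : 0 ≤ g)
    (htm : ENNReal.ofReal t < minimalMixingTime d α r C h e g) :
    0 < mixingLowerBound d α r C t h e g := by
  have hα0 : 0 < α := by linarith
  have hr0 : 0 < r := by linarith
  have hden : 0 < r - α * r + d := by
    have : 0 < r * (1 - α) := mul_pos hr0 (by linarith)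
    have : (0 : ℝ) ≤ d := Nat.cast_nonneg d
    nlinarith
  rw [mixingLowerBound]
  refine Real.rpow_pos_of_pos (lt_max_of_lt_left ?_) _
  set p := mixingPower d α r with hp
  have hpeq : p = (r - α * r + d) / (α * r) := by
    rw [hp, mixingPower]
    field_simp
  set Y := (r - α * r + d) * C * e ^ p * g with hY
  have hY0 : 0 ≤ Y := by
    have := Real.rpow_nonneg he p
    positivity
  have hX0 : 0 ≤ α * r * h ^ p := by positivity
  rw [minimalMixingTime, ← hp, ← hY] at htm
  -- Clearing the denominator in `ℝ≥0∞` includes Y = 0, where the quotient is infinite or, for a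
  -- vanishing numerator, zero.
  have hmul : t * Y < α * r * h ^ p := by
    have h1 := ENNReal.mul_lt_of_lt_div htm
    rw [← ENNReal.ofReal_mul ht] at h1
    exact (ENNReal.ofReal_lt_ofReal_iff_of_nonneg (by positivity)).1 h1
  have h2 : h ^ p - p * C * t * g * e ^ p = (α * r * h ^ p - t * Y) / (α * r) := by
    rw [hY, hpeq]
    field_simp
  rw [h2]
  exact div_pos (by linarith) (by positivity)

theorem sq_rpow {z : ℝ} (hz : 0 ≤ z) (β : ℝ) : (z ^ β) ^ 2 = (z ^ 2) ^ β := by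
  rw [← Real.rpow_natCast, ← Real.rpow_natCast, ← Real.rpow_mul hz, ← Real.rpow_mul hz, mul_comm]

theorem freqNorm_nonneg {d : ℕ} (k : Fin d → ℤ) : 0 ≤ freqNorm k := Real.sqrt_nonneg _

variable {d : ℕ} {L : ℝ} [hL : Fact (0 < L)]

/-! ### The negative Sobolev norm -/

theorem homSobolevNorm_neg_eq (α : ℝ) (f : Torus d L → Vec d) :
    homSobolevNorm (-α) f
      = √(L ^ d * ∑' k, laplaceSymbol L k ^ (-α) * ∑ i, ‖fourierCoeffVec f k i‖ ^ 2) := by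
  have hκ : 0 < 2 * Real.pi / L := div_pos (by positivity) hL.out
  have h1 : ∀ k : Fin d → ℤ, laplaceSymbol L k ^ (-α) * ∑ i, ‖fourierCoeffVec f k i‖ ^ 2
      = ((2 * Real.pi / L) ^ (-α)) ^ 2 *
        ((freqNorm k ^ (-α)) ^ 2 * ∑ i, ‖fourierCoeffVec f k i‖ ^ 2) := by
    intro k
    rw [laplaceSymbol, ← freqNorm_sq, Real.mul_rpow (sq_nonneg _) (sq_nonneg _), sq_rpow hκ.le,
      sq_rpow (freqNorm_nonneg k), mul_assoc]
  simp only [h1]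
  rw [tsum_mul_left, mul_left_comm, Real.sqrt_mul (sq_nonneg _),
    Real.sqrt_sq (Real.rpow_nonneg hκ.le _), homSobolevNorm]

/-- Poincaré's inequality mode by mode: a nonzero frequency has length at least one, and the zero
mode carries no weight. -/
theorem laplaceSymbol_rpow_neg_le {α : ℝ} (hα : 0 < α) (k : Fin d → ℤ) :
    laplaceSymbol L k ^ (-α) ≤ ((2 * Real.pi / L) ^ (-α)) ^ 2 := by
  have hκ : 0 < 2 * Real.pi / L := div_pos (by positivity) hL.out
  rcases eq_or_ne k 0 with rfl | hk
  · rw [laplaceSymbol_zero, Real.zero_rpow (by linarith)]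
    positivity
  · rw [sq_rpow hκ.le]
    exact Real.rpow_le_rpow_of_nonpos (by positivity) (sq_le_laplaceSymbol hk) (by linarith)

theorem weightedSum_laplaceSymbol_le {α : ℝ} (hα : 0 < α) (N : ℕ) (f : Torus d L → Vec d) :
    weightedSum N (fun k => laplaceSymbol L k ^ (-α)) f
      ≤ ((2 * Real.pi / L) ^ (-α)) ^ 2 * weightedSum N (fun _ => 1) f := by
  rw [weightedSum, weightedSum, Finset.mul_sum]
  refine Finset.sum_le_sum fun k _ => ?_
  rw [one_mul]
  exact mul_le_mul_of_nonneg_right (laplaceSymbol_rpow_neg_le hα k)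
    (Finset.sum_nonneg fun _ _ => by positivity)

theorem weightedSum_one_le {f : Torus d L → Vec d} (hf : MemLp f 2 volume) (N : ℕ) :
    weightedSum N (fun _ => 1) f ≤ l2Norm f ^ 2 / L ^ d := by
  rw [le_div_iff₀ torus_volume_pos, mul_comm]
  simpa only [weightedSum, one_mul] using sum_norm_sq_fourierCoeffVec_le hf (freqBox d N)

theorem sqrt_mul_l2Norm_sq_div (f : Torus d L → Vec d) :
    √(L ^ d * (l2Norm f ^ 2 / L ^ d)) = l2Norm f := by
  rw [mul_div_cancel₀ _ (torus_volume_pos (L := L) (d := d)).ne', Real.sqrt_sq]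
  exact ENNReal.toReal_nonneg

/-- A crude bound depending on N. Its only purpose is to show that the essential supremum over time
of the gradient of the truncation is finite. -/
theorem exists_eLpNorm_gradient_truncate_le (q : ℝ) (N : ℕ) (K : ℝ) :
    ∃ c : ℝ≥0∞, c ≠ ⊤ ∧ ∀ U : Torus d L → Vec d, MemLp U 2 volume → l2Norm U ≤ K →
      eLpNorm (gradient (truncate N U)) (ENNReal.ofReal q) volume ≤ c := by
  set M : ℝ := ∑ p : Fin d × Fin d, ∑ k ∈ freqBox d N, ‖derivSymbol L p.2 k‖ * (K / √(L ^ d))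
  refine ⟨volume (univ : Set (Torus d L)) ^ (ENNReal.ofReal q).toReal⁻¹ * ENNReal.ofReal M,
    ENNReal.mul_ne_top (ENNReal.rpow_ne_top_of_nonneg (by positivity) (measure_ne_top _ _))
      ENNReal.ofReal_ne_top, fun U hU hK => ?_⟩
  refine eLpNorm_le_of_ae_bound (Eventually.of_forall fun x => ?_)
  have h1 : ‖gradient (truncate N U) x‖ ≤ ∑ p, ‖gradient (truncate N U) x p‖ := by
    rw [EuclideanSpace.norm_eq]
    exact Real.sqrt_le_iff.2 ⟨Finset.sum_nonneg fun _ _ => norm_nonneg _,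
      Finset.sum_sq_le_sq_sum_of_nonneg fun _ _ => norm_nonneg _⟩
  refine h1.trans (Finset.sum_le_sum fun p _ => ?_)
  have h2 := coe_partialDeriv_truncate N U x p.1 p.2
  have h3 : ‖gradient (truncate N U) x p‖
      = ‖trigPoly (freqBox d N) (fun k => derivSymbol L p.2 k * fourierCoeffVec U k p.1) x‖ := by
    rw [← h2, Complex.norm_real]
    rfl
  rw [h3, trigPoly]
  refine (norm_sum_le _ _).trans (Finset.sum_le_sum fun k _ => ?_)
  rw [norm_mul, norm_mul, norm_character, mul_one]
  refine mul_le_mul_of_nonneg_left ((norm_fourierCoeffVec_le_l2Norm hU k p.1).trans ?_) (norm_nonneg _)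
  gcongr

/-- `supLqNorm` is a `toReal` and would be zero for an infinite essential supremum; the finite bound
c excludes this. -/
theorem eLpNorm_le_ofReal_supLqNorm {q : ℝ} {F : ℝ → Torus d L → Mat d} {c : ℝ≥0∞} (hc : c ≠ ⊤)
    (h : ∀ᵐ s ∂timeMeasure, eLpNorm (F s) (ENNReal.ofReal q) volume ≤ c) :
    ∀ᵐ s ∂timeMeasure, eLpNorm (F s) (ENNReal.ofReal q) volume
      ≤ ENNReal.ofReal (supLqNorm q F) := by
  have h1 : essSup (fun t => eLpNorm (F t) (ENNReal.ofReal q) volume) timeMeasure ≠ ⊤ :=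
    ne_top_of_le_ne_top hc (essSup_le_of_ae_le c h)
  rw [supLqNorm, ENNReal.ofReal_toReal h1]
  exact ENNReal.ae_le_essSup _

theorem IsSpectralSolution.continuous_apply {N : ℕ} {U v : ℝ → Torus d L → Vec d}
    {u₀ : Torus d L → Vec d} (hv : IsSpectralSolution N U u₀ v) {t : ℝ} (ht : 0 ≤ t) :
    Continuous (v t) := by
  rw [hv.modes t ht]
  exact (PiLp.continuous_toLp 2 _).comp (continuous_pi fun i => continuous_truncComp N (v t) i)

theorem IsSpectralSolution.memLp {N : ℕ} {U v : ℝ → Torus d L → Vec d}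
    {u₀ : Torus d L → Vec d} (hv : IsSpectralSolution N U u₀ v) {t : ℝ} (ht : 0 ≤ t) :
    MemLp (v t) 2 volume :=
  (hv.continuous_apply ht).memLp_of_hasCompactSupport (HasCompactSupport.of_compactSpace _)

theorem IsSpectralSolution.tsum_eq_weightedSum {N : ℕ} {U v : ℝ → Torus d L → Vec d}
    {u₀ : Torus d L → Vec d} (hv : IsSpectralSolution N U u₀ v) {t : ℝ} (ht : 0 ≤ t)
    (w : (Fin d → ℤ) → ℝ) :
    ∑' k, w k * ∑ i, ‖fourierCoeffVec (v t) k i‖ ^ 2 = weightedSum N w (v t) := by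
  refine tsum_eq_sum fun k hk => ?_
  simp [hv.fourierCoeffVec_eq_zero ht hk]

/-- The lower bound for the spectral approximations. -/
theorem IsSpectralSolution.mixingLowerBound_le {N : ℕ} {U v : ℝ → Torus d L → Vec d}
    {u₀ : Torus d L → Vec d} {α q r C : ℝ} {G : ℝ → Torus d L → Mat d} (hα : 1 / 2 ≤ α)
    (hα1 : α < 1) (hq : 2 ≤ q) (hr : 1 ≤ r) (hC : 0 ≤ C)
    (hbound : ∀ U : Torus d L → Vec d, IsDivFree U → MemLp U (ENNReal.ofReal q) volume →
      ∀ B : ℝ, 0 ≤ B → ∀ a : (Fin d → ℤ) → ℂ,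
      eLpNorm (gradient (truncate N U)) (ENNReal.ofReal q) volume ≤ ENNReal.ofReal B →
        |(∑ k ∈ freqBox d N, ∑ l ∈ freqBox d N, a k * conj (a l) *
          ((laplaceSymbol L l ^ (-α) : ℝ) : ℂ) * transportCoeff (truncComp N U) k l).re|
        ≤ C * B * negCoeff (freqBox d N) (laplaceSymbol L) α a ^ (2 - (1 - α) / α)
          * l2Coeff (freqBox d N) a ^ ((1 - α) / α))
    (hv : IsSpectralSolution N U u₀ v) (hU : IsAdmissibleVelocity q U G) {t : ℝ} (ht : 0 ≤ t) :
    mixingLowerBound d α r (((2 * Real.pi / L) ^ (-α)) ^ (mixingPower d α r - (1 - α) / α)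
        * ((L ^ d)⁻¹ * d * C)) t (homSobolevNorm (-α) (v 0)) (l2Norm (v 0))
        (supLqNorm q fun τ => gradient (truncate N (U τ)))
      ≤ homSobolevNorm (-α) (v t) := by
  have hα0 : 0 < α := by linarith
  have hκ : 0 < 2 * Real.pi / L := div_pos (by positivity) hL.out
  obtain ⟨K, _, hK⟩ := hU.exists_l2Norm_le hq
  obtain ⟨M, hM⟩ := hU.bound
  obtain ⟨c, hc, hcb⟩ := exists_eLpNorm_gradient_truncate_le (d := d) (L := L) q N K
  set B := supLqNorm q fun τ => gradient (truncate N (U τ)) with hBdef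
  have hB : 0 ≤ B := ENNReal.toReal_nonneg
  have hgrad : ∀ᵐ s ∂timeMeasure, eLpNorm (gradient (truncate N (U s))) (ENNReal.ofReal q) volume
      ≤ ENNReal.ofReal B :=
    eLpNorm_le_ofReal_supLqNorm hc (hK.mono fun s hs => hcb (U s) hs.1 hs.2)
  set E := l2Norm (v 0) ^ 2 / L ^ d with hEdef
  have hE : weightedSum N (fun _ => 1) (v 0) ≤ E := weightedSum_one_le (hv.memLp le_rfl) N
  have hE0 : 0 ≤ E := (weightedSum_nonneg (fun _ => zero_le_one) (v 0)).trans hE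
  have hform : ∀ᵐ s ∂timeMeasure, ∀ a : (Fin d → ℤ) → ℂ,
      |(∑ k ∈ freqBox d N, ∑ l ∈ freqBox d N, a k * conj (a l) *
          ((laplaceSymbol L l ^ (-α) : ℝ) : ℂ) * transportCoeff (truncComp N (U s)) k l).re|
        ≤ C * B * negCoeff (freqBox d N) (laplaceSymbol L) α a ^ (2 - (1 - α) / α)
          * l2Coeff (freqBox d N) a ^ ((1 - α) / α)
          + 0 * B * l2Coeff (freqBox d N) a ^ 2 := by
    filter_upwards [hgrad, hU.divFree, hM] with s hs hdiv hm a
    rw [zero_mul, zero_mul, add_zero]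
    exact hbound (U s) hdiv hm.1 B hB a hs
  have hineq := fun τ t hτ hτt => hv.weightedSum_sub_le (τ := τ) (t := t) hα hα1 hU hq hC hB le_rfl
    hform hE hτ hτt
  simp only [zero_mul, mul_zero, add_zero] at hineq
  have hmain := mixingLowerBound_le_sqrt hα hα1 hr hC hB hE0 (torus_volume_pos (d := d) (L := L))
    (Real.rpow_nonneg hκ.le (-α)) (hv.continuousOn_weightedSum fun k => laplaceSymbol L k ^ (-α))
    (fun t _ => weightedSum_nonneg (fun k => Real.rpow_nonneg (laplaceSymbol_nonneg k) _) _)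
    ((weightedSum_laplaceSymbol_le hα0 N (v 0)).trans
      (mul_le_mul_of_nonneg_left hE (sq_nonneg _))) hineq ht
  rw [hEdef, sqrt_mul_l2Norm_sq_div, ← hv.tsum_eq_weightedSum le_rfl,
    ← hv.tsum_eq_weightedSum ht, ← homSobolevNorm_neg_eq, ← homSobolevNorm_neg_eq] at hmain
  exact hmain

end VectorMixing

namespace VectorMixing

/-! ### Passing to the limit -/

/-- The weights vanish at infinity and the masses are bounded, so the tails are uniformly small
while a finite part converges term by term. This is the compactness of L² in H^{-α}. -/
theorem tendsto_tsum_mul_of_bounded {ι β : Type*} {l : Filter β} {w : ι → ℝ} (hw0 : ∀ k, 0 ≤ w k)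
    (hw : Tendsto w cofinite (𝓝 0)) {X : β → ι → ℝ} {Y : ι → ℝ} {M : ℝ}
    (hX0 : ∀ᶠ b in l, ∀ k, 0 ≤ X b k) (hXM : ∀ᶠ b in l, ∀ K : Finset ι, ∑ k ∈ K, X b k ≤ M)
    (hY0 : ∀ k, 0 ≤ Y k) (hYM : ∀ K : Finset ι, ∑ k ∈ K, Y k ≤ M)
    (hX : ∀ k, Tendsto (fun b => X b k) l (𝓝 (Y k))) :
    Tendsto (fun b => ∑' k, w k * X b k) l (𝓝 (∑' k, w k * Y k)) := by
  classical
  have hM : 0 ≤ M := by simpa using hYM ∅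
  rw [Metric.tendsto_nhds]
  intro ε hε
  obtain ⟨δ, hδ, hδM⟩ : ∃ δ > 0, δ * M < ε / 2 := by
    refine ⟨ε / 2 / (M + 1), by positivity, ?_⟩
    rw [div_mul_eq_mul_div, div_lt_iff₀ (by linarith)]
    nlinarith
  have hfin : {k | ¬ w k < δ}.Finite := by
    have := hw.eventually (eventually_lt_nhds hδ)
    rwa [eventually_cofinite] at this
  set F := hfin.toFinset with hF
  have hFw : ∀ k, k ∉ F → w k ≤ δ := by
    intro k hk
    rw [hF, Set.Finite.mem_toFinset] at hk
    exact (not_not.1 hk).le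
  have key : ∀ Z : ι → ℝ, (∀ k, 0 ≤ Z k) → (∀ K : Finset ι, ∑ k ∈ K, Z k ≤ M) →
      ∑ k ∈ F, w k * Z k ≤ ∑' k, w k * Z k ∧
        ∑' k, w k * Z k ≤ ∑ k ∈ F, w k * Z k + δ * M := by
    intro Z hZ0 hZM
    have h0 : ∀ k, 0 ≤ w k * Z k := fun k => mul_nonneg (hw0 k) (hZ0 k)
    have hb : ∀ K : Finset ι, ∑ k ∈ K, w k * Z k ≤ ∑ k ∈ F, w k * Z k + δ * M := by
      intro K
      calc ∑ k ∈ K, w k * Z k ≤ ∑ k ∈ F ∪ K \ F, w k * Z k := by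
            refine Finset.sum_le_sum_of_subset_of_nonneg ?_ fun k _ _ => h0 k
            rw [Finset.union_sdiff_self_eq_union]
            exact Finset.subset_union_right
        _ = ∑ k ∈ F, w k * Z k + ∑ k ∈ K \ F, w k * Z k :=
            Finset.sum_union Finset.disjoint_sdiff
        _ ≤ _ := by
            refine add_le_add le_rfl ?_
            calc ∑ k ∈ K \ F, w k * Z k ≤ ∑ k ∈ K \ F, δ * Z k :=
                  Finset.sum_le_sum fun k hk => mul_le_mul_of_nonneg_right
                    (hFw k (Finset.mem_sdiff.1 hk).2) (hZ0 k)
              _ = δ * ∑ k ∈ K \ F, Z k := (Finset.mul_sum _ _ _).symm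
              _ ≤ δ * M := mul_le_mul_of_nonneg_left (hZM _) hδ.le
    have hs : Summable fun k => w k * Z k := summable_of_sum_le h0 hb
    exact ⟨hs.sum_le_tsum _ fun k _ => h0 k, hs.tsum_le_of_sum_le hb⟩
  have hFlim : Tendsto (fun b => ∑ k ∈ F, w k * X b k) l (𝓝 (∑ k ∈ F, w k * Y k)) :=
    tendsto_finsetSum _ fun k _ => (hX k).const_mul (w k)
  filter_upwards [hX0, hXM, Metric.tendsto_nhds.1 hFlim (ε / 2) (by positivity)] with b h0 hm hb
  have h1 := key (X b) h0 hm
  have h2 := key Y hY0 hYM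
  rw [Real.dist_eq, abs_lt] at hb ⊢
  constructor <;> linarith [hb.1, hb.2, h1.1, h1.2, h2.1, h2.2]

/-- Lebesgue differentiation of the vanishing primitive. -/
theorem ae_eq_zero_of_integral_eq_zero {D : ℝ → ℂ}
    (hD : ∀ T, 0 < T → IntervalIntegrable D volume 0 T)
    (h0 : ∀ T, 0 < T → ∫ s in (0 : ℝ)..T, D s = 0) : ∀ᵐ t ∂timeMeasure, D t = 0 := by
  have h1 : ∀ n : ℕ, ∀ᵐ t, t ∈ uIcc (0 : ℝ) (n + 1) →
      ∀ c ∈ uIcc (0 : ℝ) (n + 1), HasDerivAt (fun x => ∫ s in c..x, D s) (D t) t :=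
    fun n => (hD (n + 1) (by positivity)).ae_hasDerivAt_integral
  rw [timeMeasure, ae_restrict_iff' measurableSet_Ioi]
  filter_upwards [ae_all_iff.2 h1] with t ht ht0
  obtain ⟨n, hn⟩ := exists_nat_ge t
  have hmem : t ∈ uIcc (0 : ℝ) (n + 1) := by
    rw [uIcc_of_le (by positivity)]
    exact ⟨le_of_lt ht0, by linarith⟩
  have hd := ht n hmem 0 left_mem_uIcc
  refine hd.unique ((hasDerivAt_const t (0 : ℂ)).congr_of_eventuallyEq ?_)
  filter_upwards [Ioi_mem_nhds ht0] with x hx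
  exact h0 x hx

/-- Weak convergence in time of equi-Lipschitz functions is pointwise convergence. -/
theorem exists_tendsto_of_tendsto_integral {f : ℕ → ℝ → ℂ} {g : ℝ → ℂ} {C M : ℝ}
    (hLip : ∀ j s t, 0 ≤ s → s ≤ t → ‖f j t - f j s‖ ≤ C * (t - s))
    (hM : ∀ j t, 0 ≤ t → ‖f j t‖ ≤ M) (hg : ∀ T, 0 < T → IntervalIntegrable g volume 0 T)
    (hconv : ∀ T, 0 < T → Tendsto (fun j => ∫ s in (0 : ℝ)..T, f j s) atTop
      (𝓝 (∫ s in (0 : ℝ)..T, g s))) :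
    ∃ c : ℝ → ℂ, (∀ t, 0 ≤ t → Tendsto (fun j => f j t) atTop (𝓝 (c t))) ∧
      ContinuousOn c (Ici 0) ∧ ∀ᵐ t ∂timeMeasure, c t = g t := by
  have hC : 0 ≤ C := by simpa using (norm_nonneg _).trans (hLip 0 0 1 le_rfl zero_le_one)
  have hcontOf : ∀ φ : ℝ → ℂ, (∀ s t, 0 ≤ s → s ≤ t → ‖φ t - φ s‖ ≤ C * (t - s)) →
      ContinuousOn φ (Ici 0) := by
    intro φ hφ
    refine LipschitzOnWith.continuousOn (K := C.toNNReal) ?_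
    refine LipschitzOnWith.of_dist_le_mul fun x hx y hy => ?_
    rw [Real.coe_toNNReal C hC, dist_eq_norm, Real.dist_eq]
    rcases le_total x y with h | h
    · rw [norm_sub_rev, abs_sub_comm, abs_of_nonneg (sub_nonneg.2 h)]
      exact hφ x y hx h
    · rw [abs_of_nonneg (sub_nonneg.2 h)]
      exact hφ y x hy h
  have hInt : ∀ φ : ℝ → ℂ, ContinuousOn φ (Ici 0) → ∀ s t, 0 ≤ s → s ≤ t →
      IntervalIntegrable φ volume s t := by
    intro φ hφ s t hs hst
    refine ContinuousOn.intervalIntegrable (hφ.mono ?_)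
    rw [uIcc_of_le hst]
    exact fun x hx => hs.trans hx.1
  have hfc := fun j => hcontOf (f j) (hLip j)
  have hlim : ∀ t, 0 ≤ t → ∃ z, Tendsto (fun j => f j t) atTop (𝓝 z) := by
    intro t ht
    refine cauchySeq_tendsto_of_complete ?_
    have hconv0 : ∀ T, 0 ≤ T → Tendsto (fun j => ∫ s in (0 : ℝ)..T, f j s) atTop
        (𝓝 (∫ s in (0 : ℝ)..T, g s)) := by
      intro T hT
      rcases hT.eq_or_lt with rfl | hT
      · simp
      · exact hconv T hT
    rw [Metric.cauchySeq_iff']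
    intro ε hε
    -- The mean over [t, t + h] differs from the value at t by at most Ch < ε/4. Two such errors and
    -- ε/2 from the convergent time integrals give the Cauchy property.
    set h : ℝ := ε / (4 * (C + 1)) with hh
    have hh0 : 0 < h := by positivity
    have hCh : C * h < ε / 4 := by
      rw [hh, mul_div_assoc', div_lt_div_iff₀ (by positivity) (by norm_num)]
      nlinarith
    have hmean : ∀ j, ‖(h : ℂ) * f j t
        - ((∫ s in (0 : ℝ)..(t + h), f j s) - ∫ s in (0 : ℝ)..t, f j s)‖ ≤ C * h * h := by
      intro j
      have hI := hInt (f j) (hfc j) t (t + h) ht (by linarith)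
      have h1 : (h : ℂ) * f j t = ∫ _ in t..(t + h), f j t := by
        rw [intervalIntegral.integral_const, add_sub_cancel_left, Complex.real_smul]
      rw [intervalIntegral.integral_interval_sub_left
        (hInt (f j) (hfc j) 0 (t + h) le_rfl (by linarith)) (hInt (f j) (hfc j) 0 t le_rfl ht), h1,
        ← intervalIntegral.integral_sub intervalIntegrable_const hI]
      have h2 : ∀ s ∈ uIoc t (t + h), ‖f j t - f j s‖ ≤ C * h := by
        intro s hs
        rw [uIoc_of_le (by linarith)] at hs
        rw [norm_sub_rev]
        refine (hLip j t s ht hs.1.le).trans (mul_le_mul_of_nonneg_left ?_ hC)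
        linarith [hs.2]
      have h3 := intervalIntegral.norm_integral_le_of_norm_le_const h2
      rwa [add_sub_cancel_left, abs_of_pos hh0] at h3
    have hcau := ((hconv0 (t + h) (by linarith)).sub (hconv0 t ht)).cauchySeq
    obtain ⟨n₀, hn₀⟩ := Metric.cauchySeq_iff'.1 hcau (h * (ε / 2)) (by positivity)
    refine ⟨n₀, fun n hn => ?_⟩
    have h1 := hn₀ n hn
    rw [dist_eq_norm] at h1 ⊢
    have h2 : h * ‖f n t - f n₀ t‖ < h * ε := by
      calc h * ‖f n t - f n₀ t‖ = ‖(h : ℂ) * f n t - (h : ℂ) * f n₀ t‖ := by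
            rw [← mul_sub, norm_mul, Complex.norm_real, Real.norm_of_nonneg hh0.le]
        _ ≤ C * h * h + h * (ε / 2) + C * h * h := by
            have h3 := hmean n
            have h4 := hmean n₀
            rw [norm_sub_rev] at h4
            have h5 := (norm_add_le _ _).trans (add_le_add ((norm_add_le _ _).trans
              (add_le_add h3 h1.le)) h4)
            refine le_trans (le_of_eq ?_) h5
            congr 1
            ring
        _ < h * ε := by
            have := mul_lt_mul_of_pos_right hCh hh0
            linarith
    exact lt_of_mul_lt_mul_left h2 hh0.le
  choose! c hc using hlim
  have hcLip : ∀ s t, 0 ≤ s → s ≤ t → ‖c t - c s‖ ≤ C * (t - s) := fun s t hs hst =>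
    le_of_tendsto (((hc t (hs.trans hst)).sub (hc s hs)).norm)
      (Eventually.of_forall fun j => hLip j s t hs hst)
  have hcc := hcontOf c hcLip
  refine ⟨c, hc, hcc, ?_⟩
  have hD := ae_eq_zero_of_integral_eq_zero (D := fun s => c s - g s)
    (fun T hT => (hInt c hcc 0 T le_rfl hT.le).sub (hg T hT)) fun T hT => ?_
  · filter_upwards [hD] with t ht
    exact sub_eq_zero.1 ht
  · rw [intervalIntegral.integral_sub (hInt c hcc 0 T le_rfl hT.le) (hg T hT), sub_eq_zero]
    refine tendsto_nhds_unique ?_ (hconv T hT)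
    refine intervalIntegral.tendsto_integral_filter_of_dominated_convergence (fun _ => M)
      (Eventually.of_forall fun j => ?_) (Eventually.of_forall fun j => ?_)
      intervalIntegrable_const ?_
    · rw [uIoc_of_le hT.le]
      exact (hInt (f j) (hfc j) 0 T le_rfl hT.le).1.aestronglyMeasurable
    · refine Eventually.of_forall fun s hs => hM j s ?_
      rw [uIoc_of_le hT.le] at hs
      exact hs.1.le
    · refine Eventually.of_forall fun s hs => hc s ?_
      rw [uIoc_of_le hT.le] at hs
      exact hs.1.le

end VectorMixing

open scoped ComplexConjugate

namespace VectorMixing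

variable {d : ℕ} {L : ℝ} [hL : Fact (0 < L)]

/-! ### Uniform estimates and convergence of the Fourier coefficients -/

theorem tendsto_laplaceSymbol_cofinite :
    Tendsto (laplaceSymbol L : (Fin d → ℤ) → ℝ) cofinite atTop := by
  have hκ : 0 < (2 * Real.pi / L) ^ 2 := pow_pos (div_pos (by positivity) hL.out) 2
  refine tendsto_atTop.2 fun R => ?_
  rw [eventually_cofinite]
  obtain ⟨n, hn⟩ := exists_nat_ge (R / (2 * Real.pi / L) ^ 2)
  refine (freqBox d n).finite_toSet.subset fun k hk => ?_
  rw [mem_ofPred_eq, not_le, laplaceSymbol] at hk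
  refine Finset.mem_coe.2 (mem_freqBox.2 fun i => ?_)
  have h1 : ∑ i, (k i : ℝ) ^ 2 < n := by
    refine lt_of_lt_of_le ?_ hn
    rwa [lt_div_iff₀ hκ, mul_comm]
  have h2 : (k i : ℝ) ^ 2 < n := lt_of_le_of_lt (Finset.single_le_sum (f := fun i => (k i : ℝ) ^ 2)
    (fun _ _ => sq_nonneg _) (Finset.mem_univ i)) h1
  have h3 : (k i) ^ 2 < (n : ℤ) := by exact_mod_cast h2
  have h4 : |k i| ≤ (k i) ^ 2 := by
    rw [← sq_abs]
    have := abs_nonneg (k i)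
    rcases eq_or_ne (k i) 0 with h | h
    · simp [h]
    · have : 1 ≤ |k i| := Int.one_le_abs h
      nlinarith
  linarith

theorem tendsto_laplaceSymbol_rpow_neg {α : ℝ} (hα : 0 < α) :
    Tendsto (fun k : Fin d → ℤ => laplaceSymbol L k ^ (-α)) cofinite (𝓝 0) :=
  (tendsto_rpow_neg_atTop hα).comp tendsto_laplaceSymbol_cofinite

namespace IsSpectralSolution

variable {N : ℕ} {U v : ℝ → Torus d L → Vec d} {u₀ : Torus d L → Vec d} {q : ℝ}
  {G : ℝ → Torus d L → Mat d}

theorem fourierCoeffVec_initial_eq (hv : IsSpectralSolution N U u₀ v) (hu : IsInitialDatum u₀)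
    {k : Fin d → ℤ} (hk : k ∈ freqBox d N) (i : Fin d) :
    fourierCoeffVec (v 0) k i = fourierCoeffVec u₀ k i := by
  rw [hv.fourierCoeffVec_initial hk,
    lerayCoeff_eq_of_divFree hu.divFree (integrable_of_memLp_two hu.memLp)]

theorem weightedSum_one_le_initial (hv : IsSpectralSolution N U u₀ v) (hu : IsInitialDatum u₀) :
    weightedSum N (fun _ => 1) (v 0) ≤ l2Norm u₀ ^ 2 / L ^ d := by
  refine le_trans (le_of_eq ?_) (weightedSum_one_le hu.memLp N)
  refine Finset.sum_congr rfl fun k hk => ?_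
  simp only [hv.fourierCoeffVec_initial_eq hu hk]

/-- The energy of any set of modes is controlled by the initial energy. -/
theorem sum_norm_sq_le (hv : IsSpectralSolution N U u₀ v) (hU : IsAdmissibleVelocity q U G)
    (hq : 2 ≤ q) (hu : IsInitialDatum u₀) {t : ℝ} (ht : 0 ≤ t) (K : Finset (Fin d → ℤ)) :
    ∑ k ∈ K, ∑ i, ‖fourierCoeffVec (v t) k i‖ ^ 2 ≤ l2Norm u₀ ^ 2 / L ^ d := by
  classical
  refine le_trans ?_ (hv.weightedSum_one_le_initial hu)
  rw [← hv.weightedSum_one_eq hU hq ht]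
  simp only [weightedSum, one_mul]
  calc _ ≤ ∑ k ∈ K ∪ freqBox d N, ∑ i, ‖fourierCoeffVec (v t) k i‖ ^ 2 :=
        Finset.sum_le_sum_of_subset_of_nonneg Finset.subset_union_left fun _ _ _ =>
          Finset.sum_nonneg fun _ _ => by positivity
    _ = _ := (Finset.sum_subset Finset.subset_union_right fun k _ hk => by
        simp [hv.fourierCoeffVec_eq_zero ht hk]).symm

theorem norm_fourierCoeffVec_le (hv : IsSpectralSolution N U u₀ v)
    (hU : IsAdmissibleVelocity q U G) (hq : 2 ≤ q) (hu : IsInitialDatum u₀) {t : ℝ} (ht : 0 ≤ t)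
    (k : Fin d → ℤ) (i : Fin d) :
    ‖fourierCoeffVec (v t) k i‖ ≤ √(l2Norm u₀ ^ 2 / L ^ d) := by
  refine Real.le_sqrt_of_sq_le (le_trans ?_ (hv.sum_norm_sq_le hU hq hu ht {k}))
  rw [Finset.sum_singleton]
  exact Finset.single_le_sum (f := fun i => ‖fourierCoeffVec (v t) k i‖ ^ 2)
    (fun _ _ => by positivity) (Finset.mem_univ i)

theorem l2Coeff_le (hv : IsSpectralSolution N U u₀ v)
    (hU : IsAdmissibleVelocity q U G) (hq : 2 ≤ q) (hu : IsInitialDatum u₀) {t : ℝ} (ht : 0 ≤ t)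
    (i : Fin d) :
    l2Coeff (freqBox d N) (fun k => fourierCoeffVec (v t) k i) ≤ √(l2Norm u₀ ^ 2 / L ^ d) := by
  refine Real.sqrt_le_sqrt (le_trans ?_ (hv.sum_norm_sq_le hU hq hu ht (freqBox d N)))
  exact Finset.sum_le_sum fun k _ => Finset.single_le_sum
    (f := fun i => ‖fourierCoeffVec (v t) k i‖ ^ 2) (fun _ _ => by positivity) (Finset.mem_univ i)

/-- The Fourier coefficients are Lipschitz in time, uniformly in the truncation. -/
theorem norm_fourierCoeffVec_sub_le (hv : IsSpectralSolution N U u₀ v)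
    (hU : IsAdmissibleVelocity q U G) (hq : 2 ≤ q) (hu : IsInitialDatum u₀) {K : ℝ} (hK0 : 0 ≤ K)
    (hK : ∀ᵐ s ∂timeMeasure, MemLp (U s) 2 volume ∧ l2Norm (U s) ≤ K) (k : Fin d → ℤ) (i : Fin d)
    {s t : ℝ} (hs : 0 ≤ s) (hst : s ≤ t) :
    ‖fourierCoeffVec (v t) k i - fourierCoeffVec (v s) k i‖
      ≤ 2 * (d * ((∑ j, ‖derivSymbol L j k‖) *
        (√(l2Norm u₀ ^ 2 / L ^ d) * (K / √(L ^ d))))) * (t - s) := by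
  have ht := hs.trans hst
  by_cases hk : k ∈ freqBox d N
  · rw [hv.fourierCoeffVec_eq_sub_integral hU hq hk i ht,
      hv.fourierCoeffVec_eq_sub_integral hU hq hk i hs, sub_sub_sub_cancel_left, norm_sub_rev,
      intervalIntegral.integral_interval_sub_left (hv.intervalIntegrable_rateCoeff hU hq k i ht)
      (hv.intervalIntegrable_rateCoeff hU hq k i hs)]
    have h := intervalIntegral.norm_integral_le_of_norm_le_const_ae (a := s) (b := t)
      (f := rateCoeff N U v k i) (C := 2 * (d * ((∑ j, ‖derivSymbol L j k‖) *
        (√(l2Norm u₀ ^ 2 / L ^ d) * (K / √(L ^ d)))))) ?_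
    · rwa [abs_of_nonneg (sub_nonneg.2 hst)] at h
    · rw [uIoc_of_le hst, ← ae_restrict_iff' measurableSet_Ioc]
      filter_upwards [ae_restrict_of_ae_timeMeasure hK hs t,
        ae_restrict_of_ae_timeMeasure hU.divFree hs t, ae_restrict_mem measurableSet_Ioc]
        with x hx hdiv hmem
      have hx0 : 0 ≤ x := hs.trans hmem.1.le
      exact hv.norm_rateCoeff_le hx0 hdiv hx.1 hx.2 (Real.sqrt_nonneg _)
        (hv.l2Coeff_le hU hq hu hx0) k i
  · rw [hv.fourierCoeffVec_eq_zero ht hk, hv.fourierCoeffVec_eq_zero hs hk, sub_self, norm_zero]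
    exact mul_nonneg (by positivity) (sub_nonneg.2 hst)

end IsSpectralSolution

/-- A time integral of Fourier coefficients as a pairing with test fields. -/
theorem integral_fourierCoeffVec {F : ℝ → Torus d L → Vec d} {T : ℝ} (hT : 0 ≤ T)
    (k : Fin d → ℤ) (i : Fin d) (hF : ∀ᵐ s ∂volume.restrict (Ioc 0 T), Integrable (F s) volume)
    (hInt : IntervalIntegrable (fun s => fourierCoeffVec (F s) k i) volume 0 T) :
    ∫ s in (0 : ℝ)..T, fourierCoeffVec (F s) k i
      = (((L ^ d)⁻¹ * ∫ s in (0 : ℝ)..T, ∫ x, inner ℝ (F s x)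
          (EuclideanSpace.single i (character (-k) x).re) : ℝ) : ℂ)
        + (((L ^ d)⁻¹ * ∫ s in (0 : ℝ)..T, ∫ x, inner ℝ (F s x)
          (EuclideanSpace.single i (character (-k) x).im) : ℝ) : ℂ) * Complex.I := by
  have hin : ∀ (z : Vec d) (c : ℝ), inner ℝ z (EuclideanSpace.single i c) = z i * c := by
    intro z c
    rw [EuclideanSpace.inner_single_right]
    simp [mul_comm]
  simp only [hin]
  apply Complex.ext
  · have h := Complex.reCLM.intervalIntegral_comp_comm hInt
    simp only [Complex.reCLM_apply] at h
    rw [← h]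
    simp only [Complex.add_re, Complex.ofReal_re, Complex.re_ofReal_mul, Complex.I_re, mul_zero,
      add_zero]
    rw [← intervalIntegral.integral_const_mul, intervalIntegral.integral_of_le hT, intervalIntegral.integral_of_le hT]
    refine integral_congr_ae ?_
    filter_upwards [hF] with s hs
    rw [fourierCoeffVec, Complex.re_ofReal_mul, integral_re_mul (integrable_apply hs i) (by fun_prop)]
  · have h := Complex.imCLM.intervalIntegral_comp_comm hInt
    simp only [Complex.imCLM_apply] at h
    rw [← h]
    simp only [Complex.add_im, Complex.ofReal_im, Complex.im_ofReal_mul, Complex.I_im, mul_one,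
      zero_add]
    rw [← intervalIntegral.integral_const_mul, intervalIntegral.integral_of_le hT, intervalIntegral.integral_of_le hT]
    refine integral_congr_ae ?_
    filter_upwards [hF] with s hs
    rw [fourierCoeffVec, Complex.im_ofReal_mul, integral_im_mul (integrable_apply hs i) (by fun_prop)]

theorem intervalIntegrable_fourierCoeffVec {u : ℝ → Torus d L → Vec d} {K : ℝ≥0}
    (hu : AEStronglyMeasurable (fun p : ℝ × Torus d L => u p.1 p.2) (timeMeasure.prod volume))
    (hK : ∀ᵐ t ∂timeMeasure, MemLp (u t) 2 volume ∧ eLpNorm (u t) 2 volume ≤ K)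
    (k : Fin d → ℤ) (i : Fin d) {T : ℝ} (hT : 0 < T) :
    IntervalIntegrable (fun s => fourierCoeffVec (u s) k i) volume 0 T := by
  rw [intervalIntegrable_iff_integrableOn_Ioc_of_le hT.le]
  refine Integrable.of_bound ((aestronglyMeasurable_fourierCoeffVec hu k i).mono_measure
    (Measure.restrict_mono (fun x hx => hx.1) le_rfl)) (K / √(L ^ d)) ?_
  filter_upwards [ae_restrict_of_ae_timeMeasure hK le_rfl T] with s hs
  refine (norm_fourierCoeffVec_le_l2Norm hs.1 k i).trans ?_
  have : l2Norm (u s) ≤ K := ENNReal.toReal_le_coe_of_le_coe hs.2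
  gcongr

/-- Weak-* convergence implies convergence of the time integrals of the Fourier coefficients. -/
theorem tendsto_integral_fourierCoeffVec {U : ℝ → Torus d L → Vec d} {u₀ : Torus d L → Vec d}
    {v : ℕ → ℝ → Torus d L → Vec d} {u : ℝ → Torus d L → Vec d}
    (hv : ∀ N, IsSpectralSolution N U u₀ (v N)) {n : ℕ → ℕ} {K : ℝ≥0}
    (hu : AEStronglyMeasurable (fun p : ℝ × Torus d L => u p.1 p.2) (timeMeasure.prod volume))
    (hK : ∀ᵐ t ∂timeMeasure, MemLp (u t) 2 volume ∧ eLpNorm (u t) 2 volume ≤ K)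
    (hn : ∀ T : ℝ, 0 < T → ∀ g : ℝ → Torus d L → Vec d,
      AEStronglyMeasurable (fun p : ℝ × Torus d L => g p.1 p.2)
        ((volume.restrict (Ioc 0 T)).prod volume) →
      ∫⁻ t in Ioc 0 T, eLpNorm (g t) 2 volume < ⊤ →
      Tendsto (fun j => ∫ t in (0 : ℝ)..T, ∫ x, inner ℝ (v (n j) t x) (g t x)) atTop
        (𝓝 (∫ t in (0 : ℝ)..T, ∫ x, inner ℝ (u t x) (g t x))))
    (k : Fin d → ℤ) (i : Fin d) {T : ℝ} (hT : 0 < T) :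
    Tendsto (fun j => ∫ s in (0 : ℝ)..T, fourierCoeffVec (v (n j) s) k i) atTop
      (𝓝 (∫ s in (0 : ℝ)..T, fourierCoeffVec (u s) k i)) := by
  have hvint : ∀ N, IntervalIntegrable (fun s => fourierCoeffVec (v N s) k i) volume 0 T := by
    intro N
    refine ContinuousOn.intervalIntegrable (((hv N).continuousOn_fourierCoeffVec k i).mono ?_)
    rw [uIcc_of_le hT.le]
    exact Icc_subset_Ici_self
  have hvI : ∀ N, ∀ᵐ s ∂volume.restrict (Ioc 0 T), Integrable (v N s) volume := by
    intro N
    filter_upwards [ae_restrict_mem measurableSet_Ioc] with s hs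
    exact integrable_of_memLp_two ((hv N).memLp hs.1.le)
  have huI : ∀ᵐ s ∂volume.restrict (Ioc 0 T), Integrable (u s) volume := by
    filter_upwards [ae_restrict_of_ae_timeMeasure hK le_rfl T] with s hs
    exact integrable_of_memLp_two hs.1
  have hpair : ∀ φ : Torus d L → ℝ, Continuous φ →
      Tendsto (fun j => ∫ t in (0 : ℝ)..T, ∫ x, inner ℝ (v (n j) t x) (EuclideanSpace.single i (φ x)))
        atTop (𝓝 (∫ t in (0 : ℝ)..T, ∫ x, inner ℝ (u t x) (EuclideanSpace.single i (φ x)))) := by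
    intro φ hφ
    have hc : Continuous fun x => (EuclideanSpace.single i (φ x) : Vec d) := by
      refine (PiLp.continuous_toLp 2 _).comp (continuous_pi fun j => ?_)
      rcases eq_or_ne j i with rfl | hj
      · simpa using hφ
      · simpa [Pi.single_eq_of_ne hj] using continuous_const
    refine hn T hT (fun _ x => EuclideanSpace.single i (φ x))
      (hc.comp continuous_snd).aestronglyMeasurable ?_
    rw [setLIntegral_const]
    refine ENNReal.mul_lt_top ?_ (by simp)
    exact (hc.memLp_of_hasCompactSupport (HasCompactSupport.of_compactSpace _)).eLpNorm_lt_top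
  rw [integral_fourierCoeffVec hT.le k i huI (intervalIntegrable_fourierCoeffVec hu hK k i hT)]
  simp only [integral_fourierCoeffVec hT.le k i (hvI _) (hvint _)]
  have hre := (hpair (fun x => (character (-k) x).re)
    (Complex.continuous_re.comp (continuous_character _))).const_mul (L ^ d)⁻¹
  have him := (hpair (fun x => (character (-k) x).im)
    (Complex.continuous_im.comp (continuous_character _))).const_mul (L ^ d)⁻¹
  exact ((Complex.continuous_ofReal.tendsto _).comp hre).add
    (((Complex.continuous_ofReal.tendsto _).comp him).mul_const _)

end VectorMixing

open scoped ComplexConjugate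

namespace VectorMixing

variable {d : ℕ} {L : ℝ} [hL : Fact (0 < L)]

/-! ### The limit of the spectral approximations -/

theorem exists_limit_coefficients {U : ℝ → Torus d L → Vec d} {u₀ : Torus d L → Vec d}
    {v : ℕ → ℝ → Torus d L → Vec d} {u : ℝ → Torus d L → Vec d} {q : ℝ} {G : ℝ → Torus d L → Mat d}
    (hU : IsAdmissibleVelocity q U G) (hq : 2 ≤ q) (hu₀ : IsInitialDatum u₀)
    (hv : ∀ N, IsSpectralSolution N U u₀ (v N)) (hu : IsSubsequentialLimit v u) :
    ∃ n : ℕ → ℕ, StrictMono n ∧ ∃ c : (Fin d → ℤ) → Fin d → ℝ → ℂ,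
      (∀ k i t, 0 ≤ t →
        Tendsto (fun j => fourierCoeffVec (v (n j) t) k i) atTop (𝓝 (c k i t))) ∧
      (∀ k i, ContinuousOn (c k i) (Ici 0)) ∧
      ∀ᵐ t ∂timeMeasure, MemLp (u t) 2 volume ∧ ∀ k i, c k i t = fourierCoeffVec (u t) k i := by
  obtain ⟨hmeas, ⟨K, hK⟩, n, hn, hconv⟩ := hu
  obtain ⟨M, hM0, hM⟩ := hU.exists_l2Norm_le hq
  have h := fun k i => exists_tendsto_of_tendsto_integral
    (f := fun j t => fourierCoeffVec (v (n j) t) k i) (g := fun t => fourierCoeffVec (u t) k i)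
    (fun j s t hs hst => (hv (n j)).norm_fourierCoeffVec_sub_le hU hq hu₀ hM0 hM k i hs hst)
    (fun j t ht => (hv (n j)).norm_fourierCoeffVec_le hU hq hu₀ ht k i)
    (fun T hT => intervalIntegrable_fourierCoeffVec hmeas hK k i hT)
    (fun T hT => tendsto_integral_fourierCoeffVec hv hmeas hK hconv k i hT)
  choose c hc hcc hae using h
  refine ⟨n, hn, c, hc, hcc, ?_⟩
  filter_upwards [hK, ae_all_iff.2 fun k => ae_all_iff.2 fun i => hae k i] with t ht hct
  exact ⟨ht.1, hct⟩

theorem fourierCoeffVec_sub {f g : Torus d L → Vec d} (hf : Integrable f volume)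
    (hg : Integrable g volume) (k : Fin d → ℤ) (i : Fin d) :
    fourierCoeffVec (fun x => f x - g x) k i = fourierCoeffVec f k i - fourierCoeffVec g k i := by
  have h := scalarCoeff_sub ((integrable_apply hf i).ofReal (𝕜 := ℂ))
    ((integrable_apply hg i).ofReal (𝕜 := ℂ)) k
  simp only [RCLike.ofReal_eq_complex_ofReal] at h
  simp only [fourierCoeffVec_eq_scalarCoeff, ← h, PiLp.sub_apply, Complex.ofReal_sub]

theorem exists_continuousRepresentative {α E : ℝ} (hα : 0 < α) {u₀ : Torus d L → Vec d}
    {u : ℝ → Torus d L → Vec d} {c : (Fin d → ℤ) → Fin d → ℝ → ℂ} (hu₀ : MemLp u₀ 2 volume)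
    (hcont : ∀ k i, ContinuousOn (c k i) (Ici 0))
    (hconj : ∀ k i t, 0 ≤ t → c (-k) i t = conj (c k i t))
    (hsum : ∀ t, 0 ≤ t → ∀ K : Finset (Fin d → ℤ), ∑ k ∈ K, ∑ i, ‖c k i t‖ ^ 2 ≤ E)
    (h0 : ∀ k i, c k i 0 = fourierCoeffVec u₀ k i)
    (hae : ∀ᵐ t ∂timeMeasure, MemLp (u t) 2 volume ∧ ∀ k i, c k i t = fourierCoeffVec (u t) k i) :
    ∃ w : ℝ → Torus d L → Vec d, IsContinuousRepresentative (-α) u₀ u w ∧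
      ∀ t, 0 ≤ t → ∀ k i, fourierCoeffVec (w t) k i = c k i t := by
  -- At almost every positive time u itself is taken, at time zero u₀, and on the remaining null set
  -- a Riesz–Fischer sum. Agreement with u thus holds by construction, without uniqueness of Fourier
  -- coefficients.
  have hex : ∀ t, ∃ f : Torus d L → Vec d, 0 ≤ t → MemLp f 2 volume ∧
      (∀ k i, fourierCoeffVec f k i = c k i t) ∧ (t = 0 → f = u₀) ∧
      (0 < t → MemLp (u t) 2 volume ∧ (∀ k i, c k i t = fourierCoeffVec (u t) k i) → f = u t) := by
    intro t
    by_cases ht0 : t = 0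
    · exact ⟨u₀, fun _ => ⟨hu₀, fun k i => by rw [ht0, h0], fun _ => rfl,
        fun hpos => absurd ht0 hpos.ne'⟩⟩
    by_cases hgood : MemLp (u t) 2 volume ∧ ∀ k i, c k i t = fourierCoeffVec (u t) k i
    · exact ⟨u t, fun _ => ⟨hgood.1, fun k i => (hgood.2 k i).symm, fun h => absurd h ht0,
        fun _ _ => rfl⟩⟩
    by_cases ht : 0 ≤ t
    · obtain ⟨f, hf, hfc⟩ := exists_memLp_fourierCoeffVec_eq (L := L) (c := fun k i => c k i t)
        (fun i => summable_of_sum_le (c := E) (fun k => by positivity) fun K =>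
          (Finset.sum_le_sum fun k _ => Finset.single_le_sum (f := fun i => ‖c k i t‖ ^ 2)
            (fun _ _ => by positivity) (Finset.mem_univ i)).trans (hsum t ht K))
        fun k i => hconj k i t ht
      exact ⟨f, fun _ => ⟨hf, hfc, fun h => absurd h ht0, fun _ h => absurd h hgood⟩⟩
    · exact ⟨0, fun h => absurd h ht⟩
  choose w hw using hex
  refine ⟨w, ⟨?_, fun t ht => (hw t ht).1, ?_, fun t ht => ?_⟩, fun t ht => (hw t ht).2.1⟩
  · have hpos : ∀ᵐ t ∂timeMeasure, t ∈ Ioi (0 : ℝ) := ae_restrict_mem measurableSet_Ioi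
    filter_upwards [hae, hpos] with t ht htp
    rw [(hw t (le_of_lt htp)).2.2.2 htp ht]
  · rw [(hw 0 le_rfl).2.2.1 rfl]
  · have hsq : ∀ z z' : ℂ, ‖z - z'‖ ^ 2 ≤ 2 * ‖z‖ ^ 2 + 2 * ‖z'‖ ^ 2 := fun z z' => by
      have h1 := norm_sub_le z z'
      nlinarith [sq_nonneg (‖z‖ - ‖z'‖), norm_nonneg (z - z')]
    have hbd : ∀ᶠ τ in 𝓝[Ici 0] t, ∀ K : Finset (Fin d → ℤ),
        ∑ k ∈ K, ∑ i, ‖c k i τ - c k i t‖ ^ 2 ≤ 4 * E := by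
      filter_upwards [self_mem_nhdsWithin] with τ hτ K
      calc _ ≤ ∑ k ∈ K, ∑ i, (2 * ‖c k i τ‖ ^ 2 + 2 * ‖c k i t‖ ^ 2) :=
            Finset.sum_le_sum fun k _ => Finset.sum_le_sum fun i _ => hsq _ _
        _ = 2 * ∑ k ∈ K, ∑ i, ‖c k i τ‖ ^ 2 + 2 * ∑ k ∈ K, ∑ i, ‖c k i t‖ ^ 2 := by
            simp only [Finset.sum_add_distrib, Finset.mul_sum]
        _ ≤ 4 * E := by linarith [hsum τ hτ K, hsum t ht K]
    have hE : 0 ≤ E := by simpa using hsum t ht ∅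
    have hlim := tendsto_tsum_mul_of_bounded (l := 𝓝[Ici 0] t)
      (fun k => Real.rpow_nonneg (laplaceSymbol_nonneg (L := L) k) (-α))
      (tendsto_laplaceSymbol_rpow_neg hα) (X := fun τ k => ∑ i, ‖c k i τ - c k i t‖ ^ 2)
      (Y := fun _ => 0) (M := 4 * E)
      (Eventually.of_forall fun τ k => Finset.sum_nonneg fun _ _ => by positivity) hbd
      (fun _ => le_rfl) (fun K => by simpa using hE) fun k => by
        have h1 : Tendsto (fun τ => ∑ i, ‖c k i τ - c k i t‖ ^ 2) (𝓝[Ici 0] t)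
            (𝓝 (∑ i, ‖c k i t - c k i t‖ ^ 2)) :=
          tendsto_finsetSum _ fun i _ => (((hcont k i t ht).tendsto).sub_const _).norm.pow 2
        simpa using h1
    have h2 : Tendsto (fun τ => √(L ^ d * ∑' k, laplaceSymbol L k ^ (-α) *
        ∑ i, ‖c k i τ - c k i t‖ ^ 2)) (𝓝[Ici 0] t) (𝓝 0) := by
      have := (hlim.const_mul (L ^ d)).sqrt
      simpa using this
    refine h2.congr' ?_
    filter_upwards [self_mem_nhdsWithin] with τ hτ
    rw [homSobolevNorm_neg_eq]
    have hIτ := integrable_of_memLp_two (hw τ hτ).1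
    have hIt := integrable_of_memLp_two (hw t ht).1
    simp only [fourierCoeffVec_sub hIτ hIt, (hw τ hτ).2.1, (hw t ht).2.1]

/-- The lower bound for limits of the spectral approximations. -/
theorem exists_representative_mixingLowerBound_le {α q r C : ℝ} {U : ℝ → Torus d L → Vec d}
    {G : ℝ → Torus d L → Mat d} {u₀ : Torus d L → Vec d} {v : ℕ → ℝ → Torus d L → Vec d}
    {u : ℝ → Torus d L → Vec d} {η : ℕ → ℝ} (hα : 1 / 2 ≤ α) (hα1 : α < 1) (hq : 2 ≤ q)
    (hr : 1 ≤ r) (hC : 0 ≤ C) (hη : ∀ N, 0 ≤ η N) (hη0 : Tendsto η atTop (𝓝 0))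
    (hbound : ∀ (N : ℕ) (U : Torus d L → Vec d), IsDivFree U →
      MemLp U (ENNReal.ofReal q) volume → ∀ B : ℝ, 0 ≤ B → ∀ a : (Fin d → ℤ) → ℂ,
      ∀ G : Torus d L → Mat d, IsWeakGradient U G → MemLp G (ENNReal.ofReal q) volume →
        eLpNorm G (ENNReal.ofReal q) volume ≤ ENNReal.ofReal B →
        |(∑ k ∈ freqBox d N, ∑ l ∈ freqBox d N, a k * conj (a l) *
          ((laplaceSymbol L l ^ (-α) : ℝ) : ℂ) * transportCoeff (truncComp N U) k l).re|
        ≤ C * B * negCoeff (freqBox d N) (laplaceSymbol L) α a ^ (2 - (1 - α) / α)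
          * l2Coeff (freqBox d N) a ^ ((1 - α) / α)
          + η N * B * l2Coeff (freqBox d N) a ^ 2)
    (hU : IsAdmissibleVelocity q U G) (hu₀ : IsInitialDatum u₀)
    (hv : ∀ N, IsSpectralSolution N U u₀ (v N)) (hu : IsSubsequentialLimit v u) :
    ∃ w : ℝ → Torus d L → Vec d, IsContinuousRepresentative (-α) u₀ u w ∧
      ∀ t, 0 ≤ t →
        mixingLowerBound d α r (((2 * Real.pi / L) ^ (-α)) ^ (mixingPower d α r - (1 - α) / α)
          * ((L ^ d)⁻¹ * d * C)) t (homSobolevNorm (-α) u₀) (l2Norm u₀) (supLqNorm q G)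
        ≤ homSobolevNorm (-α) (w t) := by
  have hα0 : 0 < α := by linarith
  have hκ : 0 < 2 * Real.pi / L := div_pos (by positivity) hL.out
  have hp1 : (1 - α) / α ≤ 1 := (div_le_one hα0).2 (by linarith)
  obtain ⟨n, hn, c, hc, hcont, hae⟩ := exists_limit_coefficients hU hq hu₀ hv hu
  set E := l2Norm u₀ ^ 2 / L ^ d with hEdef
  have hsum : ∀ t, 0 ≤ t → ∀ K : Finset (Fin d → ℤ), ∑ k ∈ K, ∑ i, ‖c k i t‖ ^ 2 ≤ E := by
    intro t ht K
    refine le_of_tendsto (tendsto_finsetSum _ fun k _ => tendsto_finsetSum _ fun i _ =>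
      (hc k i t ht).norm.pow 2) (Eventually.of_forall fun j => ?_)
    exact (hv (n j)).sum_norm_sq_le hU hq hu₀ ht K
  have hconj : ∀ k i t, 0 ≤ t → c (-k) i t = conj (c k i t) := by
    intro k i t ht
    refine tendsto_nhds_unique (hc (-k) i t ht) ?_
    refine ((Complex.continuous_conj.tendsto _).comp (hc k i t ht)).congr fun j => ?_
    exact (scalarCoeff_neg_of_real (fun x => v (n j) t x i) k).symm
  have h0 : ∀ k i, c k i 0 = fourierCoeffVec u₀ k i := by
    intro k i
    -- Each mode lies in the truncation box from some index on, and from there its initial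
    -- coefficient is constant.
    refine tendsto_nhds_unique (hc k i 0 le_rfl) (tendsto_const_nhds.congr' ?_)
    obtain ⟨m, hm⟩ : ∃ m : ℕ, k ∈ freqBox d m := by
      refine ⟨∑ i, (k i).natAbs, mem_freqBox.2 fun i => ?_⟩
      rw [Int.abs_eq_natAbs]
      exact_mod_cast Finset.single_le_sum (f := fun i => (k i).natAbs) (fun _ _ => Nat.zero_le _)
        (Finset.mem_univ i)
    filter_upwards [hn.tendsto_atTop.eventually_ge_atTop m] with j hj
    exact ((hv (n j)).fourierCoeffVec_initial_eq hu₀ (freqBox_mono hj hm) i).symm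
  obtain ⟨w, hw, hwc⟩ :=
    exists_continuousRepresentative hα0 hu₀.memLp hcont hconj hsum h0 hae
  refine ⟨w, hw, fun t ht => ?_⟩
  have hE0 : 0 ≤ E := by simpa using hsum 0 le_rfl ∅
  set B := supLqNorm q G with hBdef
  have hB : 0 ≤ B := ENNReal.toReal_nonneg
  obtain ⟨K, hK⟩ := hU.bound
  have hG : ∀ᵐ s ∂timeMeasure, eLpNorm (G s) (ENNReal.ofReal q) volume ≤ ENNReal.ofReal B :=
    eLpNorm_le_ofReal_supLqNorm (c := K) ENNReal.coe_ne_top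
      (hK.mono fun s hs => le_add_self.trans hs.2.2)
  have hw0 : ∀ k : Fin d → ℤ, 0 ≤ laplaceSymbol L k ^ (-α) :=
    fun k => Real.rpow_nonneg (laplaceSymbol_nonneg k) _
  set y : ℝ → ℝ := fun t => ∑' k, laplaceSymbol L k ^ (-α) * ∑ i, ‖c k i t‖ ^ 2 with hy
  have hy0 : ∀ t, 0 ≤ y t := fun t => tsum_nonneg fun k =>
    mul_nonneg (hw0 k) (Finset.sum_nonneg fun _ _ => by positivity)
  have hycont : ContinuousOn y (Ici 0) := by
    intro t ht
    refine tendsto_tsum_mul_of_bounded (M := E) hw0 (tendsto_laplaceSymbol_rpow_neg hα0)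
      (Eventually.of_forall fun τ k => Finset.sum_nonneg fun _ _ => by positivity)
      (by filter_upwards [self_mem_nhdsWithin] with τ hτ using hsum τ hτ)
      (fun k => Finset.sum_nonneg fun _ _ => by positivity) (hsum t ht) fun k => ?_
    exact tendsto_finsetSum _ fun i _ => (hcont k i t ht).tendsto.norm.pow 2
  have hylim : ∀ t, 0 ≤ t → Tendsto (fun j => weightedSum (n j)
      (fun k => laplaceSymbol L k ^ (-α)) (v (n j) t)) atTop (𝓝 (y t)) := by
    intro t ht
    simp only [← (hv _).tsum_eq_weightedSum ht]
    refine tendsto_tsum_mul_of_bounded (M := E) hw0 (tendsto_laplaceSymbol_rpow_neg hα0)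
      (Eventually.of_forall fun τ k => Finset.sum_nonneg fun _ _ => by positivity)
      (Eventually.of_forall fun j => (hv (n j)).sum_norm_sq_le hU hq hu₀ ht)
      (fun k => Finset.sum_nonneg fun _ _ => by positivity) (hsum t ht) fun k => ?_
    exact tendsto_finsetSum _ fun i _ => (hc k i t ht).norm.pow 2
  have hbdd : ∀ j s, 0 ≤ s → weightedSum (n j) (fun k => laplaceSymbol L k ^ (-α)) (v (n j) s)
      ≤ ((2 * Real.pi / L) ^ (-α)) ^ 2 * E := by
    intro j s hs
    refine (weightedSum_laplaceSymbol_le hα0 (n j) (v (n j) s)).trans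
      (mul_le_mul_of_nonneg_left ?_ (sq_nonneg _))
    rw [(hv (n j)).weightedSum_one_eq hU hq hs]
    exact (hv (n j)).weightedSum_one_le_initial hu₀
  have hform : ∀ N, ∀ᵐ s ∂timeMeasure, ∀ a : (Fin d → ℤ) → ℂ,
      |(∑ k ∈ freqBox d N, ∑ l ∈ freqBox d N, a k * conj (a l) *
          ((laplaceSymbol L l ^ (-α) : ℝ) : ℂ) * transportCoeff (truncComp N (U s)) k l).re|
        ≤ C * B * negCoeff (freqBox d N) (laplaceSymbol L) α a ^ (2 - (1 - α) / α)
          * l2Coeff (freqBox d N) a ^ ((1 - α) / α)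
          + η N * B * l2Coeff (freqBox d N) a ^ 2 := by
    intro N
    filter_upwards [hG, hU.divFree, hU.weakGradient, hK] with s hs hdiv hwg hm a
    exact hbound N (U s) hdiv hm.1 B hB a (G s) hwg hm.2.1 hs
  -- The limit is taken in the integral inequality rather than in the final bound: the error η
  -- disappears here, and the comparison argument then runs on y with the gradient of the velocity
  -- itself.
  have hineq : ∀ s t, 0 ≤ s → s ≤ t → y s - y t ≤ ∫ x in s..t,
      2 * (L ^ d)⁻¹ * d * (C * B * E ^ ((1 - α) / α / 2)) * y x ^ (1 - (1 - α) / α / 2) := by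
    intro s t hs hst
    have h1 := fun j => (hv (n j)).weightedSum_sub_le hα hα1 hU hq hC hB (hη (n j)) (hform (n j))
      ((hv (n j)).weightedSum_one_le_initial hu₀) hs hst
    refine le_of_tendsto_of_tendsto' ((hylim s hs).sub (hylim t (hs.trans hst))) ?_ h1
    set A := 2 * (L ^ d)⁻¹ * d * (C * B * E ^ ((1 - α) / α / 2)) with hA
    have hLd : 0 < L ^ d := torus_volume_pos
    have hA0 : 0 ≤ A := by positivity
    obtain ⟨H, hH⟩ := hη0.bddAbove_range
    have hHη : ∀ N, η N ≤ H := fun N => hH (mem_range_self N)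
    have hsub : ∀ x ∈ uIoc s t, 0 ≤ x := by
      intro x hx
      rw [uIoc_of_le hst] at hx
      exact hs.trans hx.1.le
    have hexp : 0 ≤ 1 - (1 - α) / α / 2 := by linarith
    refine intervalIntegral.tendsto_integral_filter_of_dominated_convergence
      (fun _ => A * (((2 * Real.pi / L) ^ (-α)) ^ 2 * E) ^ (1 - (1 - α) / α / 2)
        + 2 * (L ^ d)⁻¹ * d * (H * B * E)) (Eventually.of_forall fun j => ?_)
      (Eventually.of_forall fun j => Eventually.of_forall fun x hx => ?_)
      intervalIntegrable_const (Eventually.of_forall fun x hx => ?_)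
    · refine ContinuousOn.aestronglyMeasurable ?_ measurableSet_uIoc
      refine (continuousOn_const.mul ?_).add continuousOn_const
      exact (((hv (n j)).continuousOn_weightedSum _).mono hsub).rpow_const fun _ _ => Or.inr hexp
    · have hz := weightedSum_nonneg (N := n j) hw0 (v (n j) x)
      have hη1 : 0 ≤ η (n j) := hη (n j)
      rw [Real.norm_of_nonneg (by positivity)]
      have hr1 := Real.rpow_le_rpow hz (hbdd j x (hsub x hx)) hexp
      have hη2 := hHη (n j)
      gcongr
    · have h2 := ((hylim x (hsub x hx)).rpow_const (p := 1 - (1 - α) / α / 2) (Or.inr hexp)).const_mul A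
      have h3 := (hη0.comp hn.tendsto_atTop).mul_const (B * E)
      have h4 := h2.add (h3.const_mul (2 * (L ^ d)⁻¹ * d))
      simp only [zero_mul, mul_zero, add_zero, Function.comp_def, ← mul_assoc] at h4
      simpa only [← mul_assoc] using h4
  have hy00 : y 0 ≤ ((2 * Real.pi / L) ^ (-α)) ^ 2 * E :=
    le_of_tendsto (hylim 0 le_rfl) (Eventually.of_forall fun j => hbdd j 0 le_rfl)
  have hmain := mixingLowerBound_le_sqrt hα hα1 hr hC hB hE0 (torus_volume_pos (d := d) (L := L))
    (Real.rpow_nonneg hκ.le (-α)) hycont (fun t _ => hy0 t) hy00 hineq ht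
  have hyt : homSobolevNorm (-α) (w t) = √(L ^ d * y t) := by
    rw [homSobolevNorm_neg_eq]
    simp only [hwc t ht, hy]
  have hyz : homSobolevNorm (-α) u₀ = √(L ^ d * y 0) := by
    rw [homSobolevNorm_neg_eq]
    simp only [h0, hy]
  rw [hEdef, sqrt_mul_l2Norm_sq_div, ← hyt, ← hyz] at hmain
  exact hmain

end VectorMixing

/-! ### The theorem: one constant for the approximations and for their limits -/

theorem lemma3p3 (d : ℕ) (hd : 1 ≤ d) (L : ℝ) [Fact (0 < L)]
    (α q : ℝ) (hα : 1 / 2 ≤ α) (hα1 : α ≤ 1) (hq : 1 ≤ q) (hcrit : q * (1 - α) = d)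
    (r : ℝ) (hr : 1 ≤ r) :
    ∃ C : ℝ, 0 < C ∧
      ∀ (U : ℝ → VectorMixing.Torus d L → VectorMixing.Vec d)
        (G : ℝ → VectorMixing.Torus d L → VectorMixing.Mat d)
        (u₀ : VectorMixing.Torus d L → VectorMixing.Vec d),
        VectorMixing.IsAdmissibleVelocity q U G →
        VectorMixing.IsInitialDatum u₀ →
        -- the bound for every spectral approximation
        (∀ (N : ℕ) (v : ℝ → VectorMixing.Torus d L → VectorMixing.Vec d),
          VectorMixing.IsSpectralSolution N U u₀ v →
          ∀ t : ℝ, 0 ≤ t →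
            VectorMixing.mixingLowerBound d α r C t
                (VectorMixing.homSobolevNorm (-α) (v 0)) (VectorMixing.l2Norm (v 0))
                (VectorMixing.supLqNorm q
                  (fun τ => VectorMixing.gradient (VectorMixing.truncate N (U τ))))
              ≤ VectorMixing.homSobolevNorm (-α) (v t)) ∧
        -- the bound and the minimal mixing time for every limit of the approximations
        (∀ v : ℕ → ℝ → VectorMixing.Torus d L → VectorMixing.Vec d,
          (∀ N, VectorMixing.IsSpectralSolution N U u₀ (v N)) →
          ∀ u : ℝ → VectorMixing.Torus d L → VectorMixing.Vec d,
            VectorMixing.IsSubsequentialLimit v u →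
            ∃ w : ℝ → VectorMixing.Torus d L → VectorMixing.Vec d,
              VectorMixing.IsContinuousRepresentative (-α) u₀ u w ∧
              (∀ t : ℝ, 0 ≤ t →
                VectorMixing.mixingLowerBound d α r C t
                    (VectorMixing.homSobolevNorm (-α) u₀) (VectorMixing.l2Norm u₀)
                    (VectorMixing.supLqNorm q G)
                  ≤ VectorMixing.homSobolevNorm (-α) (w t)) ∧
              (∀ t : ℝ, 0 ≤ t →
                ENNReal.ofReal t < VectorMixing.minimalMixingTime d α r C
                    (VectorMixing.homSobolevNorm (-α) u₀) (VectorMixing.l2Norm u₀)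
                    (VectorMixing.supLqNorm q G) →
                0 < VectorMixing.homSobolevNorm (-α) (w t))) := by
  have hd' : (1 : ℝ) ≤ d := by exact_mod_cast hd
  -- The endpoint α = 1 would force d = 0.
  have hα1' : α < 1 := by
    refine lt_of_le_of_ne hα1 ?_
    rintro rfl
    rw [sub_self, mul_zero] at hcrit
    linarith
  -- q = d/(1 - α) with 1 - α ≤ 1/2 and d ≥ 1.
  have hq2 : 2 ≤ q := by nlinarith
  have hL : 0 < L := Fact.out
  obtain ⟨C, hC, η, hη, hη0, hbound⟩ :=
    VectorMixing.exists_truncated_transport_bound d L hα hα1' hq hcrit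
  have hκ : 0 < 2 * Real.pi / L := div_pos (by positivity) hL
  -- The commutator constant with its volume and dimension factors, times a power of the Poincaré
  -- constant that pays for raising the exponent from p₀ to p.
  have hC' : 0 < ((2 * Real.pi / L) ^ (-α)) ^ (VectorMixing.mixingPower d α r - (1 - α) / α)
      * ((L ^ d)⁻¹ * d * C) := by
    have : (0 : ℝ) < d := by linarith
    positivity
  refine ⟨_, hC', fun U G u₀ hU hu₀ => ⟨fun N v hv t ht => ?_, fun v hv u hu => ?_⟩⟩
  · exact hv.mixingLowerBound_le hα hα1' hq2 hr hC.le
      (fun U hdiv hUm B hB a => (hbound N U hdiv hUm B hB a).1) hU ht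
  · obtain ⟨w, hw, hwt⟩ := VectorMixing.exists_representative_mixingLowerBound_le hα hα1' hq2 hr
      hC.le hη hη0 (fun N U hdiv hUm B hB a => (hbound N U hdiv hUm B hB a).2) hU hu₀ hv hu
    refine ⟨w, hw, hwt, fun t ht htm => lt_of_lt_of_le ?_ (hwt t ht)⟩
    refine VectorMixing.mixingLowerBound_pos hα hα1' hr hC'.le ht ?_ ENNReal.toReal_nonneg
      ENNReal.toReal_nonneg htm
    rw [VectorMixing.homSobolevNorm_neg_eq]
    exact Real.sqrt_nonneg _
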